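/- **Spin graphs.** All graphs are undirected, without loops or multiple links, and of finite degrees. A spin graph $\alpha=(G,s)$ is a graph $G$ with a function $s:V(G)\to S$ into a set $S$ of spin values. $O_N(v)$ is the set of vertices at graph distance at most $N$ from $v$, or the induced spin subgraph on it. $GF_n$ (resp. $GC_n$) is the set of nonempty connected finite (resp. countably infinite) spin graphs with all degrees at most $n$, and $GF=\bigcup_n GF_n$. A connected graph $G$ has scaling macrodimension $d\in[-\infty,\infty]$ if $\lim_{N\to\infty}\ln|O_N(v)|/\ln N=d$ for its vertices $v$ (the limit does not depend on $v$). **Random graph grammars.** A substitution rule $Sub=(\Gamma,\Gamma',V_0,\varphi)$ consists of finite spin graphs $\Gamma\neq\emptyset$ and $\Gamma'$, a subset $V_0\subseteq V(\Gamma)$ and a map $\varphi:V_0\to V(\Gamma')$. If $\psi$ is an isomorphism of $\Gamma$ onto a (not necessarily induced) spin subgraph $\Gamma_1$ of $\alpha$, the transformed graph $T(Sub,\psi)\alpha$ is obtained from the disjoint union of $\alpha$ and $\Gamma'$ by deleting the links of $\Gamma_1$ and the vertices of $\psi(V(\Gamma)\setminus V_0)$ with all their links, and identifying $\psi(v)$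 with $\varphi(v)$ for $v\in V_0$ (any resulting loops are dropped and multiple links merged); vertices coming from $\Gamma'$ carry the spins of $\Gamma'$, and the others keep their spins. Whether the substitution is possible at $\psi$ may moreover depend, through a prescribed isomorphism-invariant condition, on the induced spin subgraph on the neighbourhood of some fixed radius of $\psi(V(\Gamma))$. A random graph grammar is a finite set of rules $Sub_i$ with rates $\lambda_i>0$. It defines the minimal continuous-time Markov chain on finite spin graphs in which each possible transformation $T(Sub_i,\psi)$ occurs at rate $\lambda_i$. The grammar is *local* if all $\Gamma_i$ are connected, and *locally bounded* if, for all sufficiently large $n$, $GF_n$ and $GC_n$ are invariant under all possible transformations (in particular connectedness is preserved). **Local reversibility.** Consider the chain on $GF$ up to isomorphism, with transition rates $\lambda_{ij}$, and the directed graph having a link from $i$ to $j\ne i$ iff $\lambda_{ij}>0$. The chain is *reversible* if $\lambda_{ij}>0$ implies $\lambda_{ji}>0$ and, with $a_{ij}=\lambda_{ij}/\lambda_{ji}$, one has $a_{i_1i_2}a_{i_2i_3}\cdots a_{i_mi_1}=1$ for every cycle of links of any length $m\ge2$. It is *locally reversible* if it is reversible and there is $n_0<\infty$ such that, for functions $a$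 with values in $\mathbb R\setminus\{0\}$ on the set of links, these relations for all cycles follow from those for the cycles of length at most $n_0$. **Infinite-volume dynamics.** Let $\alpha(0)=(G(0),s(0))\in GC_n$ for some $n$, and fix a vertex $0$ of it. Let $\xi^N$ be the Markov chain started at the finite spin graph $O_N(0)$. Name the initial vertices $(v,0)$, $v\in V(G(0))$, and let the vertices created by a transformation $T(Sub_i,\psi)$ get names $(v,j)$, where $v$ is the first component of the name of $\psi$ of a fixed vertex of $\Gamma_i$ and the $j$ are larger than all second components in current use with $v$; a vertex obtained by identification with old ones keeps one of their names. A random process $\alpha(t)=(G(t),s(t))$, $t\ge0$, of spin graphs with vertices named in $V(G(0))\times\mathbb N$ is the infinite-volume dynamics started at $\alpha(0)$ if it is the thermodynamic limit of the $\xi^N$: for all times $t_1\le\dots\le t_m$ and all events $A_1,\dots,A_m$, each prescribing the spin graph (presence and spins of the vertices, links) inside a finite set of names, $$P\big(\alpha(t_1)\in A_1,\dots,\alpha(t_m)\in A_m\big)=\lim_{N\to\infty}P\big(\xi^N(t_1)\in A_1,\dots,\xi^N(t_m)\in A_m\big).$$ **Theorem.** Assume that the random graph grammar is local, locally bounded and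 locally reversible. Let $\alpha(0)\in GC_n$ for some $n$ be such that $G(0)$ has scaling macrodimension $d\in[-\infty,\infty]$, and let $\alpha(t)=(G(t),s(t))$, $t\ge 0$, be the infinite-volume dynamics started at $\alpha(0)$. Then for every $t\ge0$, almost surely $G(t)$ has scaling macrodimension $d$. -/

import Mathlib

open MeasureTheory Filter Topology
open scoped NNReal ENNReal

noncomputable section

namespace GraphGrammar

/-! ### Spin graphs -/

/-- A spin graph whose vertices are named by some of the elements of the label type `L`: the
vertices are the labels that carry a spin, and links join vertices only. -/
structure SpinGraph (L : Type*) (S : Type*) where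
  graph : SimpleGraph L
  spin : L → Option S
  isSome_of_adj : ∀ u v, graph.Adj u v → (spin u).isSome

namespace SpinGraph

variable {L L' V S : Type*}

/-- The vertex set. -/
def verts (x : SpinGraph L S) : Set L := {v | (x.spin v).isSome}

/-- Vertex set of the `N`-neighbourhood `O_N(v)`. -/
def ball (x : SpinGraph L S) (v : L) (N : ℕ) : Set L := {u | x.graph.edist v u ≤ N}

/-- The spin graph is nonempty and any two vertices are joined by a path. -/
def IsConnected (x : SpinGraph L S) : Prop :=
  x.verts.Nonempty ∧ ∀ u ∈ x.verts, ∀ v ∈ x.verts, x.graph.Reachable u v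

/-- Every vertex has degree at most `n`. -/
def DegreeLE (x : SpinGraph L S) (n : ℕ) : Prop :=
  ∀ v ∈ x.verts, (x.graph.neighborSet v).encard ≤ n

/-- Finite connected spin graphs with degrees at most `n`. -/
def InGF (n : ℕ) (x : SpinGraph L S) : Prop :=
  x.verts.Finite ∧ x.IsConnected ∧ x.DegreeLE n

/-- Countably infinite connected spin graphs with degrees at most `n`. -/
def InGC (n : ℕ) (x : SpinGraph L S) : Prop :=
  x.verts.Infinite ∧ x.verts.Countable ∧ x.IsConnected ∧ x.DegreeLE n

/-- Isomorphism of spin graphs. -/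
def IsIso (x : SpinGraph L S) (y : SpinGraph L' S) : Prop :=
  ∃ e : x.verts ≃ y.verts,
    (∀ u v : x.verts, x.graph.Adj u v ↔ y.graph.Adj (e u) (e v)) ∧
    ∀ u : x.verts, x.spin u = y.spin (e u)

/-- The regular subgraph on the vertices lying in `U`. -/
def restrict (x : SpinGraph L S) (U : Set L) : SpinGraph L S where
  graph :=
    { Adj := fun u v => u ∈ U ∧ v ∈ U ∧ x.graph.Adj u v
      symm := ⟨fun _ _ h => ⟨h.2.1, h.1, h.2.2.symm⟩⟩
      loopless := ⟨fun _ h => x.graph.loopless.irrefl _ h.2.2⟩ }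
  spin := open Classical in fun u => if u ∈ U then x.spin u else none
  isSome_of_adj := by
    intro u v h
    rw [if_pos h.1]
    exact x.isSome_of_adj u v h.2.2

/-- The same spin graph, with the vertex `v` renamed `(v, 0)`. -/
def embed (x : SpinGraph V S) : SpinGraph (V × ℕ) S where
  graph :=
    { Adj := fun p q => p.2 = 0 ∧ q.2 = 0 ∧ x.graph.Adj p.1 q.1
      symm := ⟨fun _ _ h => ⟨h.2.1, h.1, h.2.2.symm⟩⟩
      loopless := ⟨fun _ h => x.graph.loopless.irrefl _ h.2.2⟩ }
  spin := fun p => if p.2 = 0 then x.spin p.1 else none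
  isSome_of_adj := by
    intro p q h
    rw [if_pos h.1]
    exact x.isSome_of_adj _ _ h.2.2

/-- `d` is the scaling macrodimension: `ln |O_N(v)| / ln N` tends to `d ∈ [-∞, ∞]` as `N → ∞`,
for every vertex `v` (all the neighbourhoods being finite). -/
def HasScalingMacrodim (x : SpinGraph L S) (d : EReal) : Prop :=
  x.verts.Nonempty ∧ ∀ v ∈ x.verts, (∀ N, (x.ball v N).Finite) ∧
    Tendsto (fun N : ℕ => ((Real.log ((x.ball v N).ncard : ℝ) / Real.log (N : ℝ) : ℝ) : EReal))
      atTop (𝓝 d)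

/-- The two spin graphs look the same inside the set of labels `W`. -/
def AgreeOn (W : Set L) (x y : SpinGraph L S) : Prop :=
  (∀ u ∈ W, x.spin u = y.spin u) ∧
    ∀ u ∈ W, ∀ v ∈ W, (x.graph.Adj u v ↔ y.graph.Adj u v)

/-- A local event: the configuration inside a finite set of labels is prescribed. -/
def IsCylinder (A : Set (SpinGraph L S)) : Prop :=
  ∃ (W : Finset L) (y : SpinGraph L S), A = {x | AgreeOn (W : Set L) x y}

end SpinGraph

open SpinGraph

/-! ### Substitution rules -/

/-- A substitution rule `(Γ, Γ', V₀, φ)`, with `Γ` on `k + 1` vertices and `Γ'` on `k'` vertices.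
The possibility of the substitution may depend on the neighbourhood (of some radius) of the place
where it is made: `allowed m H σ` says whether it may be made when this neighbourhood consists
of the vertices of `Γ` (left summand) and of `m` further vertices, with links `H` and
spins `σ`. The constant predicate `True` gives the unconditional rule. -/
structure Rule (S : Type*) where
  k : ℕ
  k' : ℕ
  Γ : SimpleGraph (Fin (k + 1))
  s : Fin (k + 1) → S
  Γ' : SimpleGraph (Fin k')
  s' : Fin k' → S
  V₀ : Set (Fin (k + 1))
  φ : V₀ → Fin k'
  radius : ℕ
  allowed : (m : ℕ) → SimpleGraph (Fin (k + 1) ⊕ Fin m) → (Fin (k + 1) ⊕ Fin m → S) → Prop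

namespace Rule

variable {L S : Type*} (ρ : Rule S)

/-- `ψ` is an isomorphism of `Γ` onto a (not necessarily regular) spin subgraph of `x`. -/
def IsEmbedding (x : SpinGraph L S) (ψ : Fin (ρ.k + 1) → L) : Prop :=
  Function.Injective ψ ∧ (∀ v, x.spin (ψ v) = some (ρ.s v)) ∧
    ∀ u v, ρ.Γ.Adj u v → x.graph.Adj (ψ u) (ψ v)

/-- The neighbourhood of `ψ(Γ)` in `x` allows the substitution. -/
def IsAllowedAt (x : SpinGraph L S) (ψ : Fin (ρ.k + 1) → L) : Prop :=
  ∃ (m : ℕ) (e : Fin m → L) (σ : Fin (ρ.k + 1) ⊕ Fin m → S),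
    Function.Injective e ∧
    Set.range e = (⋃ v, x.ball (ψ v) ρ.radius) \ Set.range ψ ∧
    (∀ z, x.spin (Sum.elim ψ e z) = some (σ z)) ∧
    ρ.allowed m (x.graph.comap (Sum.elim ψ e)) σ

/-- The transformation `T(ρ, ψ)` of `x` is possible. -/
def Applicable (x : SpinGraph L S) (ψ : Fin (ρ.k + 1) → L) : Prop :=
  ρ.IsEmbedding x ψ ∧ ρ.IsAllowedAt x ψ

/-- The labels `new` are available as names for new vertices. -/
def IsNew (x : SpinGraph L S) (new : Fin ρ.k' → L) : Prop :=
  Function.Injective new ∧ ∀ w, new w ∉ x.verts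

open Classical in
/-- The name in the transformed graph of the vertex `w` of `Γ'`: when `w` is identified with
vertices `ψ v`, one of their names; otherwise a new name. -/
def place (ψ : Fin (ρ.k + 1) → L) (new : Fin ρ.k' → L) (w : Fin ρ.k') : L :=
  if h : ∃ v : ρ.V₀, ρ.φ v = w then ψ h.choose else new w

open Classical in
/-- The effect of the identifications `ψ v ∼ φ v` (`v ∈ V₀`) on the old vertices. -/
def rename (ψ : Fin (ρ.k + 1) → L) (new : Fin ρ.k' → L) (p : L) : L :=
  if h : ∃ v : ρ.V₀, ψ v = p then ρ.place ψ new (ρ.φ h.choose) else p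

/-- A link of `x` that is not deleted: it is not a link of `ψ(Γ)`, and neither of its ends is
in `ψ(V ∖ V₀)`. -/
def KeptLink (x : SpinGraph L S) (ψ : Fin (ρ.k + 1) → L) (u v : L) : Prop :=
  x.graph.Adj u v ∧ (¬ ∃ a b, ρ.Γ.Adj a b ∧ ψ a = u ∧ ψ b = v) ∧
    u ∉ ψ '' ρ.V₀ᶜ ∧ v ∉ ψ '' ρ.V₀ᶜ

open Classical in
/-- The transformed graph `T(ρ, ψ) x`, its new vertices being named by `new`. Loops and multiple
links that an identification may produce are dropped and merged. -/
def substitute (x : SpinGraph L S) (ψ : Fin (ρ.k + 1) → L) (new : Fin ρ.k' → L) :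
    SpinGraph L S where
  graph := SimpleGraph.fromRel fun p q =>
    (∃ w w', ρ.Γ'.Adj w w' ∧ ρ.place ψ new w = p ∧ ρ.place ψ new w' = q) ∨
    (∃ u v, ρ.KeptLink x ψ u v ∧ ρ.rename ψ new u = p ∧ ρ.rename ψ new v = q)
  spin := fun p =>
    if h : ∃ w, ρ.place ψ new w = p then some (ρ.s' h.choose)
    else if p ∈ Set.range ψ then none
    else x.spin p
  isSome_of_adj := by
    have key : ∀ u v, ρ.KeptLink x ψ u v →
        (∃ w, ρ.place ψ new w = ρ.rename ψ new u) ∨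
          (ρ.rename ψ new u ∉ Set.range ψ ∧ (x.spin (ρ.rename ψ new u)).isSome) := by
      intro u v h
      by_cases hu : ∃ a : ρ.V₀, ψ a = u
      · left
        exact ⟨ρ.φ hu.choose, by simp only [rename, dif_pos hu]⟩
      · right
        have hr : ρ.rename ψ new u = u := by simp only [rename, dif_neg hu]
        rw [hr]
        refine ⟨?_, x.isSome_of_adj u v h.1⟩
        rintro ⟨a, rfl⟩
        by_cases ha : a ∈ ρ.V₀
        · exact hu ⟨⟨a, ha⟩, rfl⟩
        · exact h.2.2.1 ⟨a, ha, rfl⟩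
    have symmK : ∀ u v, ρ.KeptLink x ψ u v → ρ.KeptLink x ψ v u := by
      rintro u v ⟨h1, h2, h3, h4⟩
      exact ⟨h1.symm, fun ⟨a, b, hab, ha, hb⟩ => h2 ⟨b, a, hab.symm, hb, ha⟩, h4, h3⟩
    have fin : ∀ p, ((∃ w, ρ.place ψ new w = p) ∨ (p ∉ Set.range ψ ∧ (x.spin p).isSome)) →
        (if h : ∃ w, ρ.place ψ new w = p then some (ρ.s' h.choose)
          else if p ∈ Set.range ψ then none else x.spin p).isSome := by
      intro p hp
      by_cases hw : ∃ w, ρ.place ψ new w = p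
      · rw [dif_pos hw]; rfl
      · rw [dif_neg hw]
        obtain hp | hp := hp
        · exact absurd hp hw
        · rw [if_neg hp.1]; exact hp.2
    intro p q h
    rw [SimpleGraph.fromRel_adj] at h
    apply fin
    rcases h.2 with (⟨w, w', -, hw, -⟩ | ⟨u, v, huv, rfl, -⟩) |
      (⟨w, w', -, -, hw⟩ | ⟨u, v, huv, -, rfl⟩)
    · exact Or.inl ⟨w, hw⟩
    · exact key u v huv
    · exact Or.inl ⟨w', hw⟩
    · exact key v u (symmK u v huv)

end Rule

/-! ### Random graph grammars -/

/-- A random graph grammar: finitely many substitution rules, with positive rates. -/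
structure RandomGrammar (S : Type*) where
  r : ℕ
  rule : Fin r → Rule S
  rate : Fin r → ℝ
  rate_pos : ∀ i, 0 < rate i

/-- Finite connected spin graphs whose vertices are named by natural numbers. -/
def FinGraph (S : Type*) : Type _ := {x : SpinGraph ℕ S // x.verts.Finite ∧ x.IsConnected}

/-- Isomorphism is an equivalence relation. -/
instance finGraphSetoid (S : Type*) : Setoid (FinGraph S) where
  r x y := IsIso x.1 y.1
  iseqv :=
    { refl := fun _ => ⟨Equiv.refl _, fun _ _ => Iff.rfl, fun _ => rfl⟩
      symm := by
        rintro x y ⟨e, h1, h2⟩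
        refine ⟨e.symm, fun u v => ?_, fun u => ?_⟩
        · rw [h1, e.apply_symm_apply, e.apply_symm_apply]
        · rw [h2, e.apply_symm_apply]
      trans := by
        rintro x y z ⟨e, h1, h2⟩ ⟨f, h3, h4⟩
        exact ⟨e.trans f, fun u v => (h1 u v).trans (h3 _ _), fun u => (h2 u).trans (h4 _)⟩ }

/-- The state space `GF`: finite connected spin graphs up to isomorphism. -/
def GF (S : Type*) : Type _ := Quotient (finGraphSetoid S)

/-- A spin graph representing a state. -/
def GF.rep {S : Type*} (c : GF S) : SpinGraph ℕ S := (Quotient.out c).1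

namespace RandomGrammar

variable {S : Type*} (𝓖 : RandomGrammar S)

/-- The graph grammar is local: all the graphs `Γ_i` are connected. -/
def IsLocal : Prop := ∀ i, (𝓖.rule i).Γ.Connected

/-- The graph grammar is locally bounded: for all sufficiently large `n`, the set of finite and
the set of countable connected spin graphs with degrees at most `n` are invariant under all
substitutions. -/
def IsLocallyBounded : Prop :=
  ∃ n₀ : ℕ, ∀ n ≥ n₀, ∀ (L : Type) (x : SpinGraph L S) (i : Fin 𝓖.r)
    (ψ : Fin ((𝓖.rule i).k + 1) → L) (new : Fin (𝓖.rule i).k' → L),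
    (𝓖.rule i).Applicable x ψ → (𝓖.rule i).IsNew x new →
      (InGF n x → InGF n ((𝓖.rule i).substitute x ψ new)) ∧
      (InGC n x → InGC n ((𝓖.rule i).substitute x ψ new))

/-- The possible transformations of `x`: a rule with an embedding of its `Γ` into `x`. -/
def Occurrence {L : Type*} (x : SpinGraph L S) : Type _ :=
  {o : (i : Fin 𝓖.r) × (Fin ((𝓖.rule i).k + 1) → L) // (𝓖.rule o.1).Applicable x o.2}

/-! ### Local reversibility -/

open Classical in
/-- The transition rate `λ_{cc'}` of the Markov chain on `GF`. -/
def transitionRate (c c' : GF S) : ℝ :=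
  ∑' o : 𝓖.Occurrence c.rep,
    if ∃ new, (𝓖.rule o.1.1).IsNew c.rep new ∧
        IsIso ((𝓖.rule o.1.1).substitute c.rep o.1.2 new) c'.rep
    then 𝓖.rate o.1.1 else 0

/-- There is a link from the state `c` to the state `c'`. -/
def Link (c c' : GF S) : Prop := c ≠ c' ∧ 0 < 𝓖.transitionRate c c'

/-- `(c 0, c 1), …, (c (n - 1), c n)` is a cycle of length `n ≥ 2` of links. -/
def IsCycle (n : ℕ) (c : ℕ → GF S) : Prop :=
  2 ≤ n ∧ c n = c 0 ∧ ∀ j < n, 𝓖.Link (c j) (c (j + 1))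

/-- The Markov chain on `GF` is reversible. -/
def IsReversible : Prop :=
  (∀ c c', 𝓖.Link c c' → 𝓖.Link c' c) ∧
  ∀ n c, 𝓖.IsCycle n c →
    ∏ j ∈ Finset.range n,
      𝓖.transitionRate (c j) (c (j + 1)) / 𝓖.transitionRate (c (j + 1)) (c j) = 1

/-- The Markov chain on `GF` is locally reversible: it is reversible and, for some `n₀`, the
relations `a(cycle) = 1` for cycles of arbitrary length (at any state) follow from those for
cycles of length at most `n₀`, for nonvanishing real functions `a` on the set of links. -/
def IsLocallyReversible : Prop :=
  𝓖.IsReversible ∧ ∃ n₀ : ℕ, ∀ c₀ : GF S, ∀ a : GF S → GF S → ℝ,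
    (∀ c c', 𝓖.Link c c' → a c c' ≠ 0) →
    (∀ n ≤ n₀, ∀ c, 𝓖.IsCycle n c → ∏ j ∈ Finset.range n, a (c j) (c (j + 1)) = 1) →
    ∀ n c, 𝓖.IsCycle n c → c 0 = c₀ → ∏ j ∈ Finset.range n, a (c j) (c (j + 1)) = 1

/-! ### The finite-volume Markov chains

To follow individual vertices, the chains run on graphs with named vertices: the initial vertices
are `(v, 0)`, and the vertices created by a transformation `T(Sub_i, ψ)` get the first component
of `ψ 0` and fresh second components. -/

section Chain

variable {V : Type*}

/-- Names for the vertices created by a transformation. -/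
def newLabel (x : SpinGraph (V × ℕ) S) (v : V) {k' : ℕ} (w : Fin k') : V × ℕ :=
  (v, sSup {j | (v, j) ∈ x.verts} + 1 + w)

variable {𝓖} in
/-- The result of a possible transformation of `x`. -/
def Occurrence.result {x : SpinGraph (V × ℕ) S} (o : 𝓖.Occurrence x) : SpinGraph (V × ℕ) S :=
  (𝓖.rule o.1.1).substitute x o.1.2 (newLabel x (o.1.2 0).1)

/-- The total rate of transformations of `x`. -/
def totalRate (x : SpinGraph (V × ℕ) S) : ℝ := ∑' o : 𝓖.Occurrence x, 𝓖.rate o.1.1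

/-- `E[f(ξ(t)); exactly j transformations during [0, t]]` for the Markov chain `ξ` started at `x`,
in which every possible transformation occurs at its rate. -/
def semigroupAux : ℕ → ℝ → (SpinGraph (V × ℕ) S → ℝ≥0∞) → SpinGraph (V × ℕ) S → ℝ≥0∞
  | 0, t, f, x => ENNReal.ofReal (Real.exp (-(𝓖.totalRate x * t))) * f x
  | j + 1, t, f, x => ∫⁻ u in Set.Ioc 0 t, ∑' o : 𝓖.Occurrence x,
      ENNReal.ofReal (𝓖.rate o.1.1 * Real.exp (-(𝓖.totalRate x * u))) *
        semigroupAux j (t - u) f o.result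

/-- `E[f(ξ(t))]` for the (minimal) Markov chain `ξ` started at `x`. -/
def semigroup (t : ℝ) (f : SpinGraph (V × ℕ) S → ℝ≥0∞) (x : SpinGraph (V × ℕ) S) : ℝ≥0∞ :=
  ∑' j, 𝓖.semigroupAux j t f x

/-- Finite-dimensional distributions of the chain `ξ` started at `x`: for a list
`(τ₁, A₁), …, (τ_m, A_m)`, the probability that `ξ(τ₁ + ⋯ + τ_l) ∈ A_l` for `l = 1, …, m`. -/
def fdd : List (ℝ≥0 × Set (SpinGraph (V × ℕ) S)) → SpinGraph (V × ℕ) S → ℝ≥0∞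
  | [], _ => 1
  | (τ, A) :: l, x => 𝓖.semigroup τ (A.indicator (fdd l)) x

end Chain

end RandomGrammar

/-! ### The infinite-volume dynamics -/

/-- The event that `X (s + τ₁ + ⋯ + τ_l) ∈ A_l` for `l = 1, …, m`. -/
def pathEvent {E Ω : Type*} (X : ℝ≥0 → Ω → E) : ℝ≥0 → List (ℝ≥0 × Set E) → Set Ω
  | _, [] => Set.univ
  | s, (τ, A) :: l => X (s + τ) ⁻¹' A ∩ pathEvent X (s + τ) l

/-- The random process `X` of spin graphs is the infinite-volume dynamics started at the spin
graph `α`: it is the thermodynamic limit of the finite-volume Markov chains `ξ^N` started at the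
`N`-neighbourhoods of the vertex `o` in `α`. That is, its finite-dimensional distributions on
local events are the limits, as `N → ∞`, of those of `ξ^N`. -/
structure IsDynamics {S V Ω : Type*} [MeasurableSpace Ω] (𝓖 : RandomGrammar S)
    (α : SpinGraph V S) (o : V) (P : Measure Ω) (X : ℝ≥0 → Ω → SpinGraph (V × ℕ) S) : Prop where
  measurable : ∀ t A, IsCylinder A → MeasurableSet (X t ⁻¹' A)
  limit : ∀ l : List (ℝ≥0 × Set (SpinGraph (V × ℕ) S)), (∀ p ∈ l, IsCylinder p.2) →
    Tendsto (fun N : ℕ => 𝓖.fdd l (α.restrict (α.ball o N)).embed) atTop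
      (𝓝 (P (pathEvent X 0 l)))

end GraphGrammar

end

noncomputable section

namespace GraphGrammar

/-! ### Balls, distances and degree bounds in spin graphs. -/

namespace SpinGraph

variable {L S : Type*}

/-! Each substitution replaces a region of at most `C` vertices and diameter at most `C` by another
such region, and every vertex is affected at rate at most `c`; the constants depend only on the
grammar and on the degree bound (`RandomGrammar.exists_controlled`). Over a fixed time `t` the
geometry is therefore distorted, on large scales, only by a bounded factor in distances and by a
factor in volumes that can be kept subpolynomial. The macrodimension ignores both.

The first component of a name records an ancestor in `G(0)`, so a vertex `p` of `G(t)` over `v` can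
be compared with `v` itself. Two bounds are needed. Upper bound: the ball of radius `R` around `p`
lies over the ball of radius `2 ^ k * R` around `v`, and the number of vertices over that ball has
not grown much. Lower bound: the descendants of the `R`-ball of `v` are still numerous and lie
within distance `2 ^ k * R` of `p`.

All probabilities are estimated by the Markov inequality from functions `F` of time and state with
`∂F/∂t ≥ ∑ λ (F after - F before)`; such an `F` dominates the semigroup
(`IsSupersolution.semigroup_le`). Descendants are over-approximated by marks: as soon as a region
contains a mark, the whole new region is marked. The functions used are essentially the number of
marks, its inverse, a bound for second components of names, an exponential moment of distances
between marks (`supersolution_distSum`, showing that distances do not grow much) and a sum of powers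
of Green functions (`supersolution_potential`, showing that they do not shrink much).

The last one is the delicate one, since shrinking of distances involves all paths and not just one
geodesic. The Green function sums `z ^ length` over all walks, weighted by a function that is large
far from `v`. A local move changes it additively by a term bounded through the Green function of the
region, and the total rate of change is controlled by the iterated Green function, which an entropy
estimate (`green_green_le`) bounds by `ζ log (8 / ζ)`, up to a constant, for Green function value
`ζ`. The resulting growth is of Osgood type: `ζ` at time `t` is controlled by a power `ζ ^ exp (-β
t)` of its initial value, and an initial value exponentially small in the distance stays
exponentially small.

These estimates are uniform in the volume. They pass to the infinite-volume dynamics through local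
events, monotone limits over finite sets of labels, and a tightness argument for the lower bound on
balls (`measure_ball_le`). Applied to radii `2 ^ j`, they have summable error probabilities when
volume factors `(j + 1) ^ 2` are allowed; Borel–Cantelli and monotonicity in the radius give the
theorem. -/

theorem mem_verts_of_adj {x : SpinGraph L S} {u v : L} (h : x.graph.Adj u v) : u ∈ x.verts :=
  x.isSome_of_adj u v h

theorem mem_ball {x : SpinGraph L S} {v u : L} {N : ℕ} :
    u ∈ x.ball v N ↔ x.graph.edist v u ≤ N := Iff.rfl

theorem mem_ball_self (x : SpinGraph L S) (v : L) (N : ℕ) : v ∈ x.ball v N := by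
  simp [mem_ball]

theorem mem_ball_comm {x : SpinGraph L S} {v u : L} {N : ℕ} : u ∈ x.ball v N ↔ v ∈ x.ball u N := by
  rw [mem_ball, mem_ball, SimpleGraph.edist_comm]

theorem ball_mono (x : SpinGraph L S) (v : L) {N M : ℕ} (h : N ≤ M) : x.ball v N ⊆ x.ball v M :=
  fun _ hu => le_trans (mem_ball.1 hu) (by exact_mod_cast h)

theorem mem_ball_trans {x : SpinGraph L S} {u v w : L} {N M : ℕ} (h : v ∈ x.ball u N)
    (h' : w ∈ x.ball v M) : w ∈ x.ball u (N + M) := by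
  rw [mem_ball] at *
  push_cast
  exact (SimpleGraph.edist_triangle).trans (add_le_add h h')

theorem mem_ball_one_of_adj {x : SpinGraph L S} {u v : L} (h : x.graph.Adj u v) :
    v ∈ x.ball u 1 := by
  rw [mem_ball]
  exact le_of_eq (by exact_mod_cast SimpleGraph.edist_eq_one_iff_adj.2 h)

theorem mem_ball_zero {x : SpinGraph L S} {u v : L} : u ∈ x.ball v 0 ↔ v = u := by
  simp [mem_ball, SimpleGraph.edist_eq_zero_iff]

theorem exists_walk_of_mem_ball {x : SpinGraph L S} {u v : L} {N : ℕ} (h : u ∈ x.ball v N) :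
    ∃ p : x.graph.Walk v u, p.length ≤ N := by
  have hne : x.graph.edist v u ≠ ⊤ := ne_top_of_le_ne_top (ENat.natCast_ne_top N) h
  obtain ⟨p, hp⟩ := SimpleGraph.exists_walk_of_edist_ne_top hne
  exact ⟨p, by have h' := mem_ball.1 h; rw [← hp] at h'; exact_mod_cast h'⟩

theorem mem_ball_of_walk {x : SpinGraph L S} {u v : L} {N : ℕ} (p : x.graph.Walk v u)
    (h : p.length ≤ N) : u ∈ x.ball v N :=
  (SimpleGraph.edist_le p).trans (by exact_mod_cast h)

theorem mem_ball_succ {x : SpinGraph L S} {u v : L} {N : ℕ} :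
    u ∈ x.ball v (N + 1) ↔ u = v ∨ ∃ w ∈ x.ball v N, x.graph.Adj w u := by
  constructor
  · intro h
    obtain ⟨p, hp⟩ := exists_walk_of_mem_ball (mem_ball_comm.1 h)
    cases p with
    | nil => exact Or.inl rfl
    | cons hadj q =>
      refine Or.inr ⟨_, mem_ball_comm.1 (mem_ball_of_walk q ?_), hadj.symm⟩
      simpa using hp
  · rintro (rfl | ⟨w, hw, h⟩)
    · exact mem_ball_self _ _ _
    · exact mem_ball_trans hw (mem_ball_one_of_adj h)

theorem ball_subset_verts {x : SpinGraph L S} {v : L} (hv : v ∈ x.verts) (N : ℕ) :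
    x.ball v N ⊆ x.verts := by
  intro u hu
  cases N with
  | zero => rwa [← mem_ball_zero.1 hu]
  | succ N =>
    rcases mem_ball_succ.1 hu with rfl | ⟨w, -, h⟩
    · exact hv
    · exact mem_verts_of_adj h.symm

theorem neighborSet_encard_le {x : SpinGraph L S} {n : ℕ} (hx : x.DegreeLE n) (v : L) :
    (x.graph.neighborSet v).encard ≤ n := by
  by_cases hv : v ∈ x.verts
  · exact hx v hv
  · have : x.graph.neighborSet v = ∅ := by
      ext u
      simp only [SimpleGraph.mem_neighborSet, Set.mem_empty_iff_false, iff_false]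
      exact fun h => hv (mem_verts_of_adj h)
    simp [this]

/-- The set of neighbours of `v` is the coercion of a finset with at most `n` elements. -/
theorem exists_finset_neighborSet {x : SpinGraph L S} {n : ℕ} (hx : x.DegreeLE n) (v : L) :
    ∃ s : Finset L, (∀ u, u ∈ s ↔ x.graph.Adj v u) ∧ s.card ≤ n := by
  have h := neighborSet_encard_le hx v
  have hf : (x.graph.neighborSet v).Finite := Set.finite_of_encard_le_coe h
  refine ⟨hf.toFinset, fun u => by simp, ?_⟩
  rw [hf.encard_eq_coe_toFinset_card] at h
  exact_mod_cast h

/-- A ball of radius `N` has at most `(n + 1) ^ N` elements. -/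
theorem exists_finset_ball {x : SpinGraph L S} {n : ℕ} (hx : x.DegreeLE n) (v : L) (N : ℕ) :
    ∃ s : Finset L, (∀ u, u ∈ s ↔ u ∈ x.ball v N) ∧ s.card ≤ (n + 1) ^ N := by
  classical
  induction N with
  | zero => exact ⟨{v}, fun u => by rw [mem_ball_zero, Finset.mem_singleton, eq_comm], by simp⟩
  | succ N ih =>
    obtain ⟨s, hs, hc⟩ := ih
    choose t ht htc using exists_finset_neighborSet hx
    refine ⟨s.biUnion fun w => insert w (t w), fun u => ?_, ?_⟩
    · simp only [Finset.mem_biUnion, Finset.mem_insert, hs, ht]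
      constructor
      · rintro ⟨w, hw, rfl | h⟩
        · exact ball_mono x v (Nat.le_succ N) hw
        · exact mem_ball_succ.2 (Or.inr ⟨w, hw, h⟩)
      · intro h
        rcases mem_ball_succ.1 h with rfl | ⟨w, hw, h⟩
        · exact ⟨u, mem_ball_self _ _ _, Or.inl rfl⟩
        · exact ⟨w, hw, Or.inr h⟩
    · refine (Finset.card_biUnion_le_card_mul _ _ (n + 1) fun w _ => ?_).trans ?_
      · exact (Finset.card_insert_le _ _).trans (Nat.succ_le_succ (htc w))
      · rw [pow_succ]
        exact Nat.mul_le_mul_right _ hc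

theorem ball_finite {x : SpinGraph L S} {n : ℕ} (hx : x.DegreeLE n) (v : L) (N : ℕ) :
    (x.ball v N).Finite := by
  obtain ⟨s, hs, -⟩ := exists_finset_ball hx v N
  exact s.finite_toSet.subset fun u hu => (hs u).2 hu

theorem ball_ncard_le {x : SpinGraph L S} {n : ℕ} (hx : x.DegreeLE n) (v : L) (N : ℕ) :
    (x.ball v N).ncard ≤ (n + 1) ^ N := by
  obtain ⟨s, hs, hc⟩ := exists_finset_ball hx v N
  rwa [show x.ball v N = (s : Set L) from Set.ext fun u => (hs u).symm, Set.ncard_coe_finset]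

theorem exists_mem_ball {x : SpinGraph L S} (hx : x.IsConnected) {u v : L} (hu : u ∈ x.verts)
    (hv : v ∈ x.verts) : ∃ N, v ∈ x.ball u N := by
  obtain ⟨p⟩ := hx.2 u hu v hv
  exact ⟨p.length, mem_ball_of_walk p le_rfl⟩

/-! ### Restriction -/

theorem restrict_adj {x : SpinGraph L S} {W : Set L} {u v : L} :
    (x.restrict W).graph.Adj u v ↔ u ∈ W ∧ v ∈ W ∧ x.graph.Adj u v := Iff.rfl

theorem restrict_spin_of_mem {x : SpinGraph L S} {W : Set L} {u : L} (hu : u ∈ W) :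
    (x.restrict W).spin u = x.spin u := if_pos hu

theorem verts_restrict (x : SpinGraph L S) (W : Set L) : (x.restrict W).verts = x.verts ∩ W := by
  ext u
  by_cases hu : u ∈ W
  · simp [verts, restrict, hu]
  · simp [verts, restrict, hu]

theorem restrict_graph_le (x : SpinGraph L S) (W : Set L) : (x.restrict W).graph ≤ x.graph :=
  fun _ _ h => h.2.2

theorem ball_mono_graph {x y : SpinGraph L S} (h : x.graph ≤ y.graph) (v : L) (N : ℕ) :
    x.ball v N ⊆ y.ball v N :=
  fun _ hu => (SimpleGraph.edist_anti h).trans (mem_ball.1 hu)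

theorem ball_restrict {x : SpinGraph L S} {W : Set L} {v : L} {R : ℕ} (hW : x.ball v R ⊆ W)
    {N : ℕ} (hN : N ≤ R) : (x.restrict W).ball v N = x.ball v N := by
  refine (ball_mono_graph (restrict_graph_le x W) v N).antisymm ?_
  induction N with
  | zero => intro u hu; rw [mem_ball_zero] at *; exact hu
  | succ N ih =>
    intro u hu
    have huR := hW (ball_mono x v hN hu)
    rcases mem_ball_succ.1 hu with rfl | ⟨w, hw, h⟩
    · exact mem_ball_self _ _ _
    · exact mem_ball_succ.2 (Or.inr ⟨w, ih (by omega) hw,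
        hW (ball_mono x v (by omega) hw), huR, h⟩)

theorem DegreeLE.restrict {x : SpinGraph L S} {n : ℕ} (hx : x.DegreeLE n) (W : Set L) :
    (x.restrict W).DegreeLE n := fun v _ =>
  (Set.encard_le_encard fun _ h => restrict_graph_le x W h).trans (neighborSet_encard_le hx v)

theorem DegreeLE.mono {x : SpinGraph L S} {n m : ℕ} (hx : x.DegreeLE n) (h : n ≤ m) :
    x.DegreeLE m := fun v hv => (hx v hv).trans (by exact_mod_cast h)

/-- In a finite connected spin graph, distances are at most the number of vertices. -/
theorem mem_ball_card {x : SpinGraph L S} {s : Finset L} (hs : x.verts ⊆ s) {u v : L}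
    (h : x.graph.Reachable u v) (hu : u ∈ x.verts) : v ∈ x.ball u s.card := by
  classical
  obtain ⟨p, hp⟩ := h.exists_isPath
  refine mem_ball_of_walk p ?_
  have hsub : p.support.toFinset ⊆ s := by
    intro w hw
    rw [List.mem_toFinset] at hw
    have : w ∈ x.ball u p.length :=
      mem_ball_of_walk (p.takeUntil w hw) (p.length_takeUntil_le_length hw)
    exact hs (ball_subset_verts hu _ this)
  have := Finset.card_le_card hsub
  rw [List.toFinset_card_of_nodup hp.support_nodup, SimpleGraph.Walk.length_support] at this
  omega

/-! ### Local moves -/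

/-- The spin graphs `x` and `y` differ only in that the region `U` of `x` is replaced by the
region `U'` of `y`. -/
structure LocalMove (C : ℕ) (x y : SpinGraph L S) (U U' : Finset L) : Prop where
  sub : ∀ p ∈ U, p ∈ x.verts
  sub' : ∀ p ∈ U', p ∈ y.verts
  card : U.card ≤ C
  card' : U'.card ≤ C
  nonempty : U.Nonempty
  nonempty' : U'.Nonempty
  mem_iff : ∀ p, (p ∈ x.verts ∧ p ∉ U) ↔ (p ∈ y.verts ∧ p ∉ U')
  adj_iff : ∀ p ∈ x.verts, p ∉ U → ∀ q, x.graph.Adj p q ↔ y.graph.Adj p q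
  diam : ∀ p ∈ U, ∀ q ∈ U, q ∈ x.ball p C
  diam' : ∀ p ∈ U', ∀ q ∈ U', q ∈ y.ball p C

namespace LocalMove

variable {C : ℕ} {x y : SpinGraph L S} {U U' : Finset L}

/-- A link at a vertex outside `U` survives, so its other end is a vertex of `y`; the vertices of
`U` that survive all lie in `U'`. -/
theorem mem_of_adj (h : LocalMove C x y U U') {p q : L} (hp : p ∈ x.verts) (hpU : p ∉ U)
    (hpq : x.graph.Adj p q) (hq : q ∈ U) : q ∈ U' := by
  by_contra hq'
  exact ((h.mem_iff q).2 ⟨mem_verts_of_adj ((h.adj_iff p hp hpU q).1 hpq).symm, hq'⟩).2 hq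

/-- The walk is followed up to its first vertex in `U`. By `mem_of_adj` this vertex also lies in
`U'`, from where `q'` is within distance `C`. -/
theorem mem_ball_of_walk_to (h : LocalMove C x y U U') {p q : L} (w : x.graph.Walk p q)
    (hp : p ∈ x.verts) (hpU : p ∉ U) (hq : q ∈ U) {q' : L} (hq' : q' ∈ U') :
    q' ∈ y.ball p (w.length + C) := by
  induction w with
  | nil => exact absurd hq hpU
  | @cons a b c hab w ih =>
    have hy := mem_ball_one_of_adj ((h.adj_iff a hp hpU b).1 hab)
    by_cases hb : b ∈ U
    · have := mem_ball_trans hy (h.diam' b (h.mem_of_adj hp hpU hab hb) q' hq')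
      refine ball_mono y a ?_ this
      simp only [SimpleGraph.Walk.length_cons]; omega
    · have := mem_ball_trans hy (ih (mem_verts_of_adj hab.symm) hb hq)
      refine ball_mono y a ?_ this
      simp only [SimpleGraph.Walk.length_cons]; omega

/-- A walk avoiding the region is also a walk of the other graph. -/
theorem mem_ball_of_walk_avoiding (h : LocalMove C x y U U') {p q : L} (w : x.graph.Walk p q)
    (hp : p ∈ x.verts) (hw : ∀ a ∈ w.support, a ∉ U) : q ∈ y.ball p w.length := by
  induction w with
  | nil => exact mem_ball_self _ _ _
  | @cons a b c hab w ih =>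
    have hy := mem_ball_one_of_adj ((h.adj_iff a hp (hw a (by simp)) b).1 hab)
    have := mem_ball_trans hy (ih (mem_verts_of_adj hab.symm) fun d hd => hw d (by simp [hd]))
    refine ball_mono y a ?_ this
    simp only [SimpleGraph.Walk.length_cons]; omega

/-- The cost `C` is paid once, however often the walk visits `U`: its first entry into `U` and its
last exit are both in `U'`, and the part between them is replaced by a path of length at most `C`.
-/
theorem mem_ball_of_walk_outside (h : LocalMove C x y U U') {p q : L} (w : x.graph.Walk p q)
    (hp : p ∈ x.verts) (hpU : p ∉ U) (hqU : q ∉ U) : q ∈ y.ball p (w.length + C) := by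
  induction w with
  | nil => exact mem_ball_self _ _ _
  | @cons a b c hab w ih =>
    have hy := mem_ball_one_of_adj ((h.adj_iff a hp hpU b).1 hab)
    by_cases hb : b ∈ U
    · cases w with
      | nil => exact absurd hb hqU
      | cons hbd w =>
        have hc : c ∈ x.verts := by
          have := mem_ball_of_walk (w.cons hbd) le_rfl
          exact ball_subset_verts (mem_verts_of_adj hab.symm) _ this
        have := mem_ball_trans hy (mem_ball_comm.1
          (h.mem_ball_of_walk_to (w.cons hbd).reverse hc hqU hb
          (h.mem_of_adj hp hpU hab hb)))
        refine ball_mono y a ?_ this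
        simp only [SimpleGraph.Walk.length_cons, SimpleGraph.Walk.length_reverse]; omega
    · have := mem_ball_trans hy (ih (mem_verts_of_adj hab.symm) hb hqU)
      refine ball_mono y a ?_ this
      simp only [SimpleGraph.Walk.length_cons]; omega

/-- Vertices correspond to each other when they are equal and outside the regions, or both in the
regions. Corresponding distances change by at most `C`. -/
theorem mem_ball_add (h : LocalMove C x y U U') {p q p' q' : L} {N : ℕ} (hp : p ∈ x.verts)
    (hq : q ∈ x.verts) (hpp : (p ∉ U ∧ p' = p) ∨ (p ∈ U ∧ p' ∈ U'))
    (hqq : (q ∉ U ∧ q' = q) ∨ (q ∈ U ∧ q' ∈ U')) (hN : q ∈ x.ball p N) :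
    q' ∈ y.ball p' (N + C) := by
  obtain ⟨w, hw⟩ := exists_walk_of_mem_ball hN
  rcases hpp with ⟨hpU, rfl⟩ | ⟨hpU, hp'⟩ <;> rcases hqq with ⟨hqU, rfl⟩ | ⟨hqU, hq'⟩
  · exact ball_mono y _ (by omega) (h.mem_ball_of_walk_outside w hp hpU hqU)
  · exact ball_mono y _ (by omega) (h.mem_ball_of_walk_to w hp hpU hqU hq')
  · refine mem_ball_comm.1 (ball_mono y _ ?_ (h.mem_ball_of_walk_to w.reverse hq hqU hpU hp'))
    simp only [SimpleGraph.Walk.length_reverse]; omega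
  · exact ball_mono y _ (by omega) (h.diam' p' hp' q' hq')

end LocalMove

end SpinGraph

end GraphGrammar

/-! ### Substitutions are local moves. -/

namespace GraphGrammar

open SpinGraph

namespace Rule

variable {L S : Type*} {ρ : Rule S} {x : SpinGraph L S} {ψ : Fin (ρ.k + 1) → L}
  {new : Fin ρ.k' → L}

theorem place_mem_range_or_eq (ρ : Rule S) (ψ : Fin (ρ.k + 1) → L) (new : Fin ρ.k' → L)
    (w : Fin ρ.k') :
    ρ.place ψ new w ∈ Set.range ψ ∨ ρ.place ψ new w = new w := by
  unfold place
  split_ifs with h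
  · exact Or.inl ⟨_, rfl⟩
  · exact Or.inr rfl

theorem rename_of_notMem (ρ : Rule S) {ψ : Fin (ρ.k + 1) → L}
    (new : Fin ρ.k' → L) {p : L} (hp : p ∉ Set.range ψ) :
    ρ.rename ψ new p = p := by
  unfold rename
  rw [dif_neg]
  rintro ⟨v, rfl⟩
  exact hp ⟨_, rfl⟩

theorem rename_eq_place_or_eq (ρ : Rule S) (ψ : Fin (ρ.k + 1) → L) (new : Fin ρ.k' → L) (p : L) :
    (∃ w, ρ.place ψ new w = ρ.rename ψ new p) ∨ ρ.rename ψ new p = p := by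
  unfold rename
  split_ifs with h
  · exact Or.inl ⟨_, rfl⟩
  · exact Or.inr rfl

theorem mem_verts_substitute {p : L} : p ∈ (ρ.substitute x ψ new).verts ↔
    (∃ w, ρ.place ψ new w = p) ∨ (p ∉ Set.range ψ ∧ p ∈ x.verts) := by
  simp only [verts, substitute, Set.mem_ofPred_eq]
  by_cases h : ∃ w, ρ.place ψ new w = p
  · rw [dif_pos h]; simp [h]
  · rw [dif_neg h]
    by_cases hp : p ∈ Set.range ψ
    · rw [if_pos hp]; simp only [h, hp]; simp
    · rw [if_neg hp]; simp only [h, hp]; simp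

theorem substitute_spin (ρ : Rule S) (x : SpinGraph L S) (ψ : Fin (ρ.k + 1) → L)
    (new : Fin ρ.k' → L) (p : L) :
    (ρ.substitute x ψ new).spin p = none ∨ (ρ.substitute x ψ new).spin p = x.spin p ∨
      ∃ w, (ρ.substitute x ψ new).spin p = some (ρ.s' w) := by
  simp only [substitute]
  split_ifs with h h'
  · exact Or.inr (Or.inr ⟨_, rfl⟩)
  · exact Or.inl rfl
  · exact Or.inr (Or.inl rfl)

theorem KeptLink.symm {u v : L} (h : ρ.KeptLink x ψ u v) : ρ.KeptLink x ψ v u :=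
  ⟨h.1.symm, fun ⟨a, b, hab, ha, hb⟩ => h.2.1 ⟨b, a, hab.symm, hb, ha⟩, h.2.2.2, h.2.2.1⟩

theorem keptLink_of_notMem {u v : L} (h : x.graph.Adj u v) (hu : u ∉ Set.range ψ)
    (hv : v ∉ Set.range ψ) : ρ.KeptLink x ψ u v :=
  ⟨h, fun ⟨a, _, _, ha, _⟩ => hu ⟨a, ha⟩, fun ⟨a, _, ha⟩ => hu ⟨a, ha⟩,
    fun ⟨a, _, ha⟩ => hv ⟨a, ha⟩⟩

/-- A vertex outside `ψ(Γ)` that is not adjacent to it keeps its links. -/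
theorem adj_substitute_iff (hnew : ρ.IsNew x new) {p : L} (hp : p ∈ x.verts)
    (hpψ : p ∉ Set.range ψ) (hpn : ∀ a, ¬ x.graph.Adj (ψ a) p) (q : L) :
    x.graph.Adj p q ↔ (ρ.substitute x ψ new).graph.Adj p q := by
  have hplace : ∀ w, ρ.place ψ new w ≠ p := by
    intro w hw
    rcases place_mem_range_or_eq ρ ψ new w with h | h
    · exact hpψ (hw ▸ h)
    · exact hnew.2 w (by rw [← h, hw]; exact hp)
  have hr : ∀ u v, ρ.KeptLink x ψ u v → ρ.rename ψ new u = p → ρ.rename ψ new v = q →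
      x.graph.Adj p q := by
    intro u v h hu hv
    have hup : u = p := by
      rcases rename_eq_place_or_eq ρ ψ new u with ⟨w, hw⟩ | h'
      · exact absurd (hw.trans hu) (hplace w)
      · rw [← h', hu]
    subst hup
    have hvr : v ∉ Set.range ψ := by
      rintro ⟨a, rfl⟩
      exact hpn a h.1.symm
    rw [rename_of_notMem ρ new hvr] at hv
    exact hv ▸ h.1
  simp only [substitute, SimpleGraph.fromRel_adj]
  constructor
  · intro h
    have hqr : q ∉ Set.range ψ := by
      rintro ⟨a, rfl⟩
      exact hpn a h.symm
    exact ⟨h.ne, Or.inl (Or.inr ⟨p, q, keptLink_of_notMem h hpψ hqr,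
      rename_of_notMem ρ new hpψ, rename_of_notMem ρ new hqr⟩)⟩
  · rintro ⟨-, (⟨w, w', -, hw, -⟩ | ⟨u, v, h, hu, hv⟩) | (⟨w, w', -, -, hw⟩ | ⟨u, v, h, hu, hv⟩)⟩
    · exact absurd hw (hplace w)
    · exact hr u v h hu hv
    · exact absurd hw (hplace w')
    · exact hr v u h.symm hv hu

/-- Turns paths in the transformed window into paths in the whole transformed graph. -/
theorem substitute_graph_mono {x' : SpinGraph L S} (h : x'.graph ≤ x.graph) :
    (ρ.substitute x' ψ new).graph ≤ (ρ.substitute x ψ new).graph := by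
  intro p q
  simp only [substitute, SimpleGraph.fromRel_adj]
  have hk : ∀ u v, ρ.KeptLink x' ψ u v → ρ.KeptLink x ψ u v := fun u v hk => ⟨h hk.1, hk.2⟩
  rintro ⟨hne, (h' | ⟨u, v, h', hu, hv⟩) | (h' | ⟨u, v, h', hu, hv⟩)⟩
  · exact ⟨hne, Or.inl (Or.inl h')⟩
  · exact ⟨hne, Or.inl (Or.inr ⟨u, v, hk u v h', hu, hv⟩)⟩
  · exact ⟨hne, Or.inr (Or.inl h')⟩
  · exact ⟨hne, Or.inr (Or.inr ⟨u, v, hk u v h', hu, hv⟩)⟩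

/-- The part of `x` near `ψ(Γ)` on which the possibility of the substitution depends. -/
def window (ρ : Rule S) (x : SpinGraph L S) (ψ : Fin (ρ.k + 1) → L) : Set L :=
  -- The additional 1 places all neighbours of `ψ(Γ)` in the window even for radius 0.
  ⋃ v, x.ball (ψ v) (ρ.radius + 1)

theorem mem_window (ρ : Rule S) (x : SpinGraph L S) (ψ : Fin (ρ.k + 1) → L) (v) :
    ψ v ∈ ρ.window x ψ :=
  Set.mem_iUnion.2 ⟨v, mem_ball_self _ _ _⟩

/-- Everything inspected by the rule lies in the window, so invariance of `GF_n` can be applied to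
the window as a spin graph of its own. This is what makes the diameter of the new region bounded. -/
theorem applicable_window (h : ρ.Applicable x ψ) :
    ρ.Applicable (x.restrict (ρ.window x ψ)) ψ := by
  obtain ⟨⟨hinj, hspin, hadj⟩, m, e, σ, he, hrange, hσ, hall⟩ := h
  have hball : ∀ v, (x.restrict (ρ.window x ψ)).ball (ψ v) ρ.radius = x.ball (ψ v) ρ.radius :=
    fun v => ball_restrict (R := ρ.radius + 1) (Set.subset_iUnion_of_subset v subset_rfl)
      (Nat.le_succ _)
  have hmem : ∀ z, Sum.elim ψ e z ∈ ρ.window x ψ := by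
    rintro (v | j)
    · exact mem_window ρ x ψ v
    · have : e j ∈ (⋃ v, x.ball (ψ v) ρ.radius) \ Set.range ψ := hrange ▸ ⟨j, rfl⟩
      obtain ⟨v, hv⟩ := Set.mem_iUnion.1 this.1
      exact Set.mem_iUnion.2 ⟨v, ball_mono x _ (Nat.le_succ _) hv⟩
  refine ⟨⟨hinj, fun v => ?_, fun u v h => ?_⟩, m, e, σ, he, ?_, fun z => ?_, ?_⟩
  · rw [restrict_spin_of_mem (mem_window ρ x ψ v), hspin]
  · exact ⟨mem_window ρ x ψ u, mem_window ρ x ψ v, hadj u v h⟩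
  · simp only [hball, hrange]
  · rw [restrict_spin_of_mem (hmem z), hσ]
  · convert hall using 1
    ext a b
    simp only [SimpleGraph.comap_adj, restrict_adj]
    exact ⟨fun h => h.2.2, fun h => ⟨hmem a, hmem b, h⟩⟩

/-- Locality enters here: a connected `Γ` links the centres of the balls that make up the window. -/
theorem window_connected (hΓ : ρ.Γ.Connected) (h : ρ.IsEmbedding x ψ) :
    (x.restrict (ρ.window x ψ)).IsConnected := by
  have hv : ∀ v, ψ v ∈ x.verts := fun v => by
    change (x.spin (ψ v)).isSome
    rw [h.2.1 v]; rfl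
  have hψ : ∀ u v, (x.restrict (ρ.window x ψ)).graph.Reachable (ψ u) (ψ v) := by
    intro u v
    let f : ρ.Γ →g (x.restrict (ρ.window x ψ)).graph :=
      ⟨ψ, fun {a b} hab => ⟨mem_window ρ x ψ a, mem_window ρ x ψ b, h.2.2 a b hab⟩⟩
    exact (hΓ.preconnected u v).map f
  have hw : ∀ p ∈ (x.restrict (ρ.window x ψ)).verts,
      ∃ v, (x.restrict (ρ.window x ψ)).graph.Reachable (ψ v) p := by
    intro p hp
    rw [verts_restrict] at hp
    obtain ⟨v, hpv⟩ := Set.mem_iUnion.1 hp.2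
    rw [← ball_restrict (R := ρ.radius + 1) (W := ρ.window x ψ)
      (Set.subset_iUnion_of_subset v subset_rfl) le_rfl] at hpv
    obtain ⟨w, -⟩ := exists_walk_of_mem_ball hpv
    exact ⟨v, ⟨w⟩⟩
  refine ⟨⟨ψ 0, ?_⟩, fun p hp q hq => ?_⟩
  · rw [verts_restrict]
    exact ⟨hv 0, mem_window ρ x ψ 0⟩
  · obtain ⟨u, hu⟩ := hw p hp
    obtain ⟨v, hv⟩ := hw q hq
    exact hu.symm.trans ((hψ u v).trans hv)

/-- A substitution whose result, and whose restriction to the window, stay in `GF_n` is a local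
move. -/
theorem exists_localMove {n : ℕ} (hx : x.InGF n) (hΓ : ρ.Γ.Connected) (happ : ρ.Applicable x ψ)
    (hnew : ρ.IsNew x new) (hy : (ρ.substitute x ψ new).InGF n)
    (hw : (x.restrict (ρ.window x ψ)).InGF n →
      (ρ.substitute (x.restrict (ρ.window x ψ)) ψ new).InGF n) {C : ℕ}
    (hC : (ρ.k + 1) * (n + 1) ^ (ρ.radius + 1) + ρ.k' ≤ C) :
    ∃ U U' : Finset L, LocalMove C x (ρ.substitute x ψ new) U U' ∧ (∀ v, ψ v ∈ U) ∧
      ∀ p ∈ U', p ∉ x.verts → ∃ w, p = new w := by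
  classical
  choose b hb hbc using fun v => exists_finset_ball hx.2.2 (ψ v) (ρ.radius + 1)
  set B : Finset L := Finset.univ.biUnion b with hB
  have hBW : ∀ p, p ∈ B ↔ p ∈ ρ.window x ψ := by
    intro p; simp [hB, hb, window]
  have hBc : B.card ≤ (ρ.k + 1) * (n + 1) ^ (ρ.radius + 1) := by
    refine (Finset.card_biUnion_le_card_mul _ _ _ fun v _ => hbc v).trans ?_
    simp
  have hψv : ∀ v, ψ v ∈ x.verts := fun v => by
    change (x.spin (ψ v)).isSome
    rw [happ.1.2.1 v]; rfl
  have hBx : ∀ p ∈ B, p ∈ x.verts := by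
    intro p hp
    obtain ⟨v, hv⟩ := Set.mem_iUnion.1 ((hBW p).1 hp)
    exact ball_subset_verts (hψv v) _ hv
  set x' := x.restrict (ρ.window x ψ) with hx'
  have hx'v : ∀ p, p ∈ x'.verts ↔ p ∈ B := by
    intro p
    rw [hx', verts_restrict, hBW]
    exact ⟨fun h => h.2, fun h => ⟨hBx p ((hBW p).2 h), h⟩⟩
  have hconn := window_connected hΓ happ.1
  have hx'n : x'.InGF n := ⟨B.finite_toSet.subset fun p hp => (hx'v p).1 hp, hconn,
    hx.2.2.restrict _⟩
  have hy' := hw hx'n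
  set y := ρ.substitute x ψ new with hydef
  set y' := ρ.substitute x' ψ new with hy'def
  -- Neighbours of `ψ(Γ)` belong to the region, since their links may be redirected by deletions and
  -- identifications; all other vertices keep their links.
  set U : Finset L := B.filter fun p => p ∈ Set.range ψ ∨ ∃ a, x.graph.Adj (ψ a) p with hU
  set P : Finset L := Finset.univ.image (ρ.place ψ new) with hP
  have hPm : ∀ p, p ∈ P ↔ ∃ w, ρ.place ψ new w = p := by intro p; simp [hP]
  set U' : Finset L := P ∪ U.filter fun p => p ∉ Set.range ψ with hU'
  have hUm : ∀ p, p ∈ U ↔ p ∈ Set.range ψ ∨ ∃ a, x.graph.Adj (ψ a) p := by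
    intro p
    rw [hU, Finset.mem_filter, and_iff_right_iff_imp]
    rintro (⟨v, rfl⟩ | ⟨v, hv⟩)
    · exact (hBW _).2 (mem_window ρ x ψ v)
    · exact (hBW _).2 (Set.mem_iUnion.2 ⟨v, ball_mono x _ (by omega) (mem_ball_one_of_adj hv)⟩)
  have hUB : ∀ p ∈ U, p ∈ B := fun p hp => (Finset.mem_filter.1 hp).1
  have hU'm : ∀ p, p ∈ U' ↔ p ∈ P ∨ (p ∈ U ∧ p ∉ Set.range ψ) := by
    intro p; simp [hU']
  have hPx : ∀ p ∈ P, p ∈ x.verts → p ∈ Set.range ψ := by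
    intro p hp hpx
    obtain ⟨w, rfl⟩ := (hPm p).1 hp
    rcases place_mem_range_or_eq ρ ψ new w with h | h
    · exact h
    · exact absurd (h ▸ hpx) (hnew.2 w)
  have hy'v : ∀ p ∈ U', p ∈ y'.verts := by
    intro p hp
    rw [hy'def, mem_verts_substitute]
    rcases (hU'm p).1 hp with h | h
    · exact Or.inl ((hPm p).1 h)
    · exact Or.inr ⟨h.2, (hx'v p).2 (hUB p h.1)⟩
  have hyv : ∀ p ∈ U', p ∈ y.verts := by
    intro p hp
    rw [hydef, mem_verts_substitute]
    rcases (hU'm p).1 hp with h | h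
    · exact Or.inl ((hPm p).1 h)
    · exact Or.inr ⟨h.2, hBx p (hUB p h.1)⟩
  have hmem : ∀ p, (p ∈ x.verts ∧ p ∉ U) ↔ (p ∈ y.verts ∧ p ∉ U') := by
    intro p
    rw [hydef, mem_verts_substitute, hU'm, ← hPm]
    have h1 : p ∈ Set.range ψ → p ∈ U := fun h => (hUm p).2 (Or.inl h)
    have h2 := hPx p
    tauto
  have hadj : ∀ p ∈ x.verts, p ∉ U → ∀ q, x.graph.Adj p q ↔ y.graph.Adj p q := by
    intro p hp hpU
    rw [hUm] at hpU
    push Not at hpU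
    exact adj_substitute_iff hnew hp hpU.1 hpU.2
  have hψU : ∀ v, ψ v ∈ U := fun v => (hUm _).2 (Or.inl ⟨v, rfl⟩)
  have hPc : (B ∪ P).card ≤ C := by
    refine (Finset.card_union_le _ _).trans (le_trans (add_le_add hBc ?_) hC)
    exact Finset.card_image_le.trans (by simp)
  have hBC : B.card ≤ C := (Finset.card_le_card Finset.subset_union_left).trans hPc
  refine ⟨U, U', ⟨fun p hp => hBx p (hUB p hp), hyv, ?_, ?_, ⟨ψ 0, hψU 0⟩, ?_, hmem, hadj, ?_,
    ?_⟩, hψU, ?_⟩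
  · exact (Finset.card_le_card (Finset.filter_subset _ _)).trans hBC
  · refine (Finset.card_le_card ?_).trans hPc
    intro p hp
    rcases (hU'm p).1 hp with h | h
    · exact Finset.mem_union_right _ h
    · exact Finset.mem_union_left _ (hUB p h.1)
  -- If `U'` were empty, a surviving vertex `p` would be joined to `ψ 0` in `x` by a path that
  -- enters `U`; by preservation of links the entry point would survive, hence lie in `U'`.
  · obtain ⟨p, hp⟩ := hy.2.1.1
    by_contra hne
    rw [Finset.not_nonempty_iff_eq_empty] at hne
    obtain ⟨hpx, hpU⟩ := (hmem p).2 ⟨hp, by simp [hne]⟩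
    obtain ⟨w⟩ := hx.2.1.2 p hpx (ψ 0) (hψv 0)
    have key : ∀ {a b : L} (w : x.graph.Walk a b), a ∈ x.verts → a ∉ U → b ∉ U := by
      intro a b w
      induction w with
      | nil => exact fun _ h => h
      | @cons a b c hab w ih =>
        intro ha haU
        refine ih (mem_verts_of_adj hab.symm) fun hbU => ?_
        have := mem_verts_of_adj ((hadj a ha haU b).1 hab).symm
        exact ((hmem b).2 ⟨this, by simp [hne]⟩).2 hbU
    exact key w hpx hpU (hψU 0)
  · intro p hp q hq
    have hpv := (hx'v p).2 (hUB p hp)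
    have := mem_ball_card (x := x') (s := B) (fun a ha => (hx'v a).1 ha)
      (hconn.2 p hpv q ((hx'v q).2 (hUB q hq))) hpv
    exact ball_mono x p hBC (ball_mono_graph (restrict_graph_le _ _) _ _ this)
  -- The transformed window `y'` is connected because the grammar preserves `GF_n`, and it has at
  -- most as many vertices as `B ∪ P`. Its paths are paths of `y`.
  · intro p hp q hq
    have hpv := hy'v p hp
    have := mem_ball_card (x := y') (s := B ∪ P) (fun a ha => ?_)
      (hy'.2.1.2 p hpv q (hy'v q hq)) hpv
    · exact ball_mono y p hPc
        (ball_mono_graph (substitute_graph_mono (restrict_graph_le _ _)) _ _ this)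
    · rw [hy'def, mem_verts_substitute, ← hPm, hx'v] at ha
      simp only [Finset.coe_union, Set.mem_union, Finset.mem_coe]
      tauto
  · intro p hp hpx
    rcases (hU'm p).1 hp with h | h
    · obtain ⟨w, rfl⟩ := (hPm p).1 h
      rcases place_mem_range_or_eq ρ ψ new w with ⟨v, hv⟩ | h
      · exact absurd (hv ▸ hψv v) hpx
      · exact ⟨w, h⟩
    · exact absurd (hBx p (hUB p h.1)) hpx

end Rule

end GraphGrammar

/-! ### Uniform constants for all rules of the grammar. -/

namespace GraphGrammar

open SpinGraph

namespace RandomGrammar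

variable {S V : Type*}

theorem isNew_newLabel {x : SpinGraph (V × ℕ) S} (hx : x.verts.Finite) (ρ : Rule S) (v : V) :
    ρ.IsNew x (newLabel x v) := by
  refine ⟨fun a b h => ?_, fun w hw => ?_⟩
  · simp only [newLabel, Prod.mk.injEq, true_and] at h
    exact Fin.ext (by omega)
  · have hfin : {j | (v, j) ∈ x.verts}.Finite :=
      hx.preimage (f := fun j : ℕ => (v, j)) fun a _ b _ h => (Prod.mk.injEq _ _ _ _ ▸ h).2
    have := le_csSup hfin.bddAbove (show _ ∈ {j | (v, j) ∈ x.verts} from hw)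
    omega

theorem finite_occurrence (𝓖 : RandomGrammar S) {L : Type*} {x : SpinGraph L S}
    (hx : x.verts.Finite) : Finite (𝓖.Occurrence x) := by
  classical
  set T : Finset ((i : Fin 𝓖.r) × (Fin ((𝓖.rule i).k + 1) → L)) :=
    Finset.univ.sigma fun i => Fintype.piFinset fun _ => hx.toFinset
  have hT : {o : (i : Fin 𝓖.r) × (Fin ((𝓖.rule i).k + 1) → L) |
      (𝓖.rule o.1).Applicable x o.2}.Finite := by
    refine T.finite_toSet.subset fun o ho => ?_
    simp only [T, Finset.coe_sigma, Set.mem_sigma_iff, Finset.mem_coe, Finset.mem_univ, true_and,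
      Fintype.mem_piFinset, Set.Finite.mem_toFinset]
    intro a
    change (x.spin (o.2 a)).isSome
    rw [ho.1.2.1 a]; rfl
  exact hT.to_subtype

/-- Uniform control, in the class of connected finite graphs with degrees at most `n`, of the
transformations and of the rates at which vertices are affected by them. The region `U x o` of
`x` is replaced by the region `U' x o` of the transformed graph. -/
structure Controlled (𝓖 : RandomGrammar S) (V : Type*) (n C : ℕ) (c : ℝ)
    (U U' : ∀ x : SpinGraph (V × ℕ) S, 𝓖.Occurrence x → Finset (V × ℕ)) : Prop where
  result : ∀ {x : SpinGraph (V × ℕ) S}, x.InGF n → ∀ o : 𝓖.Occurrence x, o.result.InGF n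
  move : ∀ {x : SpinGraph (V × ℕ) S}, x.InGF n → ∀ o : 𝓖.Occurrence x,
    LocalMove C x o.result (U x o) (U' x o)
  rate : ∀ {x : SpinGraph (V × ℕ) S}, x.InGF n → ∀ p,
    ∑' o : 𝓖.Occurrence x, 𝓖.rate o.1.1 * (U x o : Set (V × ℕ)).indicator 1 p ≤ c
  label : ∀ {x : SpinGraph (V × ℕ) S}, x.InGF n → ∀ o : 𝓖.Occurrence x, ∀ p ∈ U' x o,
    p ∉ x.verts → ∃ a ∈ U x o, a.1 = p.1 ∧ p.2 ≤ sSup {j | (p.1, j) ∈ x.verts} + C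

theorem occurrence_result_spin {𝓖 : RandomGrammar S} {x : SpinGraph (V × ℕ) S}
    (o : 𝓖.Occurrence x) (p : V × ℕ) :
    o.result.spin p = none ∨ o.result.spin p = x.spin p ∨
      ∃ i w, o.result.spin p = some ((𝓖.rule i).s' w) := by
  rcases Rule.substitute_spin (𝓖.rule o.1.1) x o.1.2 (newLabel x (o.1.2 0).1) p with h | h | ⟨w, h⟩
  · exact Or.inl h
  · exact Or.inr (Or.inl h)
  · exact Or.inr (Or.inr ⟨_, w, h⟩)

/-- `C` dominates, for every rule, the size of a window plus the number of created vertices. A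
transformation whose region contains `p` has all of `ψ(Γ)` within distance `C` of `p`, so `ψ` is one
of boundedly many maps into a ball; this bounds the rate. -/
theorem exists_controlled (𝓖 : RandomGrammar S) (hlocal : 𝓖.IsLocal)
    (hbounded : 𝓖.IsLocallyBounded) (V : Type) :
    ∃ n₀ : ℕ, ∀ n ≥ n₀, ∃ (C : ℕ) (c : ℝ)
      (U U' : ∀ x : SpinGraph (V × ℕ) S, 𝓖.Occurrence x → Finset (V × ℕ)),
      0 < c ∧ 𝓖.Controlled V n C c U U' := by
  classical
  obtain ⟨n₀, hn₀⟩ := hbounded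
  refine ⟨n₀, fun n hn => ?_⟩
  set C : ℕ := ∑ i, (((𝓖.rule i).k + 1) * (n + 1) ^ ((𝓖.rule i).radius + 1) + (𝓖.rule i).k')
    with hC
  have hCi : ∀ i, ((𝓖.rule i).k + 1) * (n + 1) ^ ((𝓖.rule i).radius + 1) + (𝓖.rule i).k' ≤ C :=
    fun i => Finset.single_le_sum (f := fun i =>
      ((𝓖.rule i).k + 1) * (n + 1) ^ ((𝓖.rule i).radius + 1) + (𝓖.rule i).k')
      (fun _ _ => Nat.zero_le _) (Finset.mem_univ i)
  have hres : ∀ {x : SpinGraph (V × ℕ) S}, x.InGF n → ∀ o : 𝓖.Occurrence x,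
      o.result.InGF n := fun hx o =>
    (hn₀ n hn _ _ o.1.1 o.1.2 _ o.2 (isNew_newLabel hx.1 _ _)).1 hx
  have key : ∀ (x : SpinGraph (V × ℕ) S) (o : 𝓖.Occurrence x), ∃ U U' : Finset (V × ℕ),
      x.InGF n → LocalMove C x o.result U U' ∧ (∀ v, o.1.2 v ∈ U) ∧
      ∀ p ∈ U', p ∉ x.verts → ∃ w, p = newLabel x (o.1.2 0).1 (k' := (𝓖.rule o.1.1).k') w := by
    intro x o
    by_cases hx : x.InGF n
    · have hnew := isNew_newLabel hx.1 (𝓖.rule o.1.1) (o.1.2 0).1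
      obtain ⟨U, U', h⟩ := Rule.exists_localMove hx (hlocal o.1.1) o.2 hnew (hres hx o)
        (fun hx' => (hn₀ n hn _ _ o.1.1 o.1.2 _ (Rule.applicable_window o.2)
          ⟨hnew.1, fun w hw => hnew.2 w (by rw [verts_restrict] at hw; exact hw.1)⟩).1 hx')
        (hCi o.1.1)
      exact ⟨U, U', fun _ => h⟩
    · exact ⟨∅, ∅, fun h => absurd h hx⟩
  choose U U' hU using key
  set c : ℝ := ∑ i, 𝓖.rate i * (((n + 1) ^ C) ^ ((𝓖.rule i).k + 1) : ℕ) with hc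
  have hc0 : 0 ≤ c := Finset.sum_nonneg fun i _ => by
    have := (𝓖.rate_pos i).le
    positivity
  refine ⟨C, c + 1, U, U', by positivity, hres, fun hx o => (hU _ o hx).1, ?_, ?_⟩
  · intro x hx p
    have := 𝓖.finite_occurrence hx.1
    have := Fintype.ofFinite (𝓖.Occurrence x)
    rw [tsum_fintype]
    obtain ⟨B, hB, hBc⟩ := exists_finset_ball hx.2.2 p C
    set T : Finset ((i : Fin 𝓖.r) × (Fin ((𝓖.rule i).k + 1) → V × ℕ)) :=
      Finset.univ.sigma fun i => Fintype.piFinset fun _ => B with hT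
    calc ∑ o : 𝓖.Occurrence x, 𝓖.rate o.1.1 * (U x o : Set (V × ℕ)).indicator 1 p
        = ∑ o ∈ Finset.univ.filter (fun o : 𝓖.Occurrence x => p ∈ U x o), 𝓖.rate o.1.1 := by
          rw [Finset.sum_filter]
          refine Finset.sum_congr rfl fun o _ => ?_
          by_cases h : p ∈ U x o <;> simp [h]
      _ = ∑ o ∈ (Finset.univ.filter (fun o : 𝓖.Occurrence x => p ∈ U x o)).image
            (fun o => o.1), 𝓖.rate o.1 := by
          rw [Finset.sum_image]
          exact fun a _ b _ h => Subtype.ext h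
      _ ≤ ∑ o ∈ T, 𝓖.rate o.1 := by
          refine Finset.sum_le_sum_of_subset_of_nonneg ?_ fun o _ _ => (𝓖.rate_pos o.1).le
          intro o ho
          obtain ⟨o', ho', rfl⟩ := Finset.mem_image.1 ho
          rw [Finset.mem_filter] at ho'
          obtain ⟨hm, hψ, -⟩ := hU x o' hx
          simp only [hT, Finset.mem_sigma, Finset.mem_univ, true_and, Fintype.mem_piFinset]
          exact fun a => (hB _).2 (hm.diam p ho'.2 _ (hψ a))
      _ = ∑ i, 𝓖.rate i * ((B.card ^ ((𝓖.rule i).k + 1) : ℕ) : ℝ) := by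
          rw [hT, Finset.sum_sigma]
          refine Finset.sum_congr rfl fun i _ => ?_
          simp only [Finset.sum_const, nsmul_eq_mul, Fintype.card_piFinset, Finset.prod_const,
            Finset.card_univ, Fintype.card_fin]
          ring
      _ ≤ c := by
          refine Finset.sum_le_sum fun i _ => ?_
          refine mul_le_mul_of_nonneg_left ?_ (𝓖.rate_pos i).le
          exact_mod_cast Nat.pow_le_pow_left hBc _
      _ ≤ c + 1 := by linarith
  · intro x hx o p hp hpx
    obtain ⟨hm, hψ, hl⟩ := hU x o hx
    obtain ⟨w, rfl⟩ := hl p hp hpx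
    refine ⟨_, hψ 0, rfl, ?_⟩
    have h1 := hCi o.1.1
    have h2 : 1 ≤ ((𝓖.rule o.1.1).k + 1) * (n + 1) ^ ((𝓖.rule o.1.1).radius + 1) :=
      Nat.one_le_iff_ne_zero.2 (by positivity)
    have h3 := w.2
    simp only [newLabel]
    omega

end RandomGrammar

end GraphGrammar

namespace GraphGrammar

open SpinGraph

namespace RandomGrammar

variable {S V : Type*} {𝓖 : RandomGrammar S}

/-! ### The semigroup on functions: monotonicity and additivity -/

section Additivity

variable {n C : ℕ} {c : ℝ}
  {U U' : ∀ x : SpinGraph (V × ℕ) S, 𝓖.Occurrence x → Finset (V × ℕ)}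

/-- Measurability in time is what allows sums and integrals over the first jump time to be
interchanged in `semigroupAux_add`. -/
theorem Controlled.measurable_semigroupAux (h : 𝓖.Controlled V n C c U U')
    (f : SpinGraph (V × ℕ) S → ℝ≥0∞) (j : ℕ) {x : SpinGraph (V × ℕ) S} (hx : x.InGF n) :
    Measurable fun t => 𝓖.semigroupAux j t f x := by
  induction j generalizing x with
  | zero => simp only [semigroupAux]; fun_prop
  | succ j ih =>
    have := 𝓖.finite_occurrence hx.1
    simp only [semigroupAux]
    have hG : Measurable fun p : ℝ × ℝ => ∑' o : 𝓖.Occurrence x,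
        ENNReal.ofReal (𝓖.rate o.1.1 * Real.exp (-(𝓖.totalRate x * p.2))) *
          𝓖.semigroupAux j (p.1 - p.2) f o.result := by
      refine Measurable.tsum fun o => Measurable.mul (by fun_prop) ?_
      exact (ih (h.result hx o)).comp (measurable_fst.sub measurable_snd)
    have hset : MeasurableSet {p : ℝ × ℝ | 0 < p.2 ∧ p.2 ≤ p.1} :=
      (measurableSet_lt measurable_const measurable_snd).inter
        (measurableSet_le measurable_snd measurable_fst)
    have := (hG.indicator hset).lintegral_prod_right' (ν := volume)
    convert this using 1
    ext t
    rw [← lintegral_indicator measurableSet_Ioc]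
    rfl

theorem Controlled.semigroupAux_add (h : 𝓖.Controlled V n C c U U')
    (f g : SpinGraph (V × ℕ) S → ℝ≥0∞) (j : ℕ) (t : ℝ) {x : SpinGraph (V × ℕ) S}
    (hx : x.InGF n) : 𝓖.semigroupAux j t (f + g) x =
      𝓖.semigroupAux j t f x + 𝓖.semigroupAux j t g x := by
  induction j generalizing x t with
  | zero => simp only [semigroupAux, Pi.add_apply, mul_add]
  | succ j ih =>
    have := 𝓖.finite_occurrence hx.1
    simp only [semigroupAux]
    rw [← lintegral_add_left]
    · refine lintegral_congr fun u => ?_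
      rw [← ENNReal.tsum_add]
      exact tsum_congr fun o => by rw [ih _ (h.result hx o), mul_add]
    · refine Measurable.tsum fun o => Measurable.mul (by fun_prop) ?_
      exact (h.measurable_semigroupAux f j (h.result hx o)).comp (by fun_prop)

theorem Controlled.semigroup_add (h : 𝓖.Controlled V n C c U U')
    (f g : SpinGraph (V × ℕ) S → ℝ≥0∞) (t : ℝ) {x : SpinGraph (V × ℕ) S} (hx : x.InGF n) :
    𝓖.semigroup t (f + g) x = 𝓖.semigroup t f x + 𝓖.semigroup t g x := by
  simp only [semigroup, h.semigroupAux_add f g _ t hx, ENNReal.tsum_add]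

theorem semigroup_zero_fun (t : ℝ) (x : SpinGraph (V × ℕ) S) :
    𝓖.semigroup t 0 x = 0 := by
  have : ∀ j t (x : SpinGraph (V × ℕ) S), 𝓖.semigroupAux j t 0 x = 0 := by
    intro j
    induction j with
    | zero => intro t x; simp [semigroupAux]
    | succ j ih => intro t x; simp [semigroupAux, ih]
  simp [semigroup, this]

theorem Controlled.semigroup_sum (h : 𝓖.Controlled V n C c U U') {ι : Type*} (s : Finset ι)
    (f : ι → SpinGraph (V × ℕ) S → ℝ≥0∞) (t : ℝ) {x : SpinGraph (V × ℕ) S} (hx : x.InGF n) :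
    𝓖.semigroup t (∑ i ∈ s, f i) x = ∑ i ∈ s, 𝓖.semigroup t (f i) x := by
  classical
  induction s using Finset.induction_on with
  | empty => simpa using semigroup_zero_fun t x
  | insert i s hi ih => rw [Finset.sum_insert hi, Finset.sum_insert hi, h.semigroup_add _ _ t hx, ih]

theorem semigroup_mono {f g : SpinGraph (V × ℕ) S → ℝ≥0∞} (hfg : f ≤ g) (t : ℝ)
    (x : SpinGraph (V × ℕ) S) : 𝓖.semigroup t f x ≤ 𝓖.semigroup t g x := by
  have : ∀ j t (x : SpinGraph (V × ℕ) S), 𝓖.semigroupAux j t f x ≤ 𝓖.semigroupAux j t g x := by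
    intro j
    induction j with
    | zero => intro t x; exact mul_le_mul_right (hfg x) _
    | succ j ih =>
      intro t x
      exact lintegral_mono fun u => ENNReal.tsum_le_tsum fun o => mul_le_mul_right (ih _ _) _
  exact ENNReal.tsum_le_tsum fun j => this j t x

end Additivity

/-! ### Comparison with supersolutions -/

section Comparison

variable {D : Type*}

/-- A nonnegative function `F` of time, of a state and of auxiliary data, with
`∂F/∂t ≥ ∑_o λ_o (F(o) - F)` on `[0, T]`, the data being updated at every transformation. -/
structure IsSupersolution (𝓖 : RandomGrammar S) (Inv : SpinGraph (V × ℕ) S → D → Prop)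
    (upd : ∀ x : SpinGraph (V × ℕ) S, 𝓖.Occurrence x → D → D) (T : ℝ)
    (F : ℝ → SpinGraph (V × ℕ) S → D → ℝ) : Prop where
  nonneg : ∀ x δ, Inv x δ → ∀ t ∈ Set.Icc 0 T, 0 ≤ F t x δ
  deriv : ∀ x δ, Inv x δ → ∃ F' : ℝ → ℝ, Continuous F' ∧
    (∀ t, HasDerivAt (fun t => F t x δ) (F' t) t) ∧
    ∀ t ∈ Set.Icc 0 T,
      ∑' o : 𝓖.Occurrence x, 𝓖.rate o.1.1 * (F t o.result (upd x o δ) - F t x δ) ≤ F' t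

variable {Inv : SpinGraph (V × ℕ) S → D → Prop}
  {upd : ∀ x : SpinGraph (V × ℕ) S, 𝓖.Occurrence x → D → D} {T : ℝ}
  {F G : ℝ → SpinGraph (V × ℕ) S → D → ℝ}

theorem IsSupersolution.add (hfin : ∀ x δ, Inv x δ → x.verts.Finite)
    (hF : IsSupersolution 𝓖 Inv upd T F) (hG : IsSupersolution 𝓖 Inv upd T G) :
    IsSupersolution 𝓖 Inv upd T fun t x δ => F t x δ + G t x δ := by
  refine ⟨fun x δ h t ht => add_nonneg (hF.nonneg x δ h t ht) (hG.nonneg x δ h t ht),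
    fun x δ h => ?_⟩
  obtain ⟨F', h1, h2, h3⟩ := hF.deriv x δ h
  obtain ⟨G', k1, k2, k3⟩ := hG.deriv x δ h
  refine ⟨fun t => F' t + G' t, h1.add k1, fun t => (h2 t).add (k2 t), fun t ht => ?_⟩
  refine le_trans (le_of_eq ?_) (add_le_add (h3 t ht) (k3 t ht))
  have := 𝓖.finite_occurrence (hfin x δ h)
  have := Fintype.ofFinite (𝓖.Occurrence x)
  simp only [tsum_fintype, ← Finset.sum_add_distrib]
  exact Finset.sum_congr rfl fun o _ => by ring

theorem IsSupersolution.const_mul (hfin : ∀ x δ, Inv x δ → x.verts.Finite)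
    (hF : IsSupersolution 𝓖 Inv upd T F) {a : ℝ} (ha : 0 ≤ a) :
    IsSupersolution 𝓖 Inv upd T fun t x δ => a * F t x δ := by
  refine ⟨fun x δ h t ht => mul_nonneg ha (hF.nonneg x δ h t ht), fun x δ h => ?_⟩
  obtain ⟨F', h1, h2, h3⟩ := hF.deriv x δ h
  refine ⟨fun t => a * F' t, h1.const_mul a, fun t => (h2 t).const_mul a, fun t ht => ?_⟩
  refine le_trans (le_of_eq ?_) (mul_le_mul_of_nonneg_left (h3 t ht) ha)
  have := 𝓖.finite_occurrence (hfin x δ h)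
  have := Fintype.ofFinite (𝓖.Occurrence x)
  simp only [tsum_fintype, Finset.mul_sum]
  exact Finset.sum_congr rfl fun o _ => by ring

/-- Superadditivity suffices for upper bounds and requires no measurability of the integrands. -/
theorem sum_lintegral_le {ι : Type*} (s : Finset ι) (f : ι → ℝ → ℝ≥0∞) (μ : Measure ℝ) :
    ∑ i ∈ s, ∫⁻ u, f i u ∂μ ≤ ∫⁻ u, ∑ i ∈ s, f i u ∂μ := by
  classical
  induction s using Finset.induction_on with
  | empty => simp
  | insert i s hi ih =>
    simp only [Finset.sum_insert hi]
    exact (add_le_add_right ih _).trans (le_lintegral_add _ _)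

/-- Induction on the number of jumps, by conditioning on the first jump. Partial sums over the
number of jumps are bounded uniformly, so possible explosion of the chain plays no role. -/
theorem IsSupersolution.semigroup_le (hF : IsSupersolution 𝓖 Inv upd T F)
    (hfin : ∀ x δ, Inv x δ → x.verts.Finite)
    (hinv : ∀ x δ, Inv x δ → ∀ o : 𝓖.Occurrence x, Inv o.result (upd x o δ))
    {f : SpinGraph (V × ℕ) S → ℝ≥0∞} (h0 : ∀ x δ, Inv x δ → f x ≤ ENNReal.ofReal (F 0 x δ))
    {x : SpinGraph (V × ℕ) S} {δ : D} (hx : Inv x δ) {t : ℝ} (ht : t ∈ Set.Icc 0 T) :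
    𝓖.semigroup t f x ≤ ENNReal.ofReal (F t x δ) := by
  refine ENNReal.tsum_le_of_sum_range_le fun m => ?_
  induction m generalizing x δ t with
  | zero => simp
  | succ m ih =>
    have := 𝓖.finite_occurrence (hfin x δ hx)
    have := Fintype.ofFinite (𝓖.Occurrence x)
    obtain ⟨F', h1, h2, h3⟩ := hF.deriv x δ hx
    set q := 𝓖.totalRate x with hq
    have hqs : q = ∑ o : 𝓖.Occurrence x, 𝓖.rate o.1.1 := by rw [hq, totalRate, tsum_fintype]
    have htu : ∀ u ∈ Set.Ioc 0 t, t - u ∈ Set.Icc 0 T := fun u hu =>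
      ⟨by linarith [hu.2], by linarith [hu.1, ht.2]⟩
    -- `ϕ` is the derivative of `-(exp (-q u) * F (t - u))`. By the supersolution inequality it
    -- dominates the first-jump density at time `u`, and the boundary term of its integral is
    -- exactly the contribution of no jump.
    set ϕ : ℝ → ℝ := fun u => Real.exp (-(q * u)) * (F' (t - u) + q * F (t - u) x δ) with hϕ
    have hle : ∀ u ∈ Set.Ioc 0 t, ∑ o : 𝓖.Occurrence x, 𝓖.rate o.1.1 * Real.exp (-(q * u)) *
        F (t - u) o.result (upd x o δ) ≤ ϕ u := by
      intro u hu
      have := h3 (t - u) (htu u hu)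
      rw [tsum_fintype] at this
      simp only [mul_sub, Finset.sum_sub_distrib, ← Finset.sum_mul, ← hqs] at this
      have h4 : ∑ o : 𝓖.Occurrence x, 𝓖.rate o.1.1 * F (t - u) o.result (upd x o δ) ≤
        F' (t - u) + q * F (t - u) x δ := by linarith
      refine le_trans (le_of_eq ?_) (mul_le_mul_of_nonneg_left h4 (Real.exp_pos (-(q * u))).le)
      rw [Finset.mul_sum]
      exact Finset.sum_congr rfl fun o _ => by ring
    have hterm : ∀ u ∈ Set.Ioc 0 t, ∀ o : 𝓖.Occurrence x,
        0 ≤ 𝓖.rate o.1.1 * Real.exp (-(q * u)) * F (t - u) o.result (upd x o δ) := by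
      intro u hu o
      exact mul_nonneg (mul_nonneg (𝓖.rate_pos _).le (Real.exp_pos _).le)
        (hF.nonneg _ _ (hinv x δ hx o) _ (htu u hu))
    have hϕ0 : ∀ u ∈ Set.Ioc 0 t, 0 ≤ ϕ u := fun u hu =>
      (Finset.sum_nonneg fun o _ => hterm u hu o).trans (hle u hu)
    have hFc : Continuous fun s => F s x δ :=
      continuous_iff_continuousAt.2 fun s => (h2 s).continuousAt
    have hϕc : Continuous ϕ := by
      have h5 : Continuous fun u => F (t - u) x δ := hFc.comp (by fun_prop)
      simp only [hϕ]
      fun_prop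
    have hint : ∫ u in (0 : ℝ)..t, ϕ u = F t x δ - Real.exp (-(q * t)) * F 0 x δ := by
      have hd : ∀ u, HasDerivAt (fun u => -(Real.exp (-(q * u)) * F (t - u) x δ)) (ϕ u) u := by
        intro u
        have e1 : HasDerivAt (fun u => Real.exp (-(q * u))) (Real.exp (-(q * u)) * -(q * 1)) u :=
          (((hasDerivAt_id u).const_mul q).neg).exp
        have e2 : HasDerivAt (fun u => F (t - u) x δ) (F' (t - u) * -1) u :=
          (h2 (t - u)).comp u ((hasDerivAt_id u).const_sub t)
        refine HasDerivAt.congr_deriv (f := fun u => -(Real.exp (-(q * u)) * F (t - u) x δ))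
          (e1.mul e2).neg ?_
        simp only [hϕ]
        ring
      rw [intervalIntegral.integral_eq_sub_of_hasDerivAt (fun u _ => hd u)
        (hϕc.intervalIntegrable _ _)]
      simp; ring
    have hlint : ∫⁻ u in Set.Ioc 0 t, ENNReal.ofReal (ϕ u) =
        ENNReal.ofReal (F t x δ - Real.exp (-(q * t)) * F 0 x δ) := by
      rw [← hint, intervalIntegral.integral_of_le ht.1, ofReal_integral_eq_lintegral_ofReal]
      · exact (hϕc.integrableOn_Icc).mono_set Set.Ioc_subset_Icc_self
      · exact (ae_restrict_mem measurableSet_Ioc).mono hϕ0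
    have hnn : 0 ≤ F t x δ - Real.exp (-(q * t)) * F 0 x δ := by
      rw [← hint]
      refine intervalIntegral.integral_nonneg_of_ae_restrict ht.1 ?_
      rw [Filter.EventuallyLE, ← restrict_Ioc_eq_restrict_Icc]
      exact (ae_restrict_mem measurableSet_Ioc).mono hϕ0
    have hF0 := hF.nonneg x δ hx 0 ⟨le_rfl, ht.1.trans ht.2⟩
    rw [Finset.sum_range_succ']
    calc (∑ j ∈ Finset.range m, 𝓖.semigroupAux (j + 1) t f x) + 𝓖.semigroupAux 0 t f x
        ≤ ENNReal.ofReal (F t x δ - Real.exp (-(q * t)) * F 0 x δ) +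
          ENNReal.ofReal (Real.exp (-(q * t)) * F 0 x δ) := by
          refine add_le_add ?_ ?_
          · simp only [semigroupAux]
            refine (sum_lintegral_le _ _ _).trans ?_
            rw [← hlint]
            refine setLIntegral_mono' measurableSet_Ioc fun u hu => ?_
            simp only [tsum_fintype]
            rw [Finset.sum_comm]
            refine le_trans ?_ (ENNReal.ofReal_le_ofReal (hle u hu))
            rw [ENNReal.ofReal_sum_of_nonneg fun o _ => hterm u hu o]
            refine Finset.sum_le_sum fun o _ => ?_
            rw [← Finset.mul_sum, ENNReal.ofReal_mul (mul_nonneg (𝓖.rate_pos _).le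
              (Real.exp_pos _).le)]
            exact mul_le_mul_right (ih (hinv x δ hx o) (htu u hu)) _
          · simp only [semigroupAux]
            rw [ENNReal.ofReal_mul (Real.exp_pos _).le]
            exact mul_le_mul_right (h0 x δ hx) _
      _ = ENNReal.ofReal (F t x δ) := by
          rw [← ENNReal.ofReal_add hnn (mul_nonneg (Real.exp_pos _).le hF0)]
          congr 1
          ring

end Comparison

end RandomGrammar

end GraphGrammar

/-! ### Marked descendants and bounds for their number. -/

namespace GraphGrammar

open SpinGraph

namespace RandomGrammar

variable {S V : Type*} {𝓖 : RandomGrammar S}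

open Classical in
/-- Marks are kept outside the region `U`; if there is a mark in `U`, then all of the new region
`U'` becomes marked. -/
def markUpdate {L : Type*} (U U' A : Finset L) : Finset L :=
  (A \ U) ∪ if (A ∩ U).Nonempty then U' else ∅

theorem mem_markUpdate {L : Type*} {U U' A : Finset L} {p : L} :
    p ∈ markUpdate U U' A ↔ (p ∈ A ∧ p ∉ U) ∨ (p ∈ U' ∧ ∃ a ∈ A, a ∈ U) := by
  classical
  unfold markUpdate
  by_cases h : (A ∩ U).Nonempty
  · have h' : ∃ a ∈ A, a ∈ U := by obtain ⟨a, ha⟩ := h; exact ⟨a, by simpa using ha⟩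
    simp [h, h']
  · have h' : ¬ ∃ a ∈ A, a ∈ U := fun ⟨a, ha⟩ => h ⟨a, by simpa using ha⟩
    simp only [h, h', if_false, Finset.union_empty, Finset.mem_sdiff, and_false, or_false]

theorem markUpdate_of_disjoint {L : Type*} {U U' A : Finset L} (h : ¬ ∃ a ∈ A, a ∈ U) :
    markUpdate U U' A = A := by
  ext p
  rw [mem_markUpdate]
  push Not at h
  constructor
  · rintro (h' | ⟨-, a, ha, ha'⟩)
    · exact h'.1
    · exact absurd ha' (h a ha)
  · exact fun hp => Or.inl ⟨hp, h p hp⟩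

/-- The whole new region is charged to each mark in `U`. The overcounting makes the bound a sum over
individual marks, each of which is hit at a bounded rate. -/
theorem sum_markUpdate_le {L : Type*} (U U' A : Finset L) [DecidablePred (· ∈ U)] {φ : L → ℝ}
    (hφ : ∀ p, 0 ≤ φ p) :
    ∑ p ∈ markUpdate U U' A, φ p ≤ ∑ p ∈ A, if p ∈ U then ∑ p' ∈ U', φ p' else φ p := by
  classical
  have h1 : ∑ p ∈ A, (if p ∈ U then ∑ p' ∈ U', φ p' else φ p) =
      ∑ p ∈ A ∩ U, ∑ p' ∈ U', φ p' + ∑ p ∈ A \ U, φ p := by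
    rw [Finset.sum_ite]
    congr 2 <;> ext p <;> simp
  have h2 : ∑ p ∈ markUpdate U U' A, φ p ≤
      ∑ p ∈ A \ U, φ p + ∑ p ∈ (if (A ∩ U).Nonempty then U' else ∅), φ p := by
    unfold markUpdate
    rw [← Finset.sum_union_inter]
    exact le_add_of_nonneg_right (Finset.sum_nonneg fun p _ => hφ p)
  refine h2.trans ?_
  rw [h1, add_comm]
  refine add_le_add ?_ le_rfl
  split_ifs with h
  · obtain ⟨a, ha⟩ := h
    exact Finset.single_le_sum (f := fun _ => ∑ p' ∈ U', φ p')
      (fun _ _ => Finset.sum_nonneg fun p _ => hφ p) ha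
  · simp only [Finset.sum_empty]
    exact Finset.sum_nonneg fun _ _ => Finset.sum_nonneg fun p _ => hφ p

variable {n C : ℕ} {c : ℝ}
  {U U' : ∀ x : SpinGraph (V × ℕ) S, 𝓖.Occurrence x → Finset (V × ℕ)}

/-- A sum over marked vertices of weights, each multiplied by the total rate of the
transformations affecting the vertex. -/
theorem Controlled.rate_le (h : 𝓖.Controlled V n C c U U') {x : SpinGraph (V × ℕ) S}
    (hx : x.InGF n) (A : Finset (V × ℕ)) {w : V × ℕ → ℝ} (hw : ∀ p ∈ A, 0 ≤ w p)
    {g : 𝓖.Occurrence x → ℝ}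
    (hg : ∀ o, g o ≤ ∑ p ∈ A, (U x o : Set (V × ℕ)).indicator 1 p * w p) :
    ∑' o : 𝓖.Occurrence x, 𝓖.rate o.1.1 * g o ≤ c * ∑ p ∈ A, w p := by
  have := 𝓖.finite_occurrence hx.1
  have := Fintype.ofFinite (𝓖.Occurrence x)
  rw [tsum_fintype]
  calc ∑ o : 𝓖.Occurrence x, 𝓖.rate o.1.1 * g o
      ≤ ∑ o : 𝓖.Occurrence x, 𝓖.rate o.1.1 *
        ∑ p ∈ A, (U x o : Set (V × ℕ)).indicator 1 p * w p :=
        Finset.sum_le_sum fun o _ => mul_le_mul_of_nonneg_left (hg o) (𝓖.rate_pos _).le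
    _ = ∑ p ∈ A, (∑ o : 𝓖.Occurrence x, 𝓖.rate o.1.1 *
        (U x o : Set (V × ℕ)).indicator 1 p) * w p := by
        simp only [Finset.mul_sum, Finset.sum_mul]
        rw [Finset.sum_comm]
        simp only [mul_assoc]
    _ ≤ ∑ p ∈ A, c * w p := by
        refine Finset.sum_le_sum fun p hp => mul_le_mul_of_nonneg_right ?_ (hw p hp)
        have := h.rate hx p
        rwa [tsum_fintype] at this
    _ = c * ∑ p ∈ A, w p := by rw [Finset.mul_sum]

/-- Auxiliary data: two sets of marked vertices and a bound for second components of names. -/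
abbrev Marks (V : Type*) := Finset (V × ℕ) × Finset (V × ℕ) × ℕ

/-- The marked sets contain all vertices with first component in `B`, respectively in `B'`. -/
structure MarkInv (n : ℕ) (B B' : Set V) (x : SpinGraph (V × ℕ) S) (δ : Marks V) : Prop where
  inGF : x.InGF n
  sub : ∀ p ∈ δ.1, p ∈ x.verts
  nonempty : δ.1.Nonempty
  mem : ∀ p ∈ x.verts, p.1 ∈ B → p ∈ δ.1
  sub' : ∀ p ∈ δ.2.1, p ∈ x.verts
  nonempty' : δ.2.1.Nonempty
  mem' : ∀ p ∈ x.verts, p.1 ∈ B' → p ∈ δ.2.1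
  le : ∀ p ∈ x.verts, p.1 ∈ B' → p.2 ≤ δ.2.2

open Classical in
/-- The update of the data by a transformation. -/
def updateMarks (C : ℕ) (U U' : ∀ x : SpinGraph (V × ℕ) S, 𝓖.Occurrence x → Finset (V × ℕ))
    (x : SpinGraph (V × ℕ) S) (o : 𝓖.Occurrence x) (δ : Marks V) : Marks V :=
  (markUpdate (U x o) (U' x o) δ.1, markUpdate (U x o) (U' x o) δ.2.1,
    if ∃ a ∈ δ.2.1, a ∈ U x o then δ.2.2 + C else δ.2.2)

/-- An old vertex of `U'` was already in `U`; a newly created one takes its first component from a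
vertex of `U`. -/
theorem Controlled.exists_mem_of_mem (h : 𝓖.Controlled V n C c U U') {x : SpinGraph (V × ℕ) S}
    (hx : x.InGF n) (o : 𝓖.Occurrence x) {p : V × ℕ} (hp : p ∈ U' x o) :
    ∃ a ∈ U x o, a.1 = p.1 := by
  by_cases hpx : p ∈ x.verts
  · refine ⟨p, ?_, rfl⟩
    by_contra hpU
    exact (((h.move hx o).mem_iff p).1 ⟨hpx, hpU⟩).2 hp
  · obtain ⟨a, ha, ha', -⟩ := h.label hx o p hp hpx
    exact ⟨a, ha, ha'⟩

/-- A vertex of the new region lying over `B` has an ancestor in `U` with the same first component.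
That ancestor is marked, so the entire new region gets marked. The marks never die out because `U'`
is nonempty. -/
theorem Controlled.markUpdate_spec (h : 𝓖.Controlled V n C c U U') {x : SpinGraph (V × ℕ) S}
    (hx : x.InGF n) (o : 𝓖.Occurrence x) {B : Set V} {A : Finset (V × ℕ)}
    (hsub : ∀ p ∈ A, p ∈ x.verts) (hne : A.Nonempty) (hmem : ∀ p ∈ x.verts, p.1 ∈ B → p ∈ A) :
    (∀ p ∈ markUpdate (U x o) (U' x o) A, p ∈ o.result.verts) ∧
    (markUpdate (U x o) (U' x o) A).Nonempty ∧
    ∀ p ∈ o.result.verts, p.1 ∈ B → p ∈ markUpdate (U x o) (U' x o) A := by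
  have hm := h.move hx o
  refine ⟨fun p hp => ?_, ?_, fun p hp hpB => ?_⟩
  · rcases mem_markUpdate.1 hp with h' | h'
    · exact ((hm.mem_iff p).1 ⟨hsub p h'.1, h'.2⟩).1
    · exact hm.sub' p h'.1
  · obtain ⟨a, ha⟩ := hne
    by_cases haU : a ∈ U x o
    · obtain ⟨b, hb⟩ := hm.nonempty'
      exact ⟨b, mem_markUpdate.2 (Or.inr ⟨hb, a, ha, haU⟩)⟩
    · exact ⟨a, mem_markUpdate.2 (Or.inl ⟨ha, haU⟩)⟩
  · by_cases hpU : p ∈ U' x o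
    · obtain ⟨a, ha, hap⟩ := h.exists_mem_of_mem hx o hpU
      exact mem_markUpdate.2 (Or.inr ⟨hpU, a, hmem a (hm.sub a ha) (hap ▸ hpB), ha⟩)
    · obtain ⟨hpx, hpU⟩ := (hm.mem_iff p).2 ⟨hp, hpU⟩
      exact mem_markUpdate.2 (Or.inl ⟨hmem p hpx hpB, hpU⟩)

theorem MarkInv.update (h : 𝓖.Controlled V n C c U U') {B B' : Set V}
    (x : SpinGraph (V × ℕ) S) (δ : Marks V) (hx : MarkInv n B B' x δ) (o : 𝓖.Occurrence x) :
    MarkInv n B B' o.result (updateMarks C U U' x o δ) := by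
  obtain ⟨h1, h2, h3⟩ := h.markUpdate_spec hx.inGF o hx.sub hx.nonempty hx.mem
  obtain ⟨k1, k2, k3⟩ := h.markUpdate_spec hx.inGF o hx.sub' hx.nonempty' hx.mem'
  refine ⟨h.result hx.inGF o, h1, h2, h3, k1, k2, k3, fun p hp hpB => ?_⟩
  by_cases hpx : p ∈ x.verts
  · refine (hx.le p hpx hpB).trans ?_
    simp only [updateMarks]
    split_ifs <;> omega
  · have hpU : p ∈ U' x o := by
      by_contra hpU
      exact hpx (((h.move hx.inGF o).mem_iff p).2 ⟨hp, hpU⟩).1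
    obtain ⟨a, ha, hap, hle⟩ := h.label hx.inGF o p hpU hpx
    have ha' := hx.mem' a ((h.move hx.inGF o).sub a ha) (hap ▸ hpB)
    have hs : sSup {j | (p.1, j) ∈ x.verts} ≤ δ.2.2 := by
      refine csSup_le' fun j hj => ?_
      exact hx.le (p.1, j) hj hpB
    simp only [updateMarks]
    -- A new name over `B'` can appear only when the region contains a mark, which is exactly when
    -- the counter is raised by `C`.
    rw [if_pos ⟨a, ha', ha⟩]
    omega

section Supersolutions

variable {B B' : Set V}

theorem indicator_one_eq {L : Type*} (s : Finset L) [DecidablePred (· ∈ s)] (p : L) :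
    (s : Set L).indicator (1 : L → ℝ) p = if p ∈ s then 1 else 0 := by
  by_cases h : p ∈ s <;> simp [h]

theorem Controlled.card_markUpdate_sub_le (h : 𝓖.Controlled V n C c U U')
    {x : SpinGraph (V × ℕ) S} (hx : x.InGF n) (o : 𝓖.Occurrence x) (A : Finset (V × ℕ)) :
    ((markUpdate (U x o) (U' x o) A).card : ℝ) - A.card ≤
      ∑ p ∈ A, (U x o : Set (V × ℕ)).indicator 1 p * (C : ℝ) := by
  classical
  have h1 := sum_markUpdate_le (U x o) (U' x o) A (φ := fun _ => 1) (fun _ => zero_le_one)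
  have hC : ((U' x o).card : ℝ) ≤ C := by exact_mod_cast (h.move hx o).card'
  simp only [Finset.sum_const, nsmul_eq_mul, mul_one] at h1
  rw [sub_le_iff_le_add, Finset.card_eq_sum_ones A]
  push_cast
  rw [← Finset.sum_add_distrib]
  refine h1.trans (Finset.sum_le_sum fun p _ => ?_)
  rw [indicator_one_eq]
  split_ifs
  · linarith
  · simp

theorem Controlled.card_le_card_markUpdate (h : 𝓖.Controlled V n C c U U')
    {x : SpinGraph (V × ℕ) S} (hx : x.InGF n) (o : 𝓖.Occurrence x) (A : Finset (V × ℕ)) :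
    A.card ≤ (markUpdate (U x o) (U' x o) A).card + C := by
  classical
  have h1 : A ⊆ markUpdate (U x o) (U' x o) A ∪ U x o := by
    intro p hp
    by_cases hpU : p ∈ U x o
    · exact Finset.mem_union_right _ hpU
    · exact Finset.mem_union_left _ (mem_markUpdate.2 (Or.inl ⟨hp, hpU⟩))
  refine (Finset.card_le_card h1).trans ((Finset.card_union_le _ _).trans ?_)
  have := (h.move hx o).card
  omega

theorem hasDerivAt_exp_mul (b a t : ℝ) :
    HasDerivAt (fun t => Real.exp (b * t) * a) (b * Real.exp (b * t) * a) t := by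
  have : HasDerivAt (fun t => Real.exp (b * t)) (Real.exp (b * t) * (b * 1)) t :=
    ((hasDerivAt_id t).const_mul b).exp
  exact (this.mul_const a).congr_deriv (by ring)

/-- Every mark is hit at rate at most `c`, and a hit is charged at most `C` new marks, whence the
exponential rate `c * C`. -/
theorem Controlled.supersolution_card (h : 𝓖.Controlled V n C c U U') (T : ℝ) :
    IsSupersolution 𝓖 (MarkInv n B B') (updateMarks C U U') T
      fun t _ δ => Real.exp (c * C * t) * (δ.2.1.card : ℝ) := by
  refine ⟨fun x δ _ t _ => by positivity, fun x δ hx => ?_⟩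
  refine ⟨_, ?_, fun t => hasDerivAt_exp_mul _ _ t, fun t ht => ?_⟩
  · fun_prop
  · refine (h.rate_le hx.inGF δ.2.1 (w := fun _ => Real.exp (c * C * t) * C)
      (fun _ _ => by positivity) fun o => ?_).trans (le_of_eq ?_)
    · have := h.card_markUpdate_sub_le hx.inGF o δ.2.1
      rw [← mul_sub]
      refine (mul_le_mul_of_nonneg_left this (Real.exp_pos _).le).trans (le_of_eq ?_)
      rw [Finset.mul_sum]
      exact Finset.sum_congr rfl fun p _ => by ring
    · rw [Finset.sum_const, nsmul_eq_mul]
      ring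

/-- The counter increases at rate at most `c * C` per mark. Doubling the exponent in the term with
the number of marks pays both for the growth of that number and, as the exponential is at least 1,
for the counter. -/
theorem Controlled.supersolution_bound (h : 𝓖.Controlled V n C c U U') (hc : 0 ≤ c) (T : ℝ) :
    IsSupersolution 𝓖 (MarkInv n B B') (updateMarks C U U') T
      fun t _ δ => Real.exp (2 * c * C * t) * (δ.2.1.card : ℝ) + δ.2.2 := by
  classical
  refine ⟨fun x δ _ t _ => by positivity, fun x δ hx => ?_⟩
  refine ⟨_, ?_, fun t => (hasDerivAt_exp_mul _ _ t).add_const _, fun t ht => ?_⟩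
  · fun_prop
  · have hE : 1 ≤ Real.exp (2 * c * C * t) := Real.one_le_exp (by have := ht.1; positivity)
    refine (h.rate_le hx.inGF δ.2.1 (w := fun _ => 2 * Real.exp (2 * c * C * t) * C)
      (fun _ _ => by positivity) fun o => ?_).trans (le_of_eq ?_)
    · have h1 := h.card_markUpdate_sub_le hx.inGF o δ.2.1
      have h2 : ((updateMarks C U U' x o δ).2.2 : ℝ) - δ.2.2 ≤
          ∑ p ∈ δ.2.1, (U x o : Set (V × ℕ)).indicator 1 p * (C : ℝ) := by
        simp only [updateMarks]
        split_ifs with ha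
        · obtain ⟨a, ha, haU⟩ := ha
          have := Finset.single_le_sum (f := fun p =>
            (U x o : Set (V × ℕ)).indicator 1 p * (C : ℝ)) (fun p _ => mul_nonneg
              (Set.indicator_nonneg (fun _ _ => zero_le_one) _) (Nat.cast_nonneg _)) ha
          simp only [indicator_one_eq, haU, if_true, one_mul] at this ⊢
          push_cast
          linarith
        · rw [sub_self]
          exact Finset.sum_nonneg fun p _ => mul_nonneg
              (Set.indicator_nonneg (fun _ _ => zero_le_one) _) (Nat.cast_nonneg _)
      set s := ∑ p ∈ δ.2.1, (U x o : Set (V × ℕ)).indicator 1 p * (C : ℝ) with hs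
      have hs0 : 0 ≤ s := Finset.sum_nonneg fun p _ => mul_nonneg
              (Set.indicator_nonneg (fun _ _ => zero_le_one) _) (Nat.cast_nonneg _)
      have h3 : ∑ p ∈ δ.2.1, (U x o : Set (V × ℕ)).indicator 1 p *
          (2 * Real.exp (2 * c * C * t) * C) = 2 * Real.exp (2 * c * C * t) * s := by
        rw [hs, Finset.mul_sum]
        exact Finset.sum_congr rfl fun p _ => by ring
      rw [h3]
      have h4 : Real.exp (2 * c * C * t) * (((updateMarks C U U' x o δ).2.1.card : ℝ) -
          δ.2.1.card) ≤ Real.exp (2 * c * C * t) * s :=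
        mul_le_mul_of_nonneg_left h1 (Real.exp_pos _).le
      nlinarith
    · rw [Finset.sum_const, nsmul_eq_mul]
      ring

/-- If a hit changes the number of marks from `a` to `a'`, then `a ≤ a' + C` and `a' ≥ 1`, hence `a
≤ (C + 1) * a'` and `1/a' - 1/a ≤ C * (C + 1) / a ^ 2`. Hits come at total rate at most `c * a`,
which leaves a multiple of `1/a`. The inverse moment is used to show that marks do not become
scarce. -/
theorem Controlled.supersolution_inv_card (h : 𝓖.Controlled V n C c U U') (T : ℝ) :
    IsSupersolution 𝓖 (MarkInv n B B') (updateMarks C U U') T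
      fun t _ δ => Real.exp (c * (C * (C + 1)) * t) * (δ.2.1.card : ℝ)⁻¹ := by
  refine ⟨fun x δ _ t _ => by positivity, fun x δ hx => ?_⟩
  refine ⟨_, ?_, fun t => hasDerivAt_exp_mul _ _ t, fun t ht => ?_⟩
  · fun_prop
  · set a : ℝ := ((δ.2.1.card : ℕ) : ℝ) with ha
    have ha0 : 0 < a := by rw [ha]; exact_mod_cast hx.nonempty'.card_pos
    refine (h.rate_le hx.inGF δ.2.1 (w := fun _ => Real.exp (c * (C * (C + 1)) * t) *
      (C * (C + 1) * (a⁻¹ * a⁻¹))) (fun _ _ => by positivity) fun o => ?_).trans (le_of_eq ?_)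
    · rw [← mul_sub, ← Finset.sum_mul, mul_left_comm (Finset.sum _ _)]
      refine mul_le_mul_of_nonneg_left ?_ (Real.exp_pos _).le
      by_cases ht : ∃ p ∈ δ.2.1, p ∈ U x o
      · have h1 : 1 ≤ ∑ p ∈ δ.2.1, (U x o : Set (V × ℕ)).indicator (1 : V × ℕ → ℝ) p := by
          obtain ⟨p, hp, hpU⟩ := ht
          have := Finset.single_le_sum (f := fun p =>
            (U x o : Set (V × ℕ)).indicator (1 : V × ℕ → ℝ) p) (fun p _ =>
              (Set.indicator_nonneg (fun _ _ => zero_le_one) _)) hp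
          simpa [hpU] using this
        refine le_trans ?_ (le_mul_of_one_le_left (by positivity) h1)
        set a' : ℝ := (((updateMarks C U U' x o δ).2.1.card : ℕ) : ℝ) with ha'
        have ha'1 : 1 ≤ a' := by
          rw [ha']
          exact_mod_cast (MarkInv.update h x δ hx o).nonempty'.card_pos
        have h2 : a ≤ a' + C := by
          rw [ha, ha']
          exact_mod_cast h.card_le_card_markUpdate hx.inGF o δ.2.1
        have h3 : a'⁻¹ ≤ (C + 1) * a⁻¹ := by
          rw [inv_le_iff_one_le_mul₀ (by linarith), mul_assoc, mul_comm a⁻¹, ← mul_assoc,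
            ← div_eq_mul_inv, one_le_div ha0]
          have : (0 : ℝ) ≤ C := Nat.cast_nonneg _
          nlinarith
        have h4 : a'⁻¹ - a⁻¹ = (a - a') * (a'⁻¹ * a⁻¹) := by
          have : a' ≠ 0 := by linarith
          field_simp
        rw [h4]
        have h5 : 0 ≤ a'⁻¹ := inv_nonneg.2 (by linarith)
        calc (a - a') * (a'⁻¹ * a⁻¹) ≤ C * (a'⁻¹ * a⁻¹) :=
              mul_le_mul_of_nonneg_right (by linarith) (by positivity)
          _ ≤ C * ((C + 1) * a⁻¹ * a⁻¹) := by gcongr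
          _ = C * (C + 1) * (a⁻¹ * a⁻¹) := by ring
      · have : (updateMarks C U U' x o δ).2.1 = δ.2.1 := markUpdate_of_disjoint ht
        rw [this, ha, sub_self]
        exact mul_nonneg (Finset.sum_nonneg fun p _ =>
          (Set.indicator_nonneg (fun _ _ => zero_le_one) _)) (by positivity)
    · rw [Finset.sum_const, nsmul_eq_mul, ← ha]
      field_simp

end Supersolutions

end RandomGrammar

end GraphGrammar

/-! ### Exponential moments of distances between descendants. -/

namespace GraphGrammar

open SpinGraph

theorem _root_.pow_sub_one_le_mul_sub_one {θ : ℝ} (h1 : 1 ≤ θ) (h2 : θ ≤ 2) (C : ℕ) :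
    θ ^ C - 1 ≤ C * 2 ^ C * (θ - 1) := by
  induction C with
  | zero => simp
  | succ C ih =>
    have h3 : (0 : ℝ) < 2 ^ C := by positivity
    have h4 : θ ^ C ≤ 2 ^ C := pow_le_pow_left₀ (by linarith) h2 C
    have h5 : θ ^ (C + 1) - 1 = θ ^ C * (θ - 1) + (θ ^ C - 1) := by ring
    rw [h5, pow_succ]
    push_cast
    have h6 : θ ^ C * (θ - 1) ≤ 2 ^ C * (θ - 1) := mul_le_mul_of_nonneg_right h4 (by linarith)
    have h7 : 0 ≤ (C : ℝ) * 2 ^ C * (θ - 1) := by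
      have : 0 ≤ θ - 1 := by linarith
      positivity
    have h8 : 0 ≤ (2 : ℝ) ^ C * (θ - 1) := mul_nonneg h3.le (by linarith)
    nlinarith

namespace SpinGraph

variable {L : Type*} {S : Type*}

theorem IsConnected.mem_ball_iff {x : SpinGraph L S} (hx : x.IsConnected) {p q : L}
    (hp : p ∈ x.verts) (hq : q ∈ x.verts) {N : ℕ} : q ∈ x.ball p N ↔ x.graph.dist p q ≤ N := by
  rw [mem_ball, ← (hx.2 p hp q hq).coe_dist_eq_edist]
  exact_mod_cast Iff.rfl

theorem dist_le_of_mem_ball {x : SpinGraph L S} {p q : L} {N : ℕ} (h : q ∈ x.ball p N) :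
    x.graph.dist p q ≤ N := by
  obtain ⟨w, hw⟩ := exists_walk_of_mem_ball h
  exact (SimpleGraph.dist_le w).trans hw

/-- The left side is what a pair of marks is charged with after the move. If both ends are outside
`U`, the distance can grow only when the geodesic `w` meets `U`, and then by at most `C`. If an end
is in `U`, there are at most `C` or `C * C` new pairs, at distance at most `d + C`, and `θ ^ C ≤ 2 ^
C` is used crudely. -/
theorem LocalMove.sum_pow_dist_le {C : ℕ} {x y : SpinGraph L S} {U U' : Finset L}
    [DecidablePred (· ∈ U)] (h : LocalMove C x y U U') (hx : x.IsConnected) {θ : ℝ} (h1 : 1 ≤ θ) (h2 : θ ≤ 2)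
    {p q : L} (hp : p ∈ x.verts) (hq : q ∈ x.verts) {s : Finset L} {w : x.graph.Walk p q}
    (hw : w.length = x.graph.dist p q) (hs : ∀ a, a ∈ s ↔ a ∈ w.support) :
    (if p ∈ U then ∑ p' ∈ U', (if q ∈ U then ∑ q' ∈ U', θ ^ y.graph.dist p' q'
        else θ ^ y.graph.dist p' q)
      else (if q ∈ U then ∑ q' ∈ U', θ ^ y.graph.dist p q' else θ ^ y.graph.dist p q)) ≤
    θ ^ x.graph.dist p q + θ ^ x.graph.dist p q * ((θ ^ C - 1) *
        ∑ a ∈ s, (U : Set L).indicator 1 a + (C * C + C) * 2 ^ C *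
        ((U : Set L).indicator 1 p + (U : Set L).indicator 1 q)) := by
  set d := x.graph.dist p q with hd
  have h0 : (0 : ℝ) ≤ θ := by linarith
  have hC0 : (0 : ℝ) ≤ C := Nat.cast_nonneg C
  have hdpos : 0 < θ ^ d := by positivity
  have hball : q ∈ x.ball p d := (hx.mem_ball_iff hp hq).2 le_rfl
  have hpow : ∀ {p' q' : L}, ((p ∉ U ∧ p' = p) ∨ (p ∈ U ∧ p' ∈ U')) →
      ((q ∉ U ∧ q' = q) ∨ (q ∈ U ∧ q' ∈ U')) → θ ^ y.graph.dist p' q' ≤ θ ^ d * θ ^ C := by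
    intro p' q' hpp hqq
    rw [← pow_add]
    exact pow_le_pow_right₀ h1 (dist_le_of_mem_ball (h.mem_ball_add hp hq hpp hqq hball))
  have hθC : θ ^ d * θ ^ C ≤ θ ^ d * 2 ^ C :=
    mul_le_mul_of_nonneg_left (pow_le_pow_left₀ h0 h2 C) hdpos.le
  have hs0 : (0 : ℝ) ≤ ∑ a ∈ s, (U : Set L).indicator 1 a :=
    Finset.sum_nonneg fun a _ => Set.indicator_nonneg (fun _ _ => zero_le_one) _
  have hθ1 : 0 ≤ θ ^ C - 1 := by linarith [one_le_pow₀ (n := C) h1]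
  have hfirst : 0 ≤ (θ ^ C - 1) * ∑ a ∈ s, (U : Set L).indicator (1 : L → ℝ) a := mul_nonneg hθ1 hs0
  have h2C : (0 : ℝ) < 2 ^ C := by positivity
  have hcard : ((U'.card : ℕ) : ℝ) ≤ C := by exact_mod_cast h.card'
  have hsum : ∀ (f : L → ℝ) (b : ℝ), 0 ≤ b → (∀ p' ∈ U', f p' ≤ b) → ∑ p' ∈ U', f p' ≤ C * b := by
    intro f b hb hf
    refine (Finset.sum_le_card_nsmul _ _ b hf).trans ?_
    rw [nsmul_eq_mul]
    exact mul_le_mul_of_nonneg_right hcard hb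
  have hB : 0 ≤ θ ^ d * 2 ^ C := by positivity
  simp only [RandomGrammar.indicator_one_eq U p, RandomGrammar.indicator_one_eq U q]
  by_cases hpU : p ∈ U <;> by_cases hqU : q ∈ U
  · simp only [hpU, hqU, if_true]
    have := hsum (fun p' => ∑ q' ∈ U', θ ^ y.graph.dist p' q') (C * (θ ^ d * 2 ^ C))
      (by positivity) fun p' hp' => hsum _ _ hB fun q' hq' =>
        (hpow (Or.inr ⟨hpU, hp'⟩) (Or.inr ⟨hqU, hq'⟩)).trans hθC
    have h3 : 0 ≤ θ ^ d * 2 ^ C * C * C := by positivity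
    have h4 : 0 ≤ θ ^ d * 2 ^ C * C := by positivity
    have h5 := mul_nonneg hdpos.le hfirst
    nlinarith
  · simp only [hpU, hqU, if_true, if_false]
    have := hsum (fun p' => θ ^ y.graph.dist p' q) (θ ^ d * 2 ^ C) hB fun p' hp' =>
        (hpow (Or.inr ⟨hpU, hp'⟩) (Or.inl ⟨hqU, rfl⟩)).trans hθC
    have h3 : 0 ≤ θ ^ d * 2 ^ C * C * C := by positivity
    have h5 := mul_nonneg hdpos.le hfirst
    nlinarith
  · simp only [hpU, hqU, if_true, if_false]
    have := hsum (fun q' => θ ^ y.graph.dist p q') (θ ^ d * 2 ^ C) hB fun q' hq' =>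
        (hpow (Or.inl ⟨hpU, rfl⟩) (Or.inr ⟨hqU, hq'⟩)).trans hθC
    have h3 : 0 ≤ θ ^ d * 2 ^ C * C * C := by positivity
    have h5 := mul_nonneg hdpos.le hfirst
    nlinarith
  · simp only [hpU, hqU, if_false, add_zero, mul_zero]
    by_cases hhit : ∃ a ∈ s, a ∈ U
    · obtain ⟨a, ha, haU⟩ := hhit
      have h3 : 1 ≤ ∑ a ∈ s, (U : Set L).indicator (1 : L → ℝ) a := by
        have := Finset.single_le_sum (f := fun p => (U : Set L).indicator (1 : L → ℝ) p)
          (fun p _ => (Set.indicator_nonneg (fun _ _ => zero_le_one) _)) ha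
        simpa [haU] using this
      have h4 := hpow (Or.inl ⟨hpU, rfl⟩) (Or.inl ⟨hqU, rfl⟩)
      have h5 := mul_le_mul_of_nonneg_left h3 (mul_nonneg hdpos.le hθ1)
      nlinarith
    · push Not at hhit
      have := h.mem_ball_of_walk_avoiding w hp fun a ha => hhit a ((hs a).2 ha)
      rw [hw] at this
      have h3 := pow_le_pow_right₀ h1 (dist_le_of_mem_ball this)
      have h5 := mul_nonneg hdpos.le hfirst
      linarith

end SpinGraph

namespace RandomGrammar

variable {S V : Type*} {𝓖 : RandomGrammar S} {n C : ℕ} {c : ℝ}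
  {U U' : ∀ x : SpinGraph (V × ℕ) S, 𝓖.Occurrence x → Finset (V × ℕ)} {B B' : Set V}

/-- `∑ θ ^ d(p, q)` over pairs of vertices from two sets. -/
def distSum {L S : Type*} (θ : ℝ) (x : SpinGraph L S) (A A' : Finset L) : ℝ :=
  ∑ p ∈ A, ∑ q ∈ A', θ ^ x.graph.dist p q

/-- For each pair a geodesic is fixed; it has `d + 1` vertices, each hit at rate at most `c`. The
two ends account for the term with `2 * c`. -/
theorem Controlled.distSum_rate_le (h : 𝓖.Controlled V n C c U U')
    {x : SpinGraph (V × ℕ) S} {δ : Marks V} (hx : MarkInv n B B' x δ) {θ : ℝ} (h1 : 1 ≤ θ)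
    (h2 : θ ≤ 2) :
    ∑' o : 𝓖.Occurrence x, 𝓖.rate o.1.1 *
        (distSum θ o.result (updateMarks C U U' x o δ).1 (updateMarks C U U' x o δ).2.1 -
          distSum θ x δ.1 δ.2.1) ≤
      ∑ p ∈ δ.1, ∑ q ∈ δ.2.1, θ ^ x.graph.dist p q *
        ((θ ^ C - 1) * (c * (x.graph.dist p q + 1)) + (C * C + C) * 2 ^ C * (2 * c)) := by
  classical
  have hpath : ∀ p q, ∃ s : Finset (V × ℕ), p ∈ δ.1 → q ∈ δ.2.1 →
      ∃ w : x.graph.Walk p q, w.length = x.graph.dist p q ∧ ∀ a, a ∈ s ↔ a ∈ w.support := by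
    intro p q
    by_cases hpq : p ∈ δ.1 ∧ q ∈ δ.2.1
    · obtain ⟨w, hw⟩ := (hx.inGF.2.1.2 p (hx.sub p hpq.1) q
        (hx.sub' q hpq.2)).exists_walk_length_eq_dist
      exact ⟨w.support.toFinset, fun _ _ => ⟨w, hw, by simp⟩⟩
    · exact ⟨∅, fun hp hq => absurd ⟨hp, hq⟩ hpq⟩
  choose s hs using hpath
  have hscard : ∀ p ∈ δ.1, ∀ q ∈ δ.2.1, ((s p q).card : ℝ) ≤ x.graph.dist p q + 1 := by
    intro p hp q hq
    obtain ⟨w, hw, hws⟩ := hs p q hp hq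
    have h3 : s p q ⊆ w.support.toFinset := fun a ha => List.mem_toFinset.2 ((hws a).1 ha)
    have h4 := (Finset.card_le_card h3).trans (List.toFinset_card_le _)
    rw [SimpleGraph.Walk.length_support, hw] at h4
    exact_mod_cast h4
  have := 𝓖.finite_occurrence hx.inGF.1
  have := Fintype.ofFinite (𝓖.Occurrence x)
  rw [tsum_fintype]
  set K : ℝ := (C * C + C) * 2 ^ C with hK
  have hK0 : 0 ≤ K := by positivity
  have hθ1 : 0 ≤ θ ^ C - 1 := by linarith [one_le_pow₀ (n := C) h1]
  set η : 𝓖.Occurrence x → V × ℕ → V × ℕ → ℝ := fun o p q =>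
    (θ ^ C - 1) * ∑ a ∈ s p q, (U x o : Set (V × ℕ)).indicator 1 a +
      K * ((U x o : Set (V × ℕ)).indicator 1 p + (U x o : Set (V × ℕ)).indicator 1 q) with hη
  have hstep : ∀ o : 𝓖.Occurrence x,
      distSum θ o.result (updateMarks C U U' x o δ).1 (updateMarks C U U' x o δ).2.1 -
        distSum θ x δ.1 δ.2.1 ≤ ∑ p ∈ δ.1, ∑ q ∈ δ.2.1, θ ^ x.graph.dist p q * η o p q := by
    intro o
    have hpos : ∀ p q, 0 ≤ θ ^ o.result.graph.dist p q := fun p q => by positivity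
    rw [sub_le_iff_le_add', distSum, distSum, ← Finset.sum_add_distrib]
    refine (sum_markUpdate_le _ _ _ fun p => Finset.sum_nonneg fun q _ => hpos p q).trans ?_
    refine Finset.sum_le_sum fun p hp => ?_
    rw [← Finset.sum_add_distrib]
    have hq : ∀ p', ∑ q ∈ (updateMarks C U U' x o δ).2.1, θ ^ o.result.graph.dist p' q ≤
        ∑ q ∈ δ.2.1, if q ∈ U x o then ∑ q' ∈ U' x o, θ ^ o.result.graph.dist p' q'
          else θ ^ o.result.graph.dist p' q := fun p' => sum_markUpdate_le _ _ _ (hpos p')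
    refine le_trans (b := ∑ q ∈ δ.2.1, (if p ∈ U x o then ∑ p' ∈ U' x o,
      (if q ∈ U x o then ∑ q' ∈ U' x o, θ ^ o.result.graph.dist p' q'
        else θ ^ o.result.graph.dist p' q)
      else (if q ∈ U x o then ∑ q' ∈ U' x o, θ ^ o.result.graph.dist p q'
        else θ ^ o.result.graph.dist p q))) ?_ ?_
    · by_cases hpU : p ∈ U x o
      · simp only [hpU, if_true]
        rw [Finset.sum_comm (s := δ.2.1)]
        exact Finset.sum_le_sum fun p' _ => hq p'
      · simp only [hpU, if_false]
        exact hq p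
    · refine Finset.sum_le_sum fun q hq => ?_
      obtain ⟨w, hw, hws⟩ := hs p q hp hq
      exact (h.move hx.inGF o).sum_pow_dist_le hx.inGF.2.1 h1 h2 (hx.sub p hp) (hx.sub' q hq)
        hw hws
  have hrate : ∀ p, ∑ o : 𝓖.Occurrence x, 𝓖.rate o.1.1 *
      (U x o : Set (V × ℕ)).indicator 1 p ≤ c := by
    intro p
    have := h.rate hx.inGF p
    rwa [tsum_fintype] at this
  have hηrate : ∀ p ∈ δ.1, ∀ q ∈ δ.2.1, ∑ o : 𝓖.Occurrence x, 𝓖.rate o.1.1 * η o p q ≤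
      (θ ^ C - 1) * (c * (x.graph.dist p q + 1)) + K * (2 * c) := by
    intro p hp q hq
    have hc : 0 ≤ c := le_trans (Finset.sum_nonneg fun o _ => mul_nonneg (𝓖.rate_pos _).le
      (Set.indicator_nonneg (fun _ _ => zero_le_one) _)) (hrate p)
    have e1 : ∑ o : 𝓖.Occurrence x, 𝓖.rate o.1.1 * η o p q =
        (θ ^ C - 1) * ∑ a ∈ s p q, ∑ o : 𝓖.Occurrence x, 𝓖.rate o.1.1 *
          (U x o : Set (V × ℕ)).indicator 1 a +
        K * (∑ o : 𝓖.Occurrence x, 𝓖.rate o.1.1 * (U x o : Set (V × ℕ)).indicator 1 p +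
          ∑ o : 𝓖.Occurrence x, 𝓖.rate o.1.1 * (U x o : Set (V × ℕ)).indicator 1 q) := by
      rw [Finset.sum_comm, ← Finset.sum_add_distrib, Finset.mul_sum, Finset.mul_sum,
        ← Finset.sum_add_distrib]
      refine Finset.sum_congr rfl fun o _ => ?_
      simp only [hη]
      rw [← Finset.mul_sum]
      ring
    rw [e1]
    refine add_le_add (mul_le_mul_of_nonneg_left ?_ hθ1)
      (mul_le_mul_of_nonneg_left (by linarith [hrate p, hrate q]) hK0)
    refine (Finset.sum_le_sum fun a _ => hrate a).trans ?_
    rw [Finset.sum_const, nsmul_eq_mul, mul_comm]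
    exact mul_le_mul_of_nonneg_left (hscard p hp q hq) hc
  calc _ ≤ ∑ o : 𝓖.Occurrence x, 𝓖.rate o.1.1 *
        ∑ p ∈ δ.1, ∑ q ∈ δ.2.1, θ ^ x.graph.dist p q * η o p q :=
        Finset.sum_le_sum fun o _ => mul_le_mul_of_nonneg_left (hstep o) (𝓖.rate_pos _).le
    _ = ∑ p ∈ δ.1, ∑ q ∈ δ.2.1, θ ^ x.graph.dist p q *
        ∑ o : 𝓖.Occurrence x, 𝓖.rate o.1.1 * η o p q := by
        simp only [Finset.mul_sum]
        rw [Finset.sum_comm]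
        refine Finset.sum_congr rfl fun p _ => ?_
        rw [Finset.sum_comm]
        exact Finset.sum_congr rfl fun q _ => Finset.sum_congr rfl fun o _ => by ring
    _ ≤ _ := Finset.sum_le_sum fun p hp => Finset.sum_le_sum fun q hq =>
        mul_le_mul_of_nonneg_left (hηrate p hp q hq) (by positivity)

/-- The rate at which a geodesic is hit is proportional to its length, and no exponential prefactor
can absorb this. Letting the base move with `θ' = a * (θ - 1)` produces the needed factor `d` from
the derivative of `θ ^ d`, with `θ ≤ 2` used to compare `θ ^ d` and `θ ^ (d - 1)`. The contributions
without the factor `d` go into `b`. -/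
theorem Controlled.supersolution_distSum (h : 𝓖.Controlled V n C c U U') (hc : 0 ≤ c) {a b : ℝ}
    (ha : a = 2 * c * (C * 2 ^ C)) (hb : b = c * (C * 2 ^ C) + (C * C + C) * 2 ^ C * (2 * c))
    {T ε : ℝ} (hε : 0 ≤ ε) (hεT : ε * Real.exp (a * T) ≤ 1) :
    IsSupersolution 𝓖 (MarkInv n B B') (updateMarks C U U') T
      fun t x δ => Real.exp (b * t) * distSum (1 + ε * Real.exp (a * t)) x δ.1 δ.2.1 := by
  have ha0 : 0 ≤ a := by rw [ha]; positivity
  have hpos : ∀ t, 0 ≤ ε * Real.exp (a * t) := fun t => by positivity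
  refine ⟨fun x δ _ t _ => mul_nonneg (Real.exp_pos _).le (Finset.sum_nonneg fun p _ =>
    Finset.sum_nonneg fun q _ => pow_nonneg (by linarith [hpos t]) _), fun x δ hx => ?_⟩
  set θ : ℝ → ℝ := fun t => 1 + ε * Real.exp (a * t) with hθ
  have hθd : ∀ t, HasDerivAt θ (a * (θ t - 1)) t := by
    intro t
    have e1 : HasDerivAt (fun t => Real.exp (a * t)) (Real.exp (a * t) * (a * 1)) t :=
      ((hasDerivAt_id t).const_mul a).exp
    exact ((e1.const_mul ε).const_add 1).congr_deriv (by simp only [hθ]; ring)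
  have hθc : Continuous θ := by simp only [hθ]; fun_prop
  have hsd : ∀ t, HasDerivAt (fun t => distSum (θ t) x δ.1 δ.2.1)
      (∑ p ∈ δ.1, ∑ q ∈ δ.2.1, x.graph.dist p q * θ t ^ (x.graph.dist p q - 1) *
        (a * (θ t - 1))) t := by
    intro t
    exact HasDerivAt.fun_sum fun p _ => HasDerivAt.fun_sum fun q _ => (hθd t).pow _
  have hed : ∀ t, HasDerivAt (fun t => Real.exp (b * t)) (b * Real.exp (b * t)) t := by
    intro t
    simpa using hasDerivAt_exp_mul b 1 t
  refine ⟨_, ?_, fun t => (hed t).mul (hsd t), fun t ht => ?_⟩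
  · simp only [distSum]
    fun_prop
  · have h1 : 1 ≤ θ t := by simp only [hθ]; linarith [hpos t]
    have h2 : θ t ≤ 2 := by
      have : ε * Real.exp (a * t) ≤ ε * Real.exp (a * T) := by
        have := ht.2
        gcongr
      simp only [hθ]; linarith
    simp only [← mul_sub]
    have e1 : ∑' o : 𝓖.Occurrence x, 𝓖.rate o.1.1 * (Real.exp (b * t) *
        (distSum (θ t) o.result (updateMarks C U U' x o δ).1 (updateMarks C U U' x o δ).2.1 -
          distSum (θ t) x δ.1 δ.2.1)) = Real.exp (b * t) *
        ∑' o : 𝓖.Occurrence x, 𝓖.rate o.1.1 *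
        (distSum (θ t) o.result (updateMarks C U U' x o δ).1 (updateMarks C U U' x o δ).2.1 -
          distSum (θ t) x δ.1 δ.2.1) := by
      rw [← tsum_mul_left]
      exact tsum_congr fun o => by ring
    rw [e1, show b * Real.exp (b * t) * distSum (1 + ε * Real.exp (a * t)) x δ.1 δ.2.1 =
      Real.exp (b * t) * (b * distSum (θ t) x δ.1 δ.2.1) by ring, ← mul_add]
    refine mul_le_mul_of_nonneg_left ?_ (Real.exp_pos _).le
    refine (h.distSum_rate_le hx h1 h2).trans ?_
    simp only [distSum, Finset.mul_sum, ← Finset.sum_add_distrib]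
    refine Finset.sum_le_sum fun p _ => Finset.sum_le_sum fun q _ => ?_
    set d := x.graph.dist p q
    set M : ℝ := C * 2 ^ C with hM
    have hM0 : 0 ≤ M := by positivity
    have h3 : θ t ^ C - 1 ≤ M * (θ t - 1) := pow_sub_one_le_mul_sub_one h1 h2 C
    have hd0 : 0 < θ t ^ d := by positivity
    have h4 : (d : ℝ) * θ t ^ d ≤ d * (2 * θ t ^ (d - 1)) := by
      refine mul_le_mul_of_nonneg_left ?_ (Nat.cast_nonneg d)
      rcases Nat.eq_zero_or_pos d with hd | hd
      · rw [hd]; norm_num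
      · obtain ⟨e, he⟩ := Nat.exists_eq_succ_of_ne_zero hd.ne'
        rw [he, Nat.succ_sub_one, pow_succ]
        have : 0 < θ t ^ e := by positivity
        nlinarith
    have h5 : (θ t ^ C - 1) * (c * (d + 1)) ≤ M * (θ t - 1) * (c * (d + 1)) :=
      mul_le_mul_of_nonneg_right h3 (by positivity)
    have h6 : θ t ^ d * (M * (θ t - 1) * (c * (d + 1))) ≤
        c * M * θ t ^ d + d * θ t ^ (d - 1) * (a * (θ t - 1)) := by
      have h7 : 0 ≤ c * M * (θ t - 1) := mul_nonneg (mul_nonneg hc hM0) (by linarith)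
      have h8 := mul_le_mul_of_nonneg_left h4 h7
      have h9 : c * M * (θ t - 1) * θ t ^ d ≤ c * M * θ t ^ d := by
        have : 0 ≤ c * M * θ t ^ d := by positivity
        nlinarith
      rw [ha]
      nlinarith
    have h10 := mul_le_mul_of_nonneg_left h5 hd0.le
    rw [hb]
    nlinarith

end RandomGrammar

end GraphGrammar

namespace GraphGrammar

namespace SpinGraph

variable {L S : Type*}

/-! ### Green functions -/

/-- The sum of a function over the neighbours of a vertex. -/
def adjSum (x : SpinGraph L S) (φ : L → ℝ≥0∞) (p : L) : ℝ≥0∞ :=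
  ∑' q, (x.graph.neighborSet p).indicator φ q

theorem adjSum_eq_sum {x : SpinGraph L S} {p : L} {s : Finset L}
    (hs : ∀ u, u ∈ s ↔ x.graph.Adj p u) (φ : L → ℝ≥0∞) : x.adjSum φ p = ∑ q ∈ s, φ q := by
  unfold adjSum
  rw [tsum_eq_sum (s := s)]
  · exact Finset.sum_congr rfl fun q hq => Set.indicator_of_mem ((hs q).1 hq) _
  · exact fun q hq => Set.indicator_of_notMem (fun h => hq ((hs q).2 h)) _

theorem adjSum_mono_of_adj {x : SpinGraph L S} {p : L} {φ χ : L → ℝ≥0∞}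
    (h : ∀ q, x.graph.Adj p q → φ q ≤ χ q) : x.adjSum φ p ≤ x.adjSum χ p := by
  refine ENNReal.tsum_le_tsum fun q => ?_
  by_cases hq : q ∈ x.graph.neighborSet p
  · rw [Set.indicator_of_mem hq, Set.indicator_of_mem hq]
    exact h q hq
  · rw [Set.indicator_of_notMem hq]
    exact zero_le

theorem adjSum_mono (x : SpinGraph L S) {φ χ : L → ℝ≥0∞} (h : φ ≤ χ) : x.adjSum φ ≤ x.adjSum χ :=
  fun _ => adjSum_mono_of_adj fun q _ => h q

theorem adjSum_tsum (x : SpinGraph L S) {ι : Type*} (a : ι → ℝ≥0∞) (φ : ι → L → ℝ≥0∞) :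
    x.adjSum (fun q => ∑' i, a i * φ i q) = fun p => ∑' i, a i * x.adjSum (φ i) p := by
  ext p
  unfold adjSum
  simp_rw [← ENNReal.tsum_mul_left]
  rw [ENNReal.tsum_comm]
  refine tsum_congr fun q => ?_
  by_cases hq : q ∈ x.graph.neighborSet p
  · simp only [Set.indicator_of_mem hq]
  · simp only [Set.indicator_of_notMem hq, mul_zero, tsum_zero]

theorem adjSum_add (x : SpinGraph L S) (φ χ : L → ℝ≥0∞) (p : L) :
    x.adjSum (fun q => φ q + χ q) p = x.adjSum φ p + x.adjSum χ p := by
  unfold adjSum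
  rw [← ENNReal.tsum_add]
  refine tsum_congr fun q => ?_
  by_cases hq : q ∈ x.graph.neighborSet p
  · simp only [Set.indicator_of_mem hq]
  · simp only [Set.indicator_of_notMem hq, add_zero]

theorem adjSum_const_mul (x : SpinGraph L S) (a : ℝ≥0∞) (φ : L → ℝ≥0∞) (p : L) :
    x.adjSum (fun q => a * φ q) p = a * x.adjSum φ p := by
  have := congrFun (x.adjSum_tsum (fun _ : Unit => a) fun _ => φ) p
  simpa using this

theorem adjSum_le {x : SpinGraph L S} {n : ℕ} (hx : x.DegreeLE n) {φ : L → ℝ≥0∞} {b : ℝ≥0∞}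
    {p : L} (h : ∀ q, x.graph.Adj p q → φ q ≤ b) : x.adjSum φ p ≤ n * b := by
  obtain ⟨s, hs, hc⟩ := exists_finset_neighborSet hx p
  rw [adjSum_eq_sum hs]
  refine (Finset.sum_le_card_nsmul s φ b fun q hq => h q ((hs q).1 hq)).trans ?_
  rw [nsmul_eq_mul]
  gcongr

theorem adjSum_eq_zero {x : SpinGraph L S} {φ : L → ℝ≥0∞} {p : L}
    (h : ∀ q, x.graph.Adj p q → φ q = 0) : x.adjSum φ p = 0 := by
  unfold adjSum
  rw [ENNReal.tsum_eq_zero]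
  intro q
  by_cases hq : q ∈ x.graph.neighborSet p
  · rw [Set.indicator_of_mem hq]; exact h q hq
  · exact Set.indicator_of_notMem hq _

theorem adjSum_finset_sum (x : SpinGraph L S) {ι : Type*} (s : Finset ι) (φ : ι → L → ℝ≥0∞)
    (p : L) : x.adjSum (fun q => ∑ i ∈ s, φ i q) p = ∑ i ∈ s, x.adjSum (φ i) p := by
  classical
  induction s using Finset.induction_on with
  | empty => exact adjSum_eq_zero fun _ _ => by simp
  | insert i s hi ih => simp only [Finset.sum_insert hi, adjSum_add, ih]

/-- The sum of `z ^ |w| φ(end of w)` over all walks `w` from a vertex. -/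
def green (x : SpinGraph L S) (z : ℝ≥0∞) (φ : L → ℝ≥0∞) (p : L) : ℝ≥0∞ :=
  ∑' l, z ^ l * (x.adjSum^[l] φ) p

theorem green_eq (x : SpinGraph L S) (z : ℝ≥0∞) (φ : L → ℝ≥0∞) (p : L) :
    x.green z φ p = φ p + z * x.adjSum (x.green z φ) p := by
  unfold green
  rw [adjSum_tsum, tsum_eq_zero_add' ENNReal.summable, ← ENNReal.tsum_mul_left]
  simp only [pow_zero, Function.iterate_zero, id, one_mul]
  congr 1
  refine tsum_congr fun l => ?_
  rw [Function.iterate_succ_apply', pow_succ']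
  ring

theorem le_green (x : SpinGraph L S) (z : ℝ≥0∞) (φ : L → ℝ≥0∞) (p : L) : φ p ≤ x.green z φ p := by
  rw [green_eq]; exact le_self_add

theorem mul_adjSum_green_le (x : SpinGraph L S) (z : ℝ≥0∞) (φ : L → ℝ≥0∞) (p : L) :
    z * x.adjSum (x.green z φ) p ≤ x.green z φ p := by
  rw [x.green_eq z φ p]; exact le_add_self

/-- The Green function is the least solution of its equation. -/
theorem green_le {x : SpinGraph L S} {z : ℝ≥0∞} {φ W : L → ℝ≥0∞}
    (h : ∀ p, φ p + z * x.adjSum W p ≤ W p) (p : L) : x.green z φ p ≤ W p := by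
  refine ENNReal.tsum_le_of_sum_range_le fun m => ?_
  induction m generalizing p with
  | zero => simp
  | succ m ih =>
    refine le_trans ?_ (h p)
    rw [Finset.sum_range_succ']
    simp only [pow_zero, Function.iterate_zero, id, one_mul]
    rw [add_comm]
    refine add_le_add le_rfl ?_
    have h1 : ∑ l ∈ Finset.range m, z ^ (l + 1) * (x.adjSum^[l + 1] φ) p =
        z * x.adjSum (fun q => ∑ l ∈ Finset.range m, z ^ l * (x.adjSum^[l] φ) q) p := by
      rw [adjSum_finset_sum, Finset.mul_sum]
      refine Finset.sum_congr rfl fun l _ => ?_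
      rw [Function.iterate_succ_apply', pow_succ', adjSum_const_mul]
      ring
    rw [h1]
    exact mul_le_mul_right (x.adjSum_mono (fun q => ih q) p) _

theorem green_mono (x : SpinGraph L S) (z : ℝ≥0∞) {φ χ : L → ℝ≥0∞} (h : φ ≤ χ) (p : L) :
    x.green z φ p ≤ x.green z χ p :=
  green_le (fun q => by rw [x.green_eq z χ q]; exact add_le_add (h q) le_rfl) p

theorem green_const_mul (x : SpinGraph L S) (z a : ℝ≥0∞) (φ : L → ℝ≥0∞) (p : L) :
    x.green z (fun q => a * φ q) p = a * x.green z φ p := by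
  unfold green
  rw [← ENNReal.tsum_mul_left]
  refine tsum_congr fun l => ?_
  have : x.adjSum^[l] (fun q => a * φ q) = fun q => a * (x.adjSum^[l] φ) q := by
    induction l with
    | zero => rfl
    | succ l ih =>
      ext q
      rw [Function.iterate_succ_apply', ih, adjSum_const_mul, Function.iterate_succ_apply']
  rw [this]
  ring

theorem green_sum (x : SpinGraph L S) (z : ℝ≥0∞) {ι : Type*} (s : Finset ι)
    (φ : ι → L → ℝ≥0∞) (p : L) :
    x.green z (fun q => ∑ i ∈ s, φ i q) p = ∑ i ∈ s, x.green z (φ i) p := by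
  unfold green
  have : ∀ l, x.adjSum^[l] (fun q => ∑ i ∈ s, φ i q) =
      fun q => ∑ i ∈ s, (x.adjSum^[l] (φ i)) q := by
    intro l
    induction l with
    | zero => rfl
    | succ l ih =>
      ext q
      rw [Function.iterate_succ_apply', ih]
      rw [adjSum_finset_sum]
      exact Finset.sum_congr rfl fun i _ => by rw [Function.iterate_succ_apply']
  simp only [this, Finset.mul_sum]
  exact Summable.tsum_finsetSum fun _ _ => ENNReal.summable

theorem iterate_adjSum_le {x : SpinGraph L S} {n : ℕ} (hx : x.DegreeLE n) {φ : L → ℝ≥0∞}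
    (h : ∀ p, φ p ≤ 1) (l : ℕ) (p : L) : (x.adjSum^[l] φ) p ≤ n ^ l := by
  induction l generalizing p with
  | zero => simpa using h p
  | succ l ih =>
    rw [Function.iterate_succ_apply', pow_succ']
    exact adjSum_le hx fun q _ => ih q

section Bounds

variable {n : ℕ} {z : ℝ≥0∞}

theorem green_le_two_mul {x : SpinGraph L S} (hx : x.DegreeLE n) (hz : z * n ≤ 4⁻¹)
    {φ : L → ℝ≥0∞} {b : ℝ≥0∞} (h : ∀ p, φ p ≤ b) (p : L) : x.green z φ p ≤ 2 * b := by
  refine green_le (W := fun _ => 2 * b) (fun q => ?_) p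
  calc φ q + z * x.adjSum (fun _ => 2 * b) q ≤ b + z * (n * (2 * b)) :=
        add_le_add (h q) (mul_le_mul_right (adjSum_le hx fun _ _ => le_rfl) _)
    _ = b + z * n * 2 * b := by ring
    _ ≤ b + 4⁻¹ * 2 * b := by gcongr
    _ ≤ b + 1 * b := by
        gcongr
        rw [mul_comm, ← div_eq_mul_inv]
        exact ENNReal.div_le_of_le_mul (by norm_num)
    _ = 2 * b := by ring

/-- Prefixing a fixed path from `p` to `q` to the walks from `q` costs a factor `z` per link. -/
theorem green_harnack (x : SpinGraph L S) (z : ℝ≥0∞) (φ : L → ℝ≥0∞) {p q : L} {N : ℕ}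
    (h : q ∈ x.ball p N) (hz : z ≤ 1) : z ^ N * x.green z φ q ≤ x.green z φ p := by
  obtain ⟨w, hw⟩ := exists_walk_of_mem_ball h
  have hpow : z ^ N ≤ z ^ w.length := pow_le_pow_right_of_le_one' hz hw
  refine (mul_le_mul_left hpow _).trans ?_
  clear hpow hw h
  induction w with
  | nil => simp
  | @cons a b c hab w ih =>
    rw [SimpleGraph.Walk.length_cons, pow_succ', mul_assoc]
    refine (mul_le_mul_right ih _).trans (le_trans ?_ (x.mul_adjSum_green_le z φ a))
    refine mul_le_mul_right ?_ _
    unfold adjSum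
    have := ENNReal.le_tsum (f := (x.graph.neighborSet a).indicator (x.green z φ)) b
    rwa [Set.indicator_of_mem (show b ∈ x.graph.neighborSet a from hab)] at this

/-- The effect of a local move on a Green function. -/
theorem LocalMove.green_le {C : ℕ} {x y : SpinGraph L S} {U U' : Finset L}
    (h : LocalMove C x y U U') (hx : x.DegreeLE n) (hy : y.DegreeLE n) (hz : z * n ≤ 4⁻¹)
    {g : L → ℝ≥0∞} (hg : ∀ p ∈ U', g p ≤ ∑ b ∈ U, x.green z g b) :
    (∀ p ∈ U', y.green z g p ≤ 3 * ∑ b ∈ U, x.green z g b) ∧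
    ∀ p ∉ U', y.green z g p ≤ x.green z g p +
      3 * (x.green z ((U : Set L).indicator 1) p * ∑ b ∈ U, x.green z g b) := by
  classical
  set s := ∑ b ∈ U, x.green z g b with hs
  set H := x.green z ((U : Set L).indicator 1) with hH
  -- `W` satisfies the inequality of `green_le` in the graph `y`. Since `H ≥ 1` on `U`, the
  -- correction `3 * min 1 H * s` equals `3 * s` there and dominates the value on `U'`; the
  -- truncation at 1 bounds the correction by `3 * s` everywhere. The constant 3 closes the estimate
  -- on `U'`: the source, the outer neighbours and the remainder each contribute at most `s`.
  set W : L → ℝ≥0∞ := fun p => if p ∈ U' then 3 * s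
    else x.green z g p + 3 * (min 1 (H p) * s) with hW
  have hU's : ∀ q ∈ x.verts, q ∈ U' → q ∈ U := by
    intro q hq hq'
    by_contra hqU
    exact ((h.mem_iff q).1 ⟨hq, hqU⟩).2 hq'
  have hzn : ∀ b : ℝ≥0∞, z * (n * b) ≤ 4⁻¹ * b := fun b => by
    rw [← mul_assoc]; gcongr
  have key : ∀ p, y.green z g p ≤ W p := by
    refine SpinGraph.green_le fun p => ?_
    by_cases hpU' : p ∈ U'
    · have hWp : W p = 3 * s := if_pos hpU'
      rw [hWp]
      set Z' : L → ℝ≥0∞ := fun q => if q ∈ U' then 0 else x.green z g q with hZ'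
      have h1 : y.adjSum W p ≤ y.adjSum Z' p + n * (3 * s) := by
        calc y.adjSum W p ≤ y.adjSum (fun q => Z' q + 3 * s) p := by
              refine adjSum_mono_of_adj fun q _ => ?_
              by_cases hq : q ∈ U'
              · simp only [hW, hZ', hq, if_true, zero_add, le_refl]
              · simp only [hW, hZ', hq, if_false]
                gcongr
                exact mul_le_of_le_one_left' (min_le_left _ _)
          _ = y.adjSum Z' p + y.adjSum (fun _ => 3 * s) p := adjSum_add _ _ _ _
          _ ≤ _ := by gcongr; exact adjSum_le hy fun _ _ => le_rfl
      -- Links of `y` from `U'` to the outside are old links. If `p` was in `U`, its Green function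
      -- in `x` already accounts for these neighbours; otherwise `p` is new and has no such links.
      have h2 : z * y.adjSum Z' p ≤ s := by
        by_cases hpU : p ∈ U
        · refine le_trans ?_ ((x.mul_adjSum_green_le z g p).trans
            (Finset.single_le_sum (f := fun b => x.green z g b) (fun _ _ => zero_le) hpU))
          refine mul_le_mul_right (ENNReal.tsum_le_tsum fun q => ?_) _
          by_cases hq : q ∈ y.graph.neighborSet p
          · rw [Set.indicator_of_mem hq]
            by_cases hqU' : q ∈ U'
            · simp only [hZ', hqU', if_true]; exact zero_le
            · simp only [hZ', hqU', if_false]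
              have hqx := (h.mem_iff q).2 ⟨mem_verts_of_adj (SimpleGraph.Adj.symm hq), hqU'⟩
              have : q ∈ x.graph.neighborSet p :=
                ((h.adj_iff q hqx.1 hqx.2 p).2 (SimpleGraph.Adj.symm hq)).symm
              rw [Set.indicator_of_mem this]
          · rw [Set.indicator_of_notMem hq]; exact zero_le
        · rw [adjSum_eq_zero, mul_zero]
          · exact zero_le
          · intro q hq
            simp only [hZ', ite_eq_left_iff]
            intro hqU'
            have hqx := (h.mem_iff q).2 ⟨mem_verts_of_adj hq.symm, hqU'⟩
            have := (h.adj_iff q hqx.1 hqx.2 p).2 hq.symm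
            exact absurd (hU's p (mem_verts_of_adj this.symm) hpU') hpU
      calc g p + z * y.adjSum W p ≤ s + z * (y.adjSum Z' p + n * (3 * s)) := by
            gcongr
            exact hg p hpU'
        _ = s + (z * y.adjSum Z' p + z * (n * (3 * s))) := by rw [mul_add]
        _ ≤ s + (s + 4⁻¹ * (3 * s)) := by
            exact add_le_add le_rfl (add_le_add h2 (hzn _))
        _ ≤ s + (s + 1 * s) := by
            rw [← mul_assoc]
            gcongr
            rw [mul_comm, ← div_eq_mul_inv]
            exact ENNReal.div_le_of_le_mul (by norm_num)
        _ = 3 * s := by ring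
    · have hWp : W p = x.green z g p + 3 * (min 1 (H p) * s) := if_neg hpU'
      rw [hWp]
      by_cases hpy : p ∈ y.verts
      · obtain ⟨hpx, hpU⟩ := (h.mem_iff p).2 ⟨hpy, hpU'⟩
        have h1 : y.adjSum W p = x.adjSum W p := by
          unfold adjSum
          have : y.graph.neighborSet p = x.graph.neighborSet p :=
            Set.ext fun q => (h.adj_iff p hpx hpU q).symm
          rw [this]
        have h2 : x.adjSum W p ≤ x.adjSum (x.green z g) p +
            3 * s * x.adjSum (fun q => min 1 (H q)) p := by
          rw [← adjSum_const_mul, ← adjSum_add]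
          refine adjSum_mono_of_adj fun q hq => ?_
          by_cases hqU' : q ∈ U'
          · have hqU := hU's q (mem_verts_of_adj hq.symm) hqU'
            have hHq : 1 ≤ H q := by
              refine le_trans ?_ (x.le_green z _ q)
              rw [Set.indicator_of_mem (by exact_mod_cast hqU)]
              rfl
            simp only [hW, hqU', if_true, min_eq_left hHq, mul_one]
            exact le_add_self
          · simp only [hW, hqU', if_false]
            exact le_of_eq (by ring)
        have h3 : z * x.adjSum (fun q => min 1 (H q)) p ≤ min 1 (H p) := by
          refine le_min ?_ ?_
          · refine (mul_le_mul_right (adjSum_le hx (b := 1) fun q _ => min_le_left _ _) _).trans ?_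
            refine (hzn 1).trans ?_
            rw [mul_one]
            exact ENNReal.inv_le_one.2 (by norm_num)
          · refine le_trans ?_ (x.mul_adjSum_green_le z _ p)
            exact mul_le_mul_right (x.adjSum_mono (fun q => min_le_right _ _) p) _
        rw [h1]
        calc g p + z * x.adjSum W p ≤ g p + z * (x.adjSum (x.green z g) p +
              3 * s * x.adjSum (fun q => min 1 (H q)) p) := by gcongr
          _ = (g p + z * x.adjSum (x.green z g) p) +
              3 * s * (z * x.adjSum (fun q => min 1 (H q)) p) := by ring
          _ ≤ x.green z g p + 3 * s * min 1 (H p) := by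
              rw [← x.green_eq z g p]
              gcongr
          _ = x.green z g p + 3 * (min 1 (H p) * s) := by ring
      · rw [adjSum_eq_zero, mul_zero, add_zero]
        · exact (x.le_green z g p).trans le_self_add
        · exact fun q hq => absurd (mem_verts_of_adj hq) hpy
  refine ⟨fun p hp => (key p).trans (le_of_eq (if_pos hp)), fun p hp =>
    (key p).trans ((le_of_eq (if_neg hp)).trans ?_)⟩
  gcongr
  exact min_le_right _ _

theorem tsum_tsum_add (F : ℕ → ℝ≥0∞) : ∑' l, ∑' m, F (l + m) = ∑' k : ℕ, ((k : ℝ≥0∞) + 1) * F k := by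
  have e := (Finset.HasAntidiagonal.sigmaAntidiagonalEquivProd (A := ℕ)).tsum_eq
    fun p : ℕ × ℕ => F (p.1 + p.2)
  rw [← ENNReal.tsum_prod (f := fun l m => F (l + m)), ← e, ENNReal.tsum_sigma']
  refine tsum_congr fun k => ?_
  rw [tsum_fintype]
  have : ∀ b : Finset.HasAntidiagonal.antidiagonal k,
      F ((Finset.HasAntidiagonal.sigmaAntidiagonalEquivProd ⟨k, b⟩).1 +
        (Finset.HasAntidiagonal.sigmaAntidiagonalEquivProd ⟨k, b⟩).2) = F k := by
    intro b
    congr 1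
    exact Finset.HasAntidiagonal.mem_antidiagonal.1 b.2
  rw [Finset.sum_congr rfl fun b _ => this b]
  simp

/-- A walk of length `k` can be cut into two consecutive walks in `k + 1` ways. -/
theorem green_green (x : SpinGraph L S) (z : ℝ≥0∞) (g : L → ℝ≥0∞) (p : L) :
    x.green z (x.green z g) p = ∑' k : ℕ, ((k : ℝ≥0∞) + 1) * (z ^ k * (x.adjSum^[k] g) p) := by
  rw [← tsum_tsum_add]
  have : ∀ l, x.adjSum^[l] (x.green z g) = fun q => ∑' m, z ^ m * (x.adjSum^[l + m] g) q := by
    intro l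
    induction l with
    | zero => ext q; simp [green]
    | succ l ih =>
      rw [Function.iterate_succ_apply', ih, adjSum_tsum]
      ext q
      refine tsum_congr fun m => ?_
      rw [show l + 1 + m = (l + m) + 1 by ring, Function.iterate_succ_apply']
  conv_lhs => unfold green
  refine tsum_congr fun l => ?_
  change z ^ l * (x.adjSum^[l] (x.green z g)) p = _
  rw [this, ← ENNReal.tsum_mul_left]
  exact tsum_congr fun m => by rw [pow_add]; ring

/-- The entropy bound for the iterated Green function. -/
theorem green_green_le {x : SpinGraph L S} (hx : x.DegreeLE n) (hz : z * n ≤ 4⁻¹)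
    {g : L → ℝ≥0∞} (hg : ∀ p, g p ≤ 1) {p : L} (hp : g p ≠ 0) :
    x.green z (x.green z g) p ≤ ENNReal.ofReal (3 * (x.green z g p).toReal *
      Real.log (8 / (x.green z g p).toReal)) := by
  set Z := x.green z g p with hZ
  have hZ2 : Z ≤ 2 := by simpa using green_le_two_mul hx hz hg p
  have hZtop : Z ≠ ⊤ := ne_top_of_le_ne_top (by norm_num) hZ2
  have hZ0 : Z ≠ 0 := fun h => hp (le_antisymm (h ▸ x.le_green z g p) zero_le)
  set ζ := Z.toReal with hζ
  have hζ0 : 0 < ζ := ENNReal.toReal_pos hZ0 hZtop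
  have hζ2 : ζ ≤ 2 := by
    have := ENNReal.toReal_mono (by norm_num) hZ2
    simpa using this
  set Λ := Real.log (8 / ζ) with hΛ
  -- The constant 8 serves here: `ζ ≤ 2` gives `8 / ζ ≥ 4 > e`.
  have hΛ1 : 1 ≤ Λ := by
    rw [hΛ, Real.le_log_iff_exp_le (by positivity)]
    have h1 : (4 : ℝ) ≤ 8 / ζ := by rw [le_div_iff₀ hζ0]; linarith
    linarith [Real.exp_one_lt_d9]
  -- Lengths up to about `Λ` are charged to the sum `ζ` itself, longer ones to the geometric tail
  -- `4⁻¹ ^ k`, where even `ζ * 2 ^ k` is affordable. The inequality is `x + 1 ≤ exp x` at `x = (k +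
  -- 1) * log 2 - Λ`, with `exp (-Λ) = ζ / 8`.
  have hk : ∀ k : ℕ, ((k : ℝ≥0∞) + 1) ≤ ENNReal.ofReal (2 * Λ) + ENNReal.ofReal (ζ / 2) * 2 ^ k := by
    intro k
    have h1 : ((k : ℝ) + 1) ≤ 2 * Λ + ζ / 2 * 2 ^ k := by
      have h2 := Real.add_one_le_exp (((k : ℝ) + 1) * Real.log 2 - Λ)
      have h3 : Real.exp (((k : ℝ) + 1) * Real.log 2 - Λ) = 2 ^ k * ζ / 4 := by
        rw [Real.exp_sub, hΛ, Real.exp_log (by positivity), mul_comm, Real.exp_mul,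
          Real.exp_log (by norm_num)]
        have : (2 : ℝ) ^ ((k : ℝ) + 1) = 2 ^ k * 2 := by
          rw [Real.rpow_add (by norm_num), Real.rpow_natCast, Real.rpow_one]
        rw [this]
        field_simp
        norm_num
      have h4 := Real.log_two_gt_d9
      have h5 : (0 : ℝ) ≤ k := Nat.cast_nonneg k
      rw [h3] at h2
      nlinarith
    have h6 : ((k : ℝ≥0∞) + 1) = ENNReal.ofReal ((k : ℝ) + 1) := by
      rw [ENNReal.ofReal_add (Nat.cast_nonneg k) zero_le_one, ENNReal.ofReal_natCast,
        ENNReal.ofReal_one]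
    rw [h6]
    refine (ENNReal.ofReal_le_ofReal h1).trans (le_of_eq ?_)
    rw [ENNReal.ofReal_add (by linarith) (by positivity),
      ENNReal.ofReal_mul (p := ζ / 2) (by positivity), ENNReal.ofReal_pow (by norm_num)]
    norm_num
  have ha : ∀ k, z ^ k * (x.adjSum^[k] g) p ≤ 4⁻¹ ^ k := by
    intro k
    refine (mul_le_mul_right (iterate_adjSum_le hx hg k p) _).trans ?_
    rw [← mul_pow]
    exact pow_le_pow_left' hz k
  have hgeom : ∑' k : ℕ, (2 : ℝ≥0∞) ^ k * 4⁻¹ ^ k = 2 := by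
    have h1 : ∀ k : ℕ, (2 : ℝ≥0∞) ^ k * 4⁻¹ ^ k = 2⁻¹ ^ k := by
      intro k
      rw [← mul_pow]
      congr 1
      rw [show (4 : ℝ≥0∞) = 2 * 2 by norm_num, ENNReal.mul_inv (by simp) (by simp), ← mul_assoc,
        ENNReal.mul_inv_cancel (by norm_num) (by norm_num), one_mul]
    simp_rw [h1]
    rw [ENNReal.tsum_geometric, ENNReal.one_sub_inv_two, inv_inv]
  rw [green_green]
  calc ∑' k : ℕ, ((k : ℝ≥0∞) + 1) * (z ^ k * (x.adjSum^[k] g) p)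
      ≤ ∑' k : ℕ, (ENNReal.ofReal (2 * Λ) * (z ^ k * (x.adjSum^[k] g) p) +
        ENNReal.ofReal (ζ / 2) * (2 ^ k * 4⁻¹ ^ k)) := by
        refine ENNReal.tsum_le_tsum fun k => ?_
        refine (mul_le_mul_left (hk k) _).trans ?_
        rw [add_mul]
        refine add_le_add le_rfl ?_
        rw [mul_assoc]
        gcongr
        exact ha k
    _ = ENNReal.ofReal (2 * Λ) * Z + ENNReal.ofReal (ζ / 2) * 2 := by
        rw [ENNReal.tsum_add, ENNReal.tsum_mul_left, ENNReal.tsum_mul_left, hgeom]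
        rfl
    _ = ENNReal.ofReal (2 * Λ * ζ + ζ) := by
        rw [ENNReal.ofReal_add (by positivity) hζ0.le, ENNReal.ofReal_mul (by positivity) (q := ζ),
          hζ, ENNReal.ofReal_toReal hZtop]
        congr 1
        rw [← hζ, show (2 : ℝ≥0∞) = ENNReal.ofReal 2 by simp,
          ← ENNReal.ofReal_mul (by positivity), div_mul_cancel₀ _ (by norm_num), hζ,
          ENNReal.ofReal_toReal hZtop]
    _ ≤ ENNReal.ofReal (3 * ζ * Λ) := by
        refine ENNReal.ofReal_le_ofReal ?_
        nlinarith

end Bounds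

end SpinGraph

end GraphGrammar

/-! ### Powers of the potential as a supersolution. -/

namespace GraphGrammar

open SpinGraph

namespace RandomGrammar

variable {S V : Type*} {𝓖 : RandomGrammar S} {n C : ℕ} {c : ℝ}
  {U U' : ∀ x : SpinGraph (V × ℕ) S, 𝓖.Occurrence x → Finset (V × ℕ)} {B B' : Set V}

/-- The parameter of the Green functions for graphs with degrees at most `n`. -/
def greenParam (n : ℕ) : ℝ≥0∞ := ((4 * (n + 1) : ℕ) : ℝ≥0∞)⁻¹

theorem greenParam_mul_le (n : ℕ) : greenParam n * n ≤ 4⁻¹ := by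
  unfold greenParam
  rw [← ENNReal.div_eq_inv_mul]
  refine ENNReal.div_le_of_le_mul ?_
  push_cast
  rw [← mul_assoc, ENNReal.inv_mul_cancel (by norm_num) (by norm_num), one_mul]
  exact le_self_add

theorem greenParam_le_one (n : ℕ) : greenParam n ≤ 1 := by
  unfold greenParam
  rw [ENNReal.inv_le_one]
  exact_mod_cast (show 1 ≤ 4 * (n + 1) by omega)

theorem greenParam_pow_mul (n N : ℕ) : greenParam n ^ N * ((4 * (n + 1) : ℕ) : ℝ≥0∞) ^ N = 1 := by
  unfold greenParam
  rw [← mul_pow, ENNReal.inv_mul_cancel (by simp) (ENNReal.natCast_ne_top _), one_pow]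

theorem green_le_pow_mul {L : Type*} {x : SpinGraph L S} {φ : L → ℝ≥0∞} {p q : L} {N : ℕ}
    (h : q ∈ x.ball p N) : x.green (greenParam n) φ q ≤
      ((4 * (n + 1) : ℕ) : ℝ≥0∞) ^ N * x.green (greenParam n) φ p := by
  calc x.green (greenParam n) φ q
      = ((4 * (n + 1) : ℕ) : ℝ≥0∞) ^ N * (greenParam n ^ N * x.green (greenParam n) φ q) := by
        rw [← mul_assoc, mul_comm (_ ^ N), greenParam_pow_mul, one_mul]
    _ ≤ _ := mul_le_mul_right (green_harnack x _ φ h (greenParam_le_one n)) _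

/-- The Green function of a function of the first components of names. -/
def potential (n : ℕ) (g : V → ℝ≥0∞) (x : SpinGraph (V × ℕ) S) (p : V × ℕ) : ℝ≥0∞ :=
  x.green (greenParam n) (fun q => g q.1) p

section Potential

variable {g : V → ℝ≥0∞} {x : SpinGraph (V × ℕ) S}

theorem potential_le_two (hg : ∀ v, g v ≤ 1) (hx : x.DegreeLE n) (p : V × ℕ) :
    potential n g x p ≤ 2 :=
  (green_le_two_mul hx (greenParam_mul_le n) (fun q : V × ℕ => hg q.1) p).trans_eq (mul_one 2)

theorem potential_ne_top (hg : ∀ v, g v ≤ 1) (hx : x.DegreeLE n) (p : V × ℕ) :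
    potential n g x p ≠ ⊤ :=
  ne_top_of_le_ne_top (by norm_num) (potential_le_two hg hx p)

theorem toReal_potential_pos (hg : ∀ v, g v ≤ 1) (hg0 : ∀ v, g v ≠ 0) (hx : x.DegreeLE n)
    (p : V × ℕ) : 0 < (potential n g x p).toReal :=
  ENNReal.toReal_pos (fun h => hg0 p.1 (le_antisymm (h ▸ x.le_green _ (fun q => g q.1) p)
    zero_le)) (potential_ne_top hg hx p)

/-- The restriction to the affected region of the potential, summed along walks. -/
def regionPotential (n : ℕ) (g : V → ℝ≥0∞) (x : SpinGraph (V × ℕ) S) (R : Finset (V × ℕ))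
    (p : V × ℕ) : ℝ≥0∞ :=
  x.green (greenParam n) ((R : Set (V × ℕ)).indicator (potential n g x)) p

theorem regionPotential_ne_top (hg : ∀ v, g v ≤ 1) (hx : x.DegreeLE n) (R : Finset (V × ℕ))
    (p : V × ℕ) : regionPotential n g x R p ≠ ⊤ := by
  refine ne_top_of_le_ne_top (b := 2 * 2) (by norm_num)
    (green_le_two_mul hx (greenParam_mul_le n) (fun q => ?_) p)
  exact (Set.indicator_le_self _ _ _).trans (potential_le_two hg hx q)

/-- The Harnack inequality makes all potentials in a region of diameter at most `C` comparable. -/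
theorem Controlled.sum_potential_le (h : 𝓖.Controlled V n C c U U') (hx : x.InGF n)
    (o : 𝓖.Occurrence x) {a : V × ℕ} (ha : a ∈ U x o) :
    ∑ b ∈ U x o, potential n g x b ≤
      (C * (4 * (n + 1)) ^ C : ℕ) * potential n g x a := by
  have hm := h.move hx o
  refine (Finset.sum_le_card_nsmul _ _ (((4 * (n + 1) : ℕ) : ℝ≥0∞) ^ C * potential n g x a)
    fun b hb => green_le_pow_mul (hm.diam a ha b hb)).trans ?_
  rw [nsmul_eq_mul, Nat.cast_mul C, Nat.cast_pow, mul_assoc]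
  gcongr
  exact hm.card

theorem Controlled.potential_region_le (h : 𝓖.Controlled V n C c U U') (hx : x.InGF n)
    (o : 𝓖.Occurrence x) :
    (∀ p ∈ U' x o, potential n g o.result p ≤ 3 * ∑ b ∈ U x o, potential n g x b) ∧
    ∀ p ∉ U' x o, potential n g o.result p ≤ potential n g x p +
      3 * (x.green (greenParam n) ((U x o : Set (V × ℕ)).indicator 1) p *
        ∑ b ∈ U x o, potential n g x b) := by
  refine (h.move hx o).green_le hx.2.2 (h.result hx o).2.2 (greenParam_mul_le n)
    fun p hp => ?_
  obtain ⟨a, ha, hap⟩ := h.exists_mem_of_mem hx o hp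
  rw [← hap]
  exact (x.le_green (greenParam n) (fun q => g q.1) a).trans
    (Finset.single_le_sum (f := fun b => x.green (greenParam n) (fun q => g q.1) b)
      (fun _ _ => zero_le) ha)

theorem Controlled.toReal_potential_le_of_mem (h : 𝓖.Controlled V n C c U U') (hx : x.InGF n)
    (hg : ∀ v, g v ≤ 1) (o : 𝓖.Occurrence x) {a p : V × ℕ} (ha : a ∈ U x o) (hp : p ∈ U' x o) :
    (potential n g o.result p).toReal ≤
      3 * (C * (4 * (n + 1)) ^ C : ℕ) * (potential n g x a).toReal := by
  have h1 := ((h.potential_region_le hx o).1 p hp).trans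
    (mul_le_mul_right (h.sum_potential_le (g := g) hx o ha) _)
  have h2 := ENNReal.toReal_mono (ENNReal.mul_ne_top (by norm_num)
    (ENNReal.mul_ne_top (ENNReal.natCast_ne_top _) (potential_ne_top hg hx.2.2 a))) h1
  rw [ENNReal.toReal_mul, ENNReal.toReal_mul, ENNReal.toReal_natCast] at h2
  rw [mul_assoc]
  simpa using h2

theorem Controlled.toReal_potential_le_of_notMem (h : 𝓖.Controlled V n C c U U') (hx : x.InGF n)
    (hg : ∀ v, g v ≤ 1) (o : 𝓖.Occurrence x) {p : V × ℕ} (hp : p ∉ U' x o) :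
    (potential n g o.result p).toReal ≤ (potential n g x p).toReal +
      3 * (C * (4 * (n + 1)) ^ C : ℕ) * (regionPotential n g x (U x o) p).toReal := by
  have h1 := (h.potential_region_le (g := g) hx o).2 p hp
  set s := ∑ b ∈ U x o, potential n g x b with hs
  have h2 : x.green (greenParam n) ((U x o : Set (V × ℕ)).indicator 1) p * s ≤
      (C * (4 * (n + 1)) ^ C : ℕ) * regionPotential n g x (U x o) p := by
    rw [mul_comm, ← green_const_mul, regionPotential, ← green_const_mul]
    refine green_mono x _ (fun q => ?_) p
    by_cases hq : q ∈ (U x o : Set (V × ℕ))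
    · simp only [Set.indicator_of_mem hq, Pi.one_apply, mul_one]
      exact h.sum_potential_le hx o hq
    · simp only [Set.indicator_of_notMem hq, mul_zero, le_refl]
  have h3 := h1.trans (add_le_add le_rfl (mul_le_mul_right h2 _))
  have hr := regionPotential_ne_top hg hx.2.2 (U x o) p
  have hp := potential_ne_top hg hx.2.2 p
  have hnn : ((C * (4 * (n + 1)) ^ C : ℕ) : ℝ≥0∞) * regionPotential n g x (U x o) p ≠ ⊤ :=
    ENNReal.mul_ne_top (ENNReal.natCast_ne_top _) hr
  have h4 := ENNReal.toReal_mono (ENNReal.add_ne_top.2 ⟨hp,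
    ENNReal.mul_ne_top (by norm_num) hnn⟩) h3
  rw [ENNReal.toReal_add hp (ENNReal.mul_ne_top (by norm_num) hnn), ENNReal.toReal_mul,
    ENNReal.toReal_mul, ENNReal.toReal_natCast] at h4
  rw [mul_assoc]
  simpa using h4

/-- When the rates are summed inside the Green function, the indicators of the regions turn into a
factor at most `c`. What remains is the iterated Green function, to which the entropy bound applies.
-/
theorem Controlled.rate_regionPotential_le (h : 𝓖.Controlled V n C c U U') (hx : x.InGF n)
    (hg : ∀ v, g v ≤ 1) (hg0 : ∀ v, g v ≠ 0) (hc : 0 ≤ c) (p : V × ℕ) :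
    ∑' o : 𝓖.Occurrence x, 𝓖.rate o.1.1 * (regionPotential n g x (U x o) p).toReal ≤
      c * (3 * (potential n g x p).toReal * Real.log (8 / (potential n g x p).toReal)) := by
  have := 𝓖.finite_occurrence hx.1
  have := Fintype.ofFinite (𝓖.Occurrence x)
  rw [tsum_fintype]
  have hlog : 0 ≤ Real.log (8 / (potential n g x p).toReal) := by
    have h1 := toReal_potential_pos hg hg0 hx.2.2 p
    have h2 := ENNReal.toReal_mono (by norm_num) (potential_le_two hg hx.2.2 p)
    simp only [ENNReal.toReal_ofNat] at h2
    refine Real.log_nonneg ?_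
    rw [le_div_iff₀ h1]
    linarith
  have hbound : 0 ≤ 3 * (potential n g x p).toReal *
      Real.log (8 / (potential n g x p).toReal) := by positivity
  have h1 : ∑ o : 𝓖.Occurrence x, 𝓖.rate o.1.1 * (regionPotential n g x (U x o) p).toReal =
      (∑ o : 𝓖.Occurrence x, ENNReal.ofReal (𝓖.rate o.1.1) *
        regionPotential n g x (U x o) p).toReal := by
    rw [ENNReal.toReal_sum fun o _ => ENNReal.mul_ne_top ENNReal.ofReal_ne_top
      (regionPotential_ne_top hg hx.2.2 _ p)]
    refine Finset.sum_congr rfl fun o _ => ?_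
    rw [ENNReal.toReal_mul, ENNReal.toReal_ofReal (𝓖.rate_pos _).le]
  rw [h1]
  refine ENNReal.toReal_le_of_le_ofReal (mul_nonneg hc hbound) ?_
  calc ∑ o : 𝓖.Occurrence x, ENNReal.ofReal (𝓖.rate o.1.1) * regionPotential n g x (U x o) p
      = x.green (greenParam n) (fun q => ∑ o : 𝓖.Occurrence x, ENNReal.ofReal (𝓖.rate o.1.1) *
          (U x o : Set (V × ℕ)).indicator (potential n g x) q) p := by
        rw [green_sum]
        exact Finset.sum_congr rfl fun o _ => by rw [green_const_mul, regionPotential]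
    _ ≤ x.green (greenParam n) (fun q => ENNReal.ofReal c * potential n g x q) p := by
        refine green_mono x _ (fun q => ?_) p
        have hr := h.rate hx q
        rw [tsum_fintype] at hr
        refine le_trans (le_of_eq ?_) (mul_le_mul_left (ENNReal.ofReal_le_ofReal hr) _)
        have e := ENNReal.ofReal_sum_of_nonneg (s := Finset.univ)
          (f := fun o : 𝓖.Occurrence x => 𝓖.rate o.1.1 *
            (U x o : Set (V × ℕ)).indicator (1 : V × ℕ → ℝ) q)
          fun o _ => mul_nonneg (𝓖.rate_pos _).le
            (Set.indicator_nonneg (fun _ _ => zero_le_one) _)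
        rw [e, Finset.sum_mul]
        refine Finset.sum_congr rfl fun o _ => ?_
        by_cases hq : q ∈ (U x o : Set (V × ℕ))
        · simp only [Set.indicator_of_mem hq, Pi.one_apply, mul_one]
        · simp only [Set.indicator_of_notMem hq, mul_zero, ENNReal.ofReal_zero, zero_mul]
    _ = ENNReal.ofReal c * x.green (greenParam n) (potential n g x) p := green_const_mul _ _ _ _ _
    _ ≤ ENNReal.ofReal c * ENNReal.ofReal (3 * (potential n g x p).toReal *
          Real.log (8 / (potential n g x p).toReal)) :=
        mul_le_mul_right (green_green_le hx.2.2 (greenParam_mul_le n)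
          (fun q : V × ℕ => hg q.1) (hg0 p.1)) _
    _ = _ := (ENNReal.ofReal_mul hc).symm

end Potential

/-- Bernoulli's inequality for the concave power; the factor `θ` retained here is matched by the
derivative of the exponent in `supersolution_potential`. -/
theorem rpow_add_le {ζ ζ' E θ : ℝ} (hζ : 0 < ζ) (hζ' : 0 ≤ ζ') (hE : 0 ≤ E) (h : ζ' ≤ ζ + E)
    (h0 : 0 ≤ θ) (h1 : θ ≤ 1) :
    (ζ' / 8) ^ θ ≤ (ζ / 8) ^ θ + (ζ / 8) ^ θ * (θ * (E / ζ)) := by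
  have hE' : 0 ≤ E / ζ := by positivity
  calc (ζ' / 8) ^ θ ≤ (ζ / 8 * (1 + E / ζ)) ^ θ := by
        refine Real.rpow_le_rpow (by positivity) ?_ h0
        have : ζ / 8 * (1 + E / ζ) = (ζ + E) / 8 := by field_simp
        rw [this]
        linarith
    _ = (ζ / 8) ^ θ * (1 + E / ζ) ^ θ := Real.mul_rpow (by positivity) (by positivity)
    _ ≤ (ζ / 8) ^ θ * (1 + θ * (E / ζ)) := by
        refine mul_le_mul_of_nonneg_left ?_ (by positivity)
        exact rpow_one_add_le_one_add_mul_self (by linarith) h0 h1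
    _ = _ := by ring

theorem rpow_mul_le {ζ ζ' K θ : ℝ} (hζ : 0 < ζ) (hζ' : 0 ≤ ζ') (hK : 1 ≤ K) (h : ζ' ≤ K * ζ)
    (h0 : 0 ≤ θ) (h1 : θ ≤ 1) : (ζ' / 8) ^ θ ≤ K * (ζ / 8) ^ θ := by
  calc (ζ' / 8) ^ θ ≤ (K * (ζ / 8)) ^ θ := by
        refine Real.rpow_le_rpow (by positivity) ?_ h0
        rw [← mul_div_assoc]
        linarith
    _ = K ^ θ * (ζ / 8) ^ θ := Real.mul_rpow (by positivity) (by positivity)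
    _ ≤ K * (ζ / 8) ^ θ := by
        refine mul_le_mul_of_nonneg_right ?_ (by positivity)
        calc K ^ θ ≤ K ^ (1 : ℝ) := Real.rpow_le_rpow_of_exponent_le hK h1
          _ = K := Real.rpow_one K

/-- The potential `ζ` of a mark outside the region increases at rate at most a multiple of `ζ * log
(8 / ζ)`. An exponent `θ` with `θ' = -β * θ` compensates this, because the time derivative of `(ζ /
8) ^ θ` is `β * θ * log (8 / ζ) * (ζ / 8) ^ θ`. In `β` the 9 is the product of the 3 from the local
move and the 3 from the entropy bound. The rate `b` covers hits on the mark itself. -/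
theorem Controlled.supersolution_potential (h : 𝓖.Controlled V n C c U U') (hc : 0 ≤ c)
    {g : V → ℝ≥0∞} (hg : ∀ v, g v ≤ 1) (hg0 : ∀ v, g v ≠ 0) {b β : ℝ}
    (hb : b = c * (C * (3 * (C * (4 * (n + 1)) ^ C : ℕ))))
    (hβ : β = 9 * c * (C * (4 * (n + 1)) ^ C : ℕ)) (T : ℝ) :
    IsSupersolution 𝓖 (MarkInv n B B') (updateMarks C U U') T
      fun t x δ => Real.exp (b * t) * ∑ p ∈ δ.1,
        ((potential n g x p).toReal / 8) ^ Real.exp (-β * t) := by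
  have hβ0 : 0 ≤ β := by rw [hβ]; positivity
  refine ⟨fun x δ _ t _ => by positivity, fun x δ hx => ?_⟩
  have hpos : ∀ p, 0 < (potential n g x p).toReal := toReal_potential_pos hg hg0 hx.inGF.2.2
  set ζ : V × ℕ → ℝ := fun p => (potential n g x p).toReal with hζ
  set Λ : V × ℕ → ℝ := fun p => Real.log (8 / ζ p) with hΛ
  set η : ℝ → V × ℕ → ℝ := fun t p => (ζ p / 8) ^ Real.exp (-β * t) with hη
  have hη0 : ∀ t p, 0 ≤ η t p := fun t p => by
    have := (hpos p).le
    simp only [hη]; positivity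
  have hηd : ∀ t p, HasDerivAt (fun t => η t p) (β * Real.exp (-β * t) * Λ p * η t p) t := by
    intro t p
    have e1 : HasDerivAt (fun t => Real.exp (-β * t)) (-β * Real.exp (-β * t)) t := by
      simpa using hasDerivAt_exp_mul (-β) 1 t
    have hz : 0 < ζ p / 8 := by have := hpos p; positivity
    refine (e1.const_rpow hz).congr_deriv ?_
    simp only [hη, hΛ]
    rw [← inv_div, Real.log_inv]
    ring
  have hsd : ∀ t, HasDerivAt (fun t => ∑ p ∈ δ.1, η t p)
      (∑ p ∈ δ.1, β * Real.exp (-β * t) * Λ p * η t p) t := fun t =>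
    HasDerivAt.fun_sum fun p _ => hηd t p
  have hηc : ∀ p, Continuous fun t => η t p := fun p =>
    continuous_iff_continuousAt.2 fun t => (hηd t p).continuousAt
  have hed : ∀ t, HasDerivAt (fun t => Real.exp (b * t)) (b * Real.exp (b * t)) t := by
    intro t
    simpa using hasDerivAt_exp_mul b 1 t
  refine ⟨_, ?_, fun t => (hed t).mul (hsd t), fun t ht => ?_⟩
  · exact ((by fun_prop : Continuous fun t => b * Real.exp (b * t)).mul
      (continuous_finsetSum _ fun p _ => hηc p)).add
      ((by fun_prop : Continuous fun t => Real.exp (b * t)).mul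
      (continuous_finsetSum _ fun p _ => ((by fun_prop : Continuous fun t =>
        β * Real.exp (-β * t) * Λ p)).mul (hηc p)))
  classical
  have := 𝓖.finite_occurrence hx.inGF.1
  have := Fintype.ofFinite (𝓖.Occurrence x)
  set θ := Real.exp (-β * t) with hθ
  have hθ0 : 0 ≤ θ := (Real.exp_pos _).le
  have hθ1 : θ ≤ 1 := by
    rw [hθ, Real.exp_le_one_iff]
    have := ht.1
    nlinarith
  set M : ℝ := ((C * (4 * (n + 1)) ^ C : ℕ) : ℝ) with hM
  have hM0 : 0 ≤ M := Nat.cast_nonneg _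
  set e : 𝓖.Occurrence x → V × ℕ → ℝ :=
    fun o p => (regionPotential n g x (U x o) p).toReal with he
  have hstep : ∀ o : 𝓖.Occurrence x,
      ∑ p ∈ (updateMarks C U U' x o δ).1, ((potential n g o.result p).toReal / 8) ^ θ -
        ∑ p ∈ δ.1, η t p ≤ ∑ p ∈ δ.1, (η t p * (C * (3 * M)) *
          (U x o : Set (V × ℕ)).indicator 1 p + η t p * θ * (3 * M) / ζ p * e o p) := by
    intro o
    have hm := h.move hx.inGF o
    have hM1 : 1 ≤ 3 * M := by
      have hC1 : 1 ≤ C := hm.nonempty.card_pos.trans_le hm.card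
      have : 1 ≤ C * (4 * (n + 1)) ^ C :=
        Nat.one_le_iff_ne_zero.2 (mul_ne_zero (by omega) (by positivity))
      have : (1 : ℝ) ≤ M := by rw [hM]; exact_mod_cast this
      linarith
    rw [sub_le_iff_le_add', ← Finset.sum_add_distrib]
    refine (sum_markUpdate_le _ _ _ fun p => by positivity).trans
      (Finset.sum_le_sum fun p hp => ?_)
    have he0 : 0 ≤ e o p := ENNReal.toReal_nonneg
    have hterm : 0 ≤ η t p * θ * (3 * M) / ζ p * e o p := by
      have := hη0 t p
      have := (hpos p).le
      positivity
    rw [indicator_one_eq]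
    by_cases hpU : p ∈ U x o
    · simp only [hpU, if_true, mul_one]
      have h1 : ∀ p' ∈ U' x o, ((potential n g o.result p').toReal / 8) ^ θ ≤ 3 * M * η t p :=
        fun p' hp' => rpow_mul_le (hpos p) ENNReal.toReal_nonneg hM1
          (h.toReal_potential_le_of_mem hx.inGF hg o hpU hp') hθ0 hθ1
      have h2 := Finset.sum_le_card_nsmul _ _ _ h1
      rw [nsmul_eq_mul] at h2
      have h3 : ((U' x o).card : ℝ) * (3 * M * η t p) ≤ C * (3 * M * η t p) := by
        refine mul_le_mul_of_nonneg_right (by exact_mod_cast hm.card') ?_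
        have := hη0 t p
        positivity
      have := hη0 t p
      nlinarith
    · simp only [hpU, if_false, mul_zero, zero_add]
      have hpU' := ((hm.mem_iff p).1 ⟨hx.sub p hp, hpU⟩).2
      have h1 := rpow_add_le (hpos p) ENNReal.toReal_nonneg (by positivity)
        (h.toReal_potential_le_of_notMem hx.inGF hg o hpU') hθ0 hθ1
      refine h1.trans (le_of_eq ?_)
      simp only [hη, hζ, ← hθ, ← hM, he]
      ring
  have hrate : ∀ p, ∑ o : 𝓖.Occurrence x, 𝓖.rate o.1.1 *
      (U x o : Set (V × ℕ)).indicator 1 p ≤ c := by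
    intro p
    have := h.rate hx.inGF p
    rwa [tsum_fintype] at this
  have hrate' : ∀ p, ∑ o : 𝓖.Occurrence x, 𝓖.rate o.1.1 * e o p ≤
      c * (3 * ζ p * Λ p) := by
    intro p
    have := h.rate_regionPotential_le hx.inGF hg hg0 hc p
    rwa [tsum_fintype] at this
  rw [tsum_fintype]
  calc _ = Real.exp (b * t) * ∑ o : 𝓖.Occurrence x, 𝓖.rate o.1.1 *
        (∑ p ∈ (updateMarks C U U' x o δ).1, ((potential n g o.result p).toReal / 8) ^ θ -
        ∑ p ∈ δ.1, η t p) := by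
        refine Eq.trans (Finset.sum_congr rfl fun o _ => ?_) (Finset.mul_sum _ _ _).symm
        rw [← mul_sub, mul_left_comm]
    _ ≤ Real.exp (b * t) * ∑ o : 𝓖.Occurrence x, 𝓖.rate o.1.1 * ∑ p ∈ δ.1,
          (η t p * (C * (3 * M)) * (U x o : Set (V × ℕ)).indicator 1 p +
            η t p * θ * (3 * M) / ζ p * e o p) :=
        mul_le_mul_of_nonneg_left (Finset.sum_le_sum fun o _ =>
          mul_le_mul_of_nonneg_left (hstep o) (𝓖.rate_pos _).le) (Real.exp_pos _).le
    _ = Real.exp (b * t) * ∑ p ∈ δ.1, (η t p * (C * (3 * M)) * ∑ o : 𝓖.Occurrence x,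
          𝓖.rate o.1.1 * (U x o : Set (V × ℕ)).indicator 1 p +
          η t p * θ * (3 * M) / ζ p * ∑ o : 𝓖.Occurrence x, 𝓖.rate o.1.1 * e o p) := by
        congr 1
        simp only [Finset.mul_sum]
        rw [Finset.sum_comm]
        refine Finset.sum_congr rfl fun p _ => ?_
        rw [← Finset.sum_add_distrib]
        exact Finset.sum_congr rfl fun o _ => by ring
    _ ≤ Real.exp (b * t) * ∑ p ∈ δ.1, (η t p * (C * (3 * M)) * c +
          η t p * θ * (3 * M) / ζ p * (c * (3 * ζ p * Λ p))) := by
        refine mul_le_mul_of_nonneg_left (Finset.sum_le_sum fun p _ => ?_) (Real.exp_pos _).le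
        have h1 := hη0 t p
        have h2 := (hpos p).le
        refine add_le_add (mul_le_mul_of_nonneg_left (hrate p) (by positivity))
          (mul_le_mul_of_nonneg_left (hrate' p) (by positivity))
    _ = _ := by
        change _ = b * Real.exp (b * t) * ∑ p ∈ δ.1, η t p +
          Real.exp (b * t) * ∑ p ∈ δ.1, β * θ * Λ p * η t p
        rw [mul_comm b (Real.exp _), mul_assoc, ← mul_add]
        congr 1
        rw [Finset.mul_sum, ← Finset.sum_add_distrib]
        refine Finset.sum_congr rfl fun p _ => ?_
        have h2 := (hpos p).ne'
        rw [hb, hβ]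
        have h3 : η t p * θ * (3 * M) / ζ p * (c * (3 * ζ p * Λ p)) =
            9 * c * M * θ * Λ p * η t p * (ζ p / ζ p) := by ring
        rw [h3, div_self h2]
        ring

end RandomGrammar

end GraphGrammar

/-! ### Estimates for the finite-volume chains, uniform in the volume. -/

namespace GraphGrammar

open SpinGraph

namespace SpinGraph

variable {V S : Type*}

theorem mem_verts_embed {x : SpinGraph V S} {p : V × ℕ} :
    p ∈ x.embed.verts ↔ p.2 = 0 ∧ p.1 ∈ x.verts := by
  by_cases h : p.2 = 0 <;> simp [verts, embed, h]

theorem mem_ball_embed {x : SpinGraph V S} {v u : V} {N : ℕ} (h : u ∈ x.ball v N) :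
    (u, 0) ∈ x.embed.ball (v, 0) N := by
  induction N generalizing u with
  | zero => rw [mem_ball_zero] at *; rw [h]
  | succ N ih =>
    rcases mem_ball_succ.1 h with rfl | ⟨w, hw, h⟩
    · exact mem_ball_self _ _ _
    · exact mem_ball_succ.2 (Or.inr ⟨(w, 0), ih hw, rfl, rfl, h⟩)

/-- The initial state of the finite-volume chains. -/
def initial (α : SpinGraph V S) (o : V) (N : ℕ) : SpinGraph (V × ℕ) S :=
  (α.restrict (α.ball o N)).embed

section Initial

variable {α : SpinGraph V S} {o : V} {N : ℕ}

theorem mem_verts_initial (ho : o ∈ α.verts) {p : V × ℕ} :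
    p ∈ (α.initial o N).verts ↔ p.2 = 0 ∧ p.1 ∈ α.ball o N := by
  rw [initial, mem_verts_embed, verts_restrict,
    Set.inter_eq_self_of_subset_right (ball_subset_verts ho N)]

theorem adj_of_adj_initial {p q : V × ℕ} (h : (α.initial o N).graph.Adj p q) :
    α.graph.Adj p.1 q.1 := h.2.2.2.2

theorem mem_ball_initial {v u : V} {R : ℕ} (hv : α.ball v R ⊆ α.ball o N) (hu : u ∈ α.ball v R) :
    (u, 0) ∈ (α.initial o N).ball (v, 0) R := by
  refine mem_ball_embed ?_
  rwa [ball_restrict hv le_rfl]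

theorem inGF_initial {n : ℕ} (hα : α.InGC n) (ho : o ∈ α.verts) (N : ℕ) :
    (α.initial o N).InGF n := by
  have hfin := ball_finite hα.2.2.2 o N
  refine ⟨?_, ⟨⟨(o, 0), (mem_verts_initial ho).2 ⟨rfl, mem_ball_self _ _ _⟩⟩, ?_⟩, ?_⟩
  · refine (hfin.image fun v => (v, 0)).subset fun p hp => ?_
    obtain ⟨h1, h2⟩ := (mem_verts_initial ho).1 hp
    exact ⟨p.1, h2, Prod.ext rfl h1.symm⟩
  · have key : ∀ p ∈ (α.initial o N).verts, (α.initial o N).graph.Reachable (o, 0) p := by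
      rintro ⟨u, j⟩ hp
      obtain ⟨h1, h2⟩ := (mem_verts_initial ho).1 hp
      simp only at h1 h2
      subst h1
      obtain ⟨w, -⟩ := exists_walk_of_mem_ball (mem_ball_initial (o := o) subset_rfl h2)
      exact ⟨w⟩
    exact fun p hp q hq => (key p hp).symm.trans (key q hq)
  · rintro ⟨v, j⟩ -
    have h1 : (α.initial o N).graph.neighborSet (v, j) ⊆
        (fun u => (u, 0)) '' α.graph.neighborSet v := by
      rintro ⟨u, i⟩ h
      exact ⟨u, adj_of_adj_initial h, Prod.ext rfl h.2.1.symm⟩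
    exact (Set.encard_le_encard h1).trans ((Set.encard_image_le _ _).trans
      (neighborSet_encard_le hα.2.2.2 v))

end Initial

end SpinGraph

namespace RandomGrammar

variable {S V : Type*} {𝓖 : RandomGrammar S} {n C : ℕ} {c : ℝ}
  {U U' : ∀ x : SpinGraph (V × ℕ) S, 𝓖.Occurrence x → Finset (V × ℕ)}

/-- The vertices of the initial state lying over a finite set. -/
def initialMarks (B : Finset V) : Finset (V × ℕ) := B.map ⟨fun v => (v, 0), fun _ _ h => by
  simpa using h⟩

theorem mem_initialMarks {B : Finset V} {p : V × ℕ} : p ∈ initialMarks B ↔ p.2 = 0 ∧ p.1 ∈ B := by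
  simp only [initialMarks, Finset.mem_map]
  constructor
  · rintro ⟨v, hv, rfl⟩; exact ⟨rfl, hv⟩
  · rintro ⟨h1, h2⟩; exact ⟨p.1, h2, Prod.ext rfl h1.symm⟩

theorem card_initialMarks (B : Finset V) : (initialMarks B).card = B.card := Finset.card_map _

section Estimates

variable {α : SpinGraph V S} {o : V} {N : ℕ}

theorem markInv_initial (hα : α.InGC n) (ho : o ∈ α.verts) {B B' : Finset V} (hB : B.Nonempty)
    (hB' : B'.Nonempty) (hBN : ∀ v ∈ B, v ∈ α.ball o N) (hBN' : ∀ v ∈ B', v ∈ α.ball o N) :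
    MarkInv n (B : Set V) (B' : Set V) (α.initial o N)
      (initialMarks B, initialMarks B', 0) := by
  refine ⟨inGF_initial hα ho N, fun p hp => ?_, ?_, fun p hp hpB => ?_, fun p hp => ?_, ?_,
    fun p hp hpB => ?_, fun p hp _ => ?_⟩
  · rw [mem_initialMarks] at hp
    exact (mem_verts_initial ho).2 ⟨hp.1, hBN _ hp.2⟩
  · exact hB.map
  · exact mem_initialMarks.2 ⟨((mem_verts_initial ho).1 hp).1, hpB⟩
  · rw [mem_initialMarks] at hp
    exact (mem_verts_initial ho).2 ⟨hp.1, hBN' _ hp.2⟩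
  · exact hB'.map
  · exact mem_initialMarks.2 ⟨((mem_verts_initial ho).1 hp).1, hpB⟩
  · exact ((mem_verts_initial ho).1 hp).1.le

/-- Comparison for the probability of an event, for the chain started at an initial state. -/
theorem Controlled.semigroup_initial_le (h : 𝓖.Controlled V n C c U U') (hα : α.InGC n)
    (ho : o ∈ α.verts) {B B' : Finset V} (hB : B.Nonempty)
    (hB' : B'.Nonempty) (hBN : ∀ v ∈ B, v ∈ α.ball o N) (hBN' : ∀ v ∈ B', v ∈ α.ball o N)
    {t : ℝ} (ht : 0 ≤ t) {F : ℝ → SpinGraph (V × ℕ) S → Marks V → ℝ}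
    (hF : IsSupersolution 𝓖 (MarkInv n (B : Set V) (B' : Set V)) (updateMarks C U U') t F)
    {E : Set (SpinGraph (V × ℕ) S)}
    (h0 : ∀ x ∈ E, ∀ δ, MarkInv n (B : Set V) (B' : Set V) x δ → 1 ≤ F 0 x δ) :
    𝓖.semigroup t (E.indicator 1) (α.initial o N) ≤
      ENNReal.ofReal (F t (α.initial o N) (initialMarks B, initialMarks B', 0)) := by
  refine hF.semigroup_le (fun _ _ hx => hx.inGF.1) (fun x δ => MarkInv.update h x δ)
    (fun x δ hx => ?_) (markInv_initial hα ho hB hB' hBN hBN') ⟨ht, le_rfl⟩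
  by_cases hxE : x ∈ E
  · rw [Set.indicator_of_mem hxE]
    exact ENNReal.one_le_ofReal.2 (h0 x hxE δ hx)
  · rw [Set.indicator_of_notMem hxE]
    exact zero_le

/-- Few new vertices are created over a finite set. -/
theorem Controlled.semigroup_card_le (h : 𝓖.Controlled V n C c U U') (hα : α.InGC n)
    (ho : o ∈ α.verts) {B : Finset V} (hB : B.Nonempty) (hBN : ∀ v ∈ B, v ∈ α.ball o N)
    {t : ℝ} (ht : 0 ≤ t) {m : ℕ} (hm : 0 < m) :
    𝓖.semigroup t (Set.indicator {x | ∃ s : Finset (V × ℕ),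
      (∀ p ∈ s, p ∈ x.verts ∧ p.1 ∈ B) ∧ m ≤ s.card} 1) (α.initial o N) ≤
      ENNReal.ofReal (Real.exp (c * C * t) * (B.card / m)) := by
  have hm' : (0 : ℝ) < m := by exact_mod_cast hm
  refine (h.semigroup_initial_le hα ho hB hB hBN hBN ht
    ((h.supersolution_card t).const_mul (fun _ _ hx => hx.inGF.1) (inv_nonneg.2 hm'.le))
    ?_).trans (le_of_eq ?_)
  · rintro x ⟨s, hs, hsm⟩ δ hx
    have h1 : s ⊆ δ.2.1 := fun p hp => hx.mem' p (hs p hp).1 (hs p hp).2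
    have h2 : (m : ℝ) ≤ δ.2.1.card := by exact_mod_cast hsm.trans (Finset.card_le_card h1)
    rw [mul_zero, Real.exp_zero, one_mul, ← div_eq_inv_mul, one_le_div hm']
    exact h2
  · rw [card_initialMarks]
    congr 1
    field_simp

/-- The second components of names over a finite set are bounded in probability. -/
theorem Controlled.semigroup_snd_le (h : 𝓖.Controlled V n C c U U') (hc : 0 ≤ c)
    (hα : α.InGC n) (ho : o ∈ α.verts) {B : Finset V} (hB : B.Nonempty)
    (hBN : ∀ v ∈ B, v ∈ α.ball o N) {t : ℝ} (ht : 0 ≤ t) {J : ℕ} (hJ : 0 < J) :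
    𝓖.semigroup t (Set.indicator {x | ∃ p ∈ x.verts, p.1 ∈ B ∧ J ≤ p.2} 1) (α.initial o N) ≤
      ENNReal.ofReal (Real.exp (2 * c * C * t) * B.card / J) := by
  have hJ' : (0 : ℝ) < J := by exact_mod_cast hJ
  refine (h.semigroup_initial_le hα ho hB hB hBN hBN ht
    ((h.supersolution_bound hc t).const_mul (fun _ _ hx => hx.inGF.1) (inv_nonneg.2 hJ'.le))
    ?_).trans (le_of_eq ?_)
  · rintro x ⟨p, hp, hpB, hpJ⟩ δ hx
    have h2 : (J : ℝ) ≤ δ.2.2 := by exact_mod_cast hpJ.trans (hx.le p hp hpB)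
    rw [mul_zero, Real.exp_zero, one_mul, ← div_eq_inv_mul, one_le_div hJ']
    have : (0 : ℝ) ≤ δ.2.1.card := Nat.cast_nonneg _
    linarith
  · rw [card_initialMarks]
    congr 1
    simp
    field_simp

/-- Neighbourhoods contain a positive proportion of the initial vertices. -/
theorem Controlled.exists_semigroup_ball_le (h : 𝓖.Controlled V n C c U U') (hc : 0 ≤ c)
    (hα : α.InGC n) (ho : o ∈ α.verts) {t : ℝ} (ht : 0 ≤ t) :
    ∃ K θ₀ θ₁ : ℝ, 0 ≤ K ∧ 1 < θ₀ ∧ 1 ≤ θ₁ ∧ ∀ (v : V) (B : Finset V) (r R m N : ℕ),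
      B.Nonempty → (∀ u ∈ B, u ∈ α.ball v r) → α.ball v r ⊆ α.ball o N →
      𝓖.semigroup t (Set.indicator {x | ∃ p ∈ x.verts, p.1 = v ∧ (x.ball p R).ncard < m} 1)
        (α.initial o N) ≤
      ENNReal.ofReal (K * (B.card * θ₁ ^ r / θ₀ ^ R + m / B.card)) := by
  set a : ℝ := 2 * c * (C * 2 ^ C) with ha
  set b : ℝ := c * (C * 2 ^ C) + (C * C + C) * 2 ^ C * (2 * c) with hb
  set b' : ℝ := c * (C * (C + 1)) with hb'
  -- The time of a supersolution is the remaining time: the base is `1 + ε` for distances in the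
  -- final state and exactly 2 for those in the initial state.
  set ε : ℝ := Real.exp (-(a * t)) with hε
  have hε0 : 0 < ε := Real.exp_pos _
  have hεt : ε * Real.exp (a * t) = 1 := by rw [hε, ← Real.exp_add]; simp
  refine ⟨max (Real.exp (b * t)) (Real.exp (b' * t)), 1 + ε, 2, ?_, by linarith, by norm_num, ?_⟩
  · exact le_max_of_le_left (Real.exp_pos _).le
  intro v B r R m N hB hBr hrN
  have hRpos : 0 < (1 + ε) ^ R := by positivity
  have hF := ((h.supersolution_distSum (B := (({v} : Finset V) : Set V)) (B' := (B : Set V)) hc ha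
    hb hε0.le hεt.le).const_mul
    (fun _ _ hx => hx.inGF.1) (inv_nonneg.2 hRpos.le)).add (fun _ _ hx => hx.inGF.1)
    ((h.supersolution_inv_card t).const_mul (fun _ _ hx => hx.inGF.1) (Nat.cast_nonneg m))
  have hvN : v ∈ α.ball o N := hrN (mem_ball_self _ _ _)
  refine (h.semigroup_initial_le hα ho (Finset.singleton_nonempty v) hB
    (fun u hu => by rw [Finset.mem_singleton.1 hu]; exact hvN) (fun u hu => hrN (hBr u hu)) ht hF
    ?_).trans (ENNReal.ofReal_le_ofReal ?_)
  · rintro x ⟨p, hp, hpv, hpm⟩ δ hx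
    have hpδ : p ∈ δ.1 := hx.mem p hp (by simp [hpv])
    simp only [mul_zero, Real.exp_zero, one_mul, mul_one]
    have h1 : 0 ≤ ((1 + ε) ^ R)⁻¹ * distSum (1 + ε) x δ.1 δ.2.1 :=
      mul_nonneg (inv_nonneg.2 hRpos.le) (Finset.sum_nonneg fun _ _ => Finset.sum_nonneg
        fun _ _ => by positivity)
    have h2 : 0 ≤ (m : ℝ) * (δ.2.1.card : ℝ)⁻¹ := by positivity
    -- If the ball of `p` has few vertices, either it contains all marks, and these are few, or some
    -- mark is farther than `R` from `p`. The two summands of the supersolution detect the two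
    -- cases.
    by_cases hsub : ∀ q ∈ δ.2.1, q ∈ x.ball p R
    · have h3 : δ.2.1.card ≤ (x.ball p R).ncard := by
        rw [← Set.ncard_coe_finset]
        exact Set.ncard_le_ncard hsub (ball_finite hx.inGF.2.2 p R)
      have h4 : 0 < δ.2.1.card := hx.nonempty'.card_pos
      have h5 : 1 ≤ (m : ℝ) * (δ.2.1.card : ℝ)⁻¹ := by
        rw [← div_eq_mul_inv, one_le_div (by exact_mod_cast h4)]
        exact_mod_cast (h3.trans hpm.le)
      linarith
    · push Not at hsub
      obtain ⟨q, hq, hqR⟩ := hsub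
      rw [hx.inGF.2.1.mem_ball_iff hp (hx.sub' q hq), not_le] at hqR
      have h3 : (1 + ε) ^ R ≤ distSum (1 + ε) x δ.1 δ.2.1 := by
        refine (pow_le_pow_right₀ (by linarith) hqR.le).trans ?_
        refine le_trans ?_ (Finset.single_le_sum (f := fun p => ∑ q ∈ δ.2.1,
          (1 + ε) ^ x.graph.dist p q) (fun _ _ => Finset.sum_nonneg fun _ _ => by positivity) hpδ)
        exact Finset.single_le_sum (f := fun q => (1 + ε) ^ x.graph.dist p q)
          (fun _ _ => by positivity) hq
      have h4 : 1 ≤ ((1 + ε) ^ R)⁻¹ * distSum (1 + ε) x δ.1 δ.2.1 := by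
        rw [← div_eq_inv_mul, one_le_div hRpos]
        exact h3
      linarith
  · rw [hεt, card_initialMarks]
    have h1 : distSum (1 + 1 : ℝ) (α.initial o N) (initialMarks {v}) (initialMarks B) ≤
        B.card * 2 ^ r := by
      have : initialMarks ({v} : Finset V) = {(v, 0)} := rfl
      rw [distSum, this, Finset.sum_singleton, ← card_initialMarks, ← nsmul_eq_mul]
      refine Finset.sum_le_card_nsmul _ _ _ fun q hq => ?_
      rw [show (1 + 1 : ℝ) = 2 by norm_num]
      refine pow_le_pow_right₀ (by norm_num) (dist_le_of_mem_ball ?_)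
      obtain ⟨hq1, hq2⟩ := mem_initialMarks.1 hq
      rw [show q = (q.1, 0) from Prod.ext rfl hq1]
      exact mem_ball_initial hrN (hBr _ hq2)
    have h2 : 0 < (B.card : ℝ) := by exact_mod_cast hB.card_pos
    have h3 : ((1 + ε) ^ R)⁻¹ * (Real.exp (b * t) * distSum (1 + 1) (α.initial o N)
        (initialMarks {v}) (initialMarks B)) ≤
        max (Real.exp (b * t)) (Real.exp (b' * t)) * (B.card * 2 ^ r / (1 + ε) ^ R) := by
      rw [div_eq_inv_mul, mul_left_comm]
      refine mul_le_mul (le_max_left _ _) (mul_le_mul_of_nonneg_left h1 (inv_nonneg.2 hRpos.le))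
        (mul_nonneg (inv_nonneg.2 hRpos.le) (Finset.sum_nonneg fun _ _ => Finset.sum_nonneg
        fun _ _ => by positivity)) (le_max_of_le_left (Real.exp_pos _).le)
    have h4 : (m : ℝ) * (Real.exp (b' * t) * (B.card : ℝ)⁻¹) ≤
        max (Real.exp (b * t)) (Real.exp (b' * t)) * (m / B.card) := by
      rw [mul_left_comm, div_eq_mul_inv]
      exact mul_le_mul_of_nonneg_right (le_max_right _ _) (by positivity)
    exact (add_le_add h3 h4).trans_eq (mul_add _ _ _).symm

/-- Neighbourhoods only contain vertices with ancestors that are not too far away. -/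
theorem Controlled.exists_semigroup_dist_le (h : 𝓖.Controlled V n C c U U') (hc : 0 ≤ c)
    (hα : α.InGC n) (ho : o ∈ α.verts) {t : ℝ} (ht : 0 ≤ t) :
    ∃ K ρ : ℝ, 0 ≤ K ∧ 0 < ρ ∧ ρ < 1 ∧ ∀ (v : V) (R M N : ℕ), v ∈ α.ball o N →
      𝓖.semigroup t (Set.indicator {x | (∃ p ∈ x.verts, p.1 = v ∧
        ∃ q ∈ x.ball p R, M ≤ α.graph.dist v q.1) ∨
        ∀ p ∈ x.verts, M ≤ α.graph.dist v p.1} 1) (α.initial o N) ≤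
      ENNReal.ofReal (K * (4 * (n + 1)) ^ R * ρ ^ M) := by
  set b : ℝ := c * (C * (3 * (C * (4 * (n + 1)) ^ C : ℕ))) with hb
  set β : ℝ := 9 * c * (C * (4 * (n + 1)) ^ C : ℕ) with hβ
  set θ : ℝ := Real.exp (-β * t) with hθ
  have hθ0 : 0 < θ := Real.exp_pos _
  -- The initial potential over `v` is at most `2 * 2⁻¹ ^ M`; its power with exponent `θ` gives the
  -- base `ρ = 2⁻¹ ^ θ < 1`.
  refine ⟨8 * Real.exp (b * t), (2⁻¹ : ℝ) ^ θ, by positivity, by positivity,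
    Real.rpow_lt_one (by norm_num) (by norm_num) hθ0, fun v R M N hv => ?_⟩
  -- The weight is 1 at distance `M` or more from `v` (truncated subtraction) and loses a factor 2
  -- per step towards `v`. As it at most doubles along a link, `2 * g` dominates its initial Green
  -- function.
  set g : V → ℝ≥0∞ := fun u => 2⁻¹ ^ (M - α.graph.dist v u) with hg
  have hg1 : ∀ u, g u ≤ 1 := fun u => pow_le_one₀ zero_le (by simp)
  have hg0 : ∀ u, g u ≠ 0 := fun u => pow_ne_zero _ (by simp)
  have hgM : ∀ u, M ≤ α.graph.dist v u → g u = 1 := fun u hu => by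
    simp only [hg, Nat.sub_eq_zero_of_le hu, pow_zero]
  have hgadj : ∀ u w, α.graph.Adj u w → g w ≤ 2 * g u := by
    intro u w huw
    have hd : α.graph.dist v w ≤ α.graph.dist v u + 1 := by
      by_cases hr : α.graph.Reachable v u
      · obtain ⟨p, hp⟩ := hr.exists_walk_length_eq_dist
        have := SimpleGraph.dist_le (p.concat huw)
        rwa [SimpleGraph.Walk.length_concat, hp] at this
      · have : ¬ α.graph.Reachable v w := fun h' => hr (h'.trans huw.symm.reachable)
        rw [SimpleGraph.dist_eq_zero_of_not_reachable this]
        exact Nat.zero_le _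
    calc g w ≤ 2 * (2⁻¹ * g w) := by
          rw [← mul_assoc, ENNReal.mul_inv_cancel (by norm_num) (by norm_num), one_mul]
      _ = 2 * 2⁻¹ ^ (M - α.graph.dist v w + 1) := by rw [pow_succ']
      _ ≤ 2 * g u := by
          refine mul_le_mul_right (pow_le_pow_right_of_le_one' (by simp) (by omega)) _
  set x₀ := α.initial o N with hx₀
  have hinit : x₀.green (greenParam n) (fun q => g q.1) (v, 0) ≤ 2 * g v := by
    refine SpinGraph.green_le (W := fun q => 2 * g q.1) (fun p => ?_) (v, 0)
    have h1 : x₀.adjSum (fun q => 2 * g q.1) p ≤ n * (2 * (2 * g p.1)) :=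
      adjSum_le (inGF_initial hα ho N).2.2 fun q hq =>
        mul_le_mul_right (hgadj _ _ (adj_of_adj_initial hq)) _
    calc g p.1 + greenParam n * x₀.adjSum (fun q => 2 * g q.1) p
        ≤ g p.1 + greenParam n * (n * (2 * (2 * g p.1))) := by gcongr
      _ = g p.1 + greenParam n * n * (4 * g p.1) := by ring
      _ ≤ g p.1 + 4⁻¹ * (4 * g p.1) := by gcongr; exact greenParam_mul_le n
      _ = 2 * g p.1 := by
          rw [← mul_assoc, ENNReal.inv_mul_cancel (by norm_num) (by norm_num), one_mul, two_mul]
  set w : ℝ := 4 * (n + 1) with hw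
  have hw1 : 1 ≤ w := by
    have : (0 : ℝ) ≤ n := Nat.cast_nonneg n
    linarith
  have hwR : 1 ≤ w ^ R := one_le_pow₀ hw1
  have hF := (h.supersolution_potential (B := (({v} : Finset V) : Set V))
    (B' := (({v} : Finset V) : Set V)) hc hg1 hg0 hb hβ t).const_mul
    (fun _ _ hx => hx.inGF.1) (a := 8 * w ^ R) (by positivity)
  refine (h.semigroup_initial_le hα ho (Finset.singleton_nonempty v)
    (Finset.singleton_nonempty v) (fun u hu => by rw [Finset.mem_singleton.1 hu]; exact hv)
    (fun u hu => by rw [Finset.mem_singleton.1 hu]; exact hv) ht hF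
    ?_).trans (ENNReal.ofReal_le_ofReal ?_)
  · rintro x hxE δ hx
    have hkey : ∃ p ∈ δ.1, 1 ≤ w ^ R * (potential n g x p).toReal := by
      have htop := fun p => potential_ne_top (n := n) hg1 hx.inGF.2.2 p
      rcases hxE with ⟨p, hp, hpv, q, hq, hqM⟩ | hall
      · refine ⟨p, hx.mem p hp (by simp [hpv]), ?_⟩
        have h1 : 1 ≤ ((4 * (n + 1) : ℕ) : ℝ≥0∞) ^ R * potential n g x p := by
          refine le_trans ?_ (green_le_pow_mul hq)
          rw [← hgM q.1 hqM]
          exact x.le_green (greenParam n) (fun q => g q.1) q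
        have h2 := ENNReal.toReal_mono (ENNReal.mul_ne_top (ENNReal.pow_ne_top
          (ENNReal.natCast_ne_top _)) (htop p)) h1
        rw [ENNReal.toReal_mul, ENNReal.toReal_pow, ENNReal.toReal_natCast] at h2
        simpa [hw] using h2
      -- Any mark is here itself over a distant vertex. This alternative later excludes that the
      -- limit graph is empty.
      · obtain ⟨p, hp⟩ := hx.nonempty
        refine ⟨p, hp, ?_⟩
        have h1 : 1 ≤ potential n g x p := by
          rw [← hgM p.1 (hall p (hx.sub p hp))]
          exact x.le_green (greenParam n) (fun q => g q.1) p
        have h2 := ENNReal.toReal_mono (htop p) h1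
        rw [ENNReal.toReal_one] at h2
        nlinarith
    obtain ⟨p, hp, hp1⟩ := hkey
    simp only [mul_zero, Real.exp_zero, one_mul, Real.rpow_one]
    have h2 := Finset.single_le_sum (f := fun p => (potential n g x p).toReal / 8)
      (fun _ _ => by positivity) hp
    have h3 : 8 * w ^ R * ((potential n g x p).toReal / 8) ≤
        8 * w ^ R * ∑ p ∈ δ.1, (potential n g x p).toReal / 8 :=
      mul_le_mul_of_nonneg_left h2 (by positivity)
    linarith
  · have : initialMarks ({v} : Finset V) = {(v, 0)} := rfl
    rw [this, Finset.sum_singleton]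
    have h1 : (potential n g x₀ (v, 0)).toReal / 8 ≤ (2⁻¹ : ℝ) ^ M := by
      have h2 : (potential n g x₀ (v, 0)).toReal ≤ 2 * 2⁻¹ ^ M := by
        have h3 := ENNReal.toReal_mono (ENNReal.mul_ne_top (by norm_num)
          (ne_top_of_le_ne_top (by norm_num) (hg1 v))) hinit
        have h4 : g v = 2⁻¹ ^ M := by simp [hg]
        rw [h4] at h3
        simpa [potential] using h3
      have : (0 : ℝ) < 2⁻¹ ^ M := by positivity
      linarith
    have h2 : ((potential n g x₀ (v, 0)).toReal / 8) ^ θ ≤ ((2⁻¹ : ℝ) ^ θ) ^ M := by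
      refine (Real.rpow_le_rpow (by positivity) h1 hθ0.le).trans (le_of_eq ?_)
      rw [← Real.rpow_natCast, ← Real.rpow_mul (by norm_num), mul_comm,
        Real.rpow_mul (by norm_num), Real.rpow_natCast]
    calc 8 * w ^ R * (Real.exp (b * t) * ((potential n g x₀ (v, 0)).toReal / 8) ^ θ)
        ≤ 8 * w ^ R * (Real.exp (b * t) * ((2⁻¹ : ℝ) ^ θ) ^ M) := by gcongr
      _ = _ := by ring

end Estimates

end RandomGrammar

end GraphGrammar

/-! ### Limits of probabilities of events in finitely many labels. -/

namespace GraphGrammar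

open SpinGraph

namespace SpinGraph

variable {L S : Type*}

theorem AgreeOn.symm {W : Set L} {x y : SpinGraph L S} (h : AgreeOn W x y) : AgreeOn W y x :=
  ⟨fun u hu => (h.1 u hu).symm, fun u hu v hv => (h.2 u hu v hv).symm⟩

theorem AgreeOn.trans {W : Set L} {x y z : SpinGraph L S} (h : AgreeOn W x y)
    (h' : AgreeOn W y z) : AgreeOn W x z :=
  ⟨fun u hu => (h.1 u hu).trans (h'.1 u hu), fun u hu v hv => (h.2 u hu v hv).trans (h'.2 u hu v hv)⟩

theorem agreeOn_iff_restrict_eq {W : Set L} {x y : SpinGraph L S} :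
    AgreeOn W x y ↔ x.restrict W = y.restrict W := by
  constructor
  · intro h
    unfold restrict
    congr 1
    · ext u v
      simp only
      exact ⟨fun ⟨hu, hv, k⟩ => ⟨hu, hv, (h.2 u hu v hv).1 k⟩,
        fun ⟨hu, hv, k⟩ => ⟨hu, hv, (h.2 u hu v hv).2 k⟩⟩
    · ext1 u
      by_cases hu : u ∈ W
      · rw [if_pos hu, if_pos hu, h.1 u hu]
      · rw [if_neg hu, if_neg hu]
  · intro h
    refine ⟨fun u hu => ?_, fun u hu v hv => ?_⟩
    · rw [← restrict_spin_of_mem hu, ← restrict_spin_of_mem (x := y) hu, h]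
    · have h1 : (x.restrict W).graph.Adj u v ↔ (y.restrict W).graph.Adj u v := by rw [h]
      simpa [restrict_adj, hu, hv] using h1

theorem agreeOn_restrict (W : Set L) (x : SpinGraph L S) : AgreeOn W x (x.restrict W) :=
  ⟨fun _ hu => (restrict_spin_of_mem hu).symm, fun u hu v hv => by simp [restrict_adj, hu, hv]⟩

/-- There are finitely many configurations inside a finite set of labels, if there are finitely
many possible spins for every label. -/
theorem finite_restrict_image (W : Finset L) {T : L → Set (Option S)} (hT : ∀ p, (T p).Finite) :
    ((fun x : SpinGraph L S => x.restrict W) '' {x | ∀ p ∈ W, x.spin p ∈ T p}).Finite := by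
  set f : SpinGraph L S → (W → Option S) × (W → W → Prop) :=
    fun y => (fun p => y.spin p, fun p q => y.graph.Adj p q) with hf
  have hfin : ((Set.univ.pi fun p : W => T p) ×ˢ (Set.univ : Set (W → W → Prop))).Finite :=
    (Set.Finite.pi fun p : W => hT p).prod Set.finite_univ
  refine Set.Finite.of_finite_image (f := f) (hfin.subset ?_) ?_
  · rintro _ ⟨_, ⟨x, hx, rfl⟩, rfl⟩
    refine ⟨fun p _ => ?_, trivial⟩
    simp only [hf]
    rw [restrict_spin_of_mem p.2]
    exact hx p p.2
  · rintro _ ⟨x, -, rfl⟩ _ ⟨y, -, rfl⟩ h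
    simp only [hf, Prod.mk.injEq] at h
    have h3 : AgreeOn (W : Set L) (x.restrict W) (y.restrict W) :=
      ⟨fun u hu => congrFun h.1 ⟨u, hu⟩,
        fun u hu v hv => iff_of_eq (congrFun (congrFun h.2 ⟨u, hu⟩) ⟨v, hv⟩)⟩
    exact agreeOn_iff_restrict_eq.1
      ((agreeOn_restrict _ x).trans (h3.trans (agreeOn_restrict _ y).symm))

end SpinGraph

namespace RandomGrammar

variable {S V : Type*} {𝓖 : RandomGrammar S} {n C : ℕ} {c : ℝ}
  {U U' : ∀ x : SpinGraph (V × ℕ) S, 𝓖.Occurrence x → Finset (V × ℕ)}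
  {α : SpinGraph V S} {o : V}

variable (𝓖 α) in
/-- The spins that a vertex may acquire. -/
def possibleSpins (p : V × ℕ) : Set (Option S) :=
  {none, α.spin p.1} ∪ ⋃ i, Set.range fun w => some ((𝓖.rule i).s' w)

theorem finite_possibleSpins (p : V × ℕ) : (possibleSpins 𝓖 α p).Finite :=
  (Set.toFinite _).union (Set.finite_iUnion fun _ => Set.finite_range _)

/-- The reachable states have possible spins only, and names over the vertices of `α` only. -/
theorem Controlled.semigroup_impossible (h : 𝓖.Controlled V n C c U U') (hα : α.InGC n)
    (ho : o ∈ α.verts) {t : ℝ} (ht : 0 ≤ t) (N : ℕ) :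
    𝓖.semigroup t (Set.indicator {x | ¬ ((∀ p, x.spin p ∈ possibleSpins 𝓖 α p) ∧
      ∀ p ∈ x.verts, p.1 ∈ α.verts)} 1) (α.initial o N) = 0 := by
  set Inv : SpinGraph (V × ℕ) S → Unit → Prop := fun x _ => x.InGF n ∧
    (∀ p, x.spin p ∈ possibleSpins 𝓖 α p) ∧ ∀ p ∈ x.verts, p.1 ∈ α.verts with hInv
  have hF : IsSupersolution 𝓖 Inv (fun _ _ δ => δ) t fun _ _ _ => 0 :=
    ⟨fun _ _ _ _ _ => le_rfl, fun _ _ _ => ⟨fun _ => 0, continuous_const,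
      fun _ => hasDerivAt_const _ _, fun _ _ => by simp⟩⟩
  refine le_antisymm ((hF.semigroup_le (fun _ _ hx => hx.1.1) ?_ ?_ (δ := ()) ?_
    ⟨ht, le_rfl⟩).trans (by simp)) zero_le
  · rintro x δ ⟨h1, h2, h3⟩ o
    refine ⟨h.result h1 o, fun p => ?_, fun p hp => ?_⟩
    · rcases occurrence_result_spin o p with h4 | h4 | ⟨i, w, h4⟩
      · rw [h4]; exact Or.inl (Or.inl rfl)
      · rw [h4]; exact h2 p
      · rw [h4]; exact Or.inr (Set.mem_iUnion.2 ⟨i, w, rfl⟩)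
    · by_cases hpx : p ∈ x.verts
      · exact h3 p hpx
      · have hm := h.move h1 o
        have hpU' : p ∈ U' x o := by
          by_contra hp'
          exact hpx ((hm.mem_iff p).2 ⟨hp, hp'⟩).1
        obtain ⟨a, ha, hap, -⟩ := h.label h1 o p hpU' hpx
        rw [← hap]
        exact h3 a (hm.sub a ha)
  · intro x δ hx
    have hn : x ∉ {x : SpinGraph (V × ℕ) S | ¬ ((∀ p, x.spin p ∈ possibleSpins 𝓖 α p) ∧
        ∀ p ∈ x.verts, p.1 ∈ α.verts)} := fun hn => hn hx.2
    rw [Set.indicator_of_notMem hn]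
    exact zero_le
  · refine ⟨inGF_initial hα ho N, fun p => Or.inl ?_, fun p hp => ?_⟩
    · change (α.restrict (α.ball o N)).embed.spin p ∈ _
      simp only [embed, restrict]
      split_ifs
      exacts [Or.inr rfl, Or.inl rfl, Or.inl rfl]
    · exact ball_subset_verts ho N ((mem_verts_initial ho).1 hp).2

end RandomGrammar

namespace IsDynamics

variable {S V Ω : Type*} [MeasurableSpace Ω] {𝓖 : RandomGrammar S} {n C : ℕ} {c : ℝ}
  {U U' : ∀ x : SpinGraph (V × ℕ) S, 𝓖.Occurrence x → Finset (V × ℕ)}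
  {α : SpinGraph V S} {o : V} {P : Measure Ω} {X : ℝ≥0 → Ω → SpinGraph (V × ℕ) S}

theorem tendsto_semigroup_of_isCylinder (hX : IsDynamics 𝓖 α o P X) (t : ℝ≥0)
    {A : Set (SpinGraph (V × ℕ) S)} (hA : IsCylinder A) :
    Tendsto (fun N => 𝓖.semigroup t (A.indicator 1) (α.initial o N)) atTop
      (𝓝 (P (X t ⁻¹' A))) := by
  have h := hX.limit [(t, A)] (by simpa using hA)
  simp only [pathEvent, Set.inter_univ, zero_add] at h
  exact h

/-- Convergence of the probabilities of events that are determined by the configuration in a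
finite set of labels. -/
theorem tendsto_semigroup (hX : IsDynamics 𝓖 α o P X) (h : 𝓖.Controlled V n C c U U')
    (hα : α.InGC n) (ho : o ∈ α.verts) (t : ℝ≥0) (W : Finset (V × ℕ))
    {E : Set (SpinGraph (V × ℕ) S)} (hE : ∀ x y, AgreeOn (W : Set (V × ℕ)) x y → x ∈ E → y ∈ E)
    (hE' : ∀ x ∈ E, ∀ p ∈ W, x.spin p ∈ RandomGrammar.possibleSpins 𝓖 α p) :
    MeasurableSet (X t ⁻¹' E) ∧
    Tendsto (fun N => 𝓖.semigroup t (E.indicator 1) (α.initial o N)) atTop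
      (𝓝 (P (X t ⁻¹' E))) := by
  classical
  -- The spin set may be infinite; only finitely many spins are possible at each label, so `E` is a
  -- finite disjoint union of local events.
  have hfin := ((finite_restrict_image W fun p =>
    RandomGrammar.finite_possibleSpins (𝓖 := 𝓖) (α := α) p).subset (Set.image_mono
      (show E ⊆ _ from fun x hx => hE' x hx)))
  set Y := hfin.toFinset with hY
  set cyl : SpinGraph (V × ℕ) S → Set (SpinGraph (V × ℕ) S) :=
    fun y => {x | AgreeOn (W : Set (V × ℕ)) x y} with hcyl
  have hEY : E = ⋃ y ∈ Y, cyl y := by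
    ext x
    simp only [Set.mem_iUnion, hY, Set.Finite.mem_toFinset, exists_prop]
    constructor
    · exact fun hx => ⟨_, ⟨x, hx, rfl⟩, agreeOn_restrict _ x⟩
    · rintro ⟨_, ⟨x', hx', rfl⟩, hxx'⟩
      exact hE x' x (hxx'.trans (agreeOn_restrict _ x').symm).symm hx'
  have hcylY : ∀ y, IsCylinder (cyl y) := fun y => ⟨W, y, rfl⟩
  have hdisj : ∀ y ∈ Y, ∀ y' ∈ Y, y ≠ y' → Disjoint (cyl y) (cyl y') := by
    intro y hy y' hy' hne
    rw [hY, Set.Finite.mem_toFinset] at hy hy'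
    obtain ⟨z, -, rfl⟩ := hy
    obtain ⟨z', -, rfl⟩ := hy'
    refine Set.disjoint_left.2 fun x hx hx' => hne ?_
    exact agreeOn_iff_restrict_eq.1 ((agreeOn_restrict _ z).trans
      (hx.symm.trans (hx'.trans (agreeOn_restrict _ z').symm)))
  have hmeas : ∀ y, MeasurableSet (X t ⁻¹' cyl y) := fun y => hX.measurable t _ (hcylY y)
  have hpre : X t ⁻¹' E = ⋃ y ∈ Y, X t ⁻¹' cyl y := by rw [hEY]; simp
  refine ⟨hpre ▸ Finset.measurableSet_biUnion _ fun y _ => hmeas y, ?_⟩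
  have h1 : P (X t ⁻¹' E) = ∑ y ∈ Y, P (X t ⁻¹' cyl y) := by
    rw [hpre, measure_biUnion_finset (fun y hy y' hy' hne =>
      (hdisj y hy y' hy' hne).preimage _) fun y _ => hmeas y]
  have h2 : ∀ N, 𝓖.semigroup t (E.indicator 1) (α.initial o N) =
      ∑ y ∈ Y, 𝓖.semigroup t ((cyl y).indicator 1) (α.initial o N) := by
    intro N
    rw [← h.semigroup_sum Y _ t (inGF_initial hα ho N)]
    congr 1
    ext x
    rw [hEY, Finset.indicator_biUnion Y cyl fun y hy y' hy' hne => hdisj y hy y' hy' hne]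
    simp
  rw [h1]
  simp only [h2]
  exact tendsto_finsetSum _ fun y _ => hX.tendsto_semigroup_of_isCylinder t (hcylY y)

variable [IsProbabilityMeasure P]

/-- Estimates for the probabilities of events that are determined by the configuration in a
finite set of labels. -/
theorem measure_le (hX : IsDynamics 𝓖 α o P X) (h : 𝓖.Controlled V n C c U U')
    (hα : α.InGC n) (ho : o ∈ α.verts) (t : ℝ≥0) (W : Finset (V × ℕ))
    {E : Set (SpinGraph (V × ℕ) S)} (hE : ∀ x y, AgreeOn (W : Set (V × ℕ)) x y → x ∈ E → y ∈ E)
    {ε : ℝ≥0∞} (hε : ∀ᶠ N in atTop, 𝓖.semigroup t (E.indicator 1) (α.initial o N) ≤ ε) :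
    P (X t ⁻¹' E) ≤ ε := by
  set K : Set (SpinGraph (V × ℕ) S) :=
    {x | ∀ p ∈ W, x.spin p ∈ RandomGrammar.possibleSpins 𝓖 α p} with hK
  have hKW : ∀ x y, AgreeOn (W : Set (V × ℕ)) x y → x ∈ K → y ∈ K :=
    fun x y hxy hx p hp => hxy.1 p hp ▸ hx p hp
  -- The full space is a local event over no labels, so the total masses of the chains tend to 1.
  -- The finite-volume mass of `Kᶜ` vanishes, hence `P (X t ⁻¹' K)` has the same limit 1.
  have hP : P (X t ⁻¹' Kᶜ) = 0 := by
    obtain ⟨h1, h2⟩ := hX.tendsto_semigroup h hα ho t W hKW fun x hx => hx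
    have h3 := hX.tendsto_semigroup_of_isCylinder t (A := Set.univ)
      ⟨∅, α.initial o 0, by ext x; simp [AgreeOn]⟩
    have h4 : P (X t ⁻¹' K) = 1 := by
      refine tendsto_nhds_unique h2 ?_
      rw [Set.preimage_univ, measure_univ] at h3
      refine h3.congr fun N => ?_
      have h5 : (Set.univ : Set (SpinGraph (V × ℕ) S)).indicator
          (1 : SpinGraph (V × ℕ) S → ℝ≥0∞) = K.indicator 1 + Kᶜ.indicator 1 := by
        rw [Set.indicator_self_add_compl, Set.indicator_univ]
      rw [h5, h.semigroup_add _ _ t (inGF_initial hα ho N)]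
      suffices h6 : 𝓖.semigroup t (Kᶜ.indicator 1) (α.initial o N) ≤ 0 by
        rw [le_antisymm h6 zero_le, add_zero]
      rw [← h.semigroup_impossible hα ho t.2 N]
      refine RandomGrammar.semigroup_mono (Set.indicator_le_indicator_of_subset (by
        intro x hx hx'
        exact hx fun p _ => hx'.1 p) fun _ => zero_le) _ _
    rw [Set.preimage_compl, prob_compl_eq_zero_iff h1, h4]
  obtain ⟨h1, h2⟩ := hX.tendsto_semigroup h hα ho t W (E := E ∩ K)
    (fun x y hxy hx => ⟨hE x y hxy hx.1, hKW x y hxy hx.2⟩) fun x hx => hx.2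
  have h3 : P (X t ⁻¹' (E ∩ K)) ≤ ε := by
    refine le_of_tendsto h2 (hε.mono fun N hN => le_trans ?_ hN)
    exact RandomGrammar.semigroup_mono (Set.indicator_le_indicator_of_subset
      Set.inter_subset_left fun _ => zero_le) _ _
  calc P (X t ⁻¹' E) ≤ P (X t ⁻¹' (E ∩ K) ∪ X t ⁻¹' Kᶜ) := by
        refine measure_mono fun ω hω => ?_
        by_cases hk : X t ω ∈ K
        · exact Or.inl ⟨hω, hk⟩
        · exact Or.inr hk
    _ ≤ P (X t ⁻¹' (E ∩ K)) + P (X t ⁻¹' Kᶜ) := measure_union_le _ _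
    _ ≤ ε := by rw [hP, add_zero]; exact h3

/-- Estimates for the probabilities of increasing events. -/
theorem measure_le_of_monotone [Countable V] (hX : IsDynamics 𝓖 α o P X)
    (h : 𝓖.Controlled V n C c U U') (hα : α.InGC n) (ho : o ∈ α.verts) (t : ℝ≥0)
    {E : Set (SpinGraph (V × ℕ) S)}
    (hE : ∀ x y, x.verts ⊆ y.verts → x.graph ≤ y.graph → x ∈ E → y ∈ E)
    {ε : ℝ≥0∞} (hε : ∀ᶠ N in atTop, 𝓖.semigroup t (E.indicator 1) (α.initial o N) ≤ ε) :
    P {ω | ∃ W : Finset (V × ℕ), (X t ω).restrict W ∈ E} ≤ ε := by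
  have h1 : {ω | ∃ W : Finset (V × ℕ), (X t ω).restrict W ∈ E} =
      ⋃ W : Finset (V × ℕ), X t ⁻¹' {x | x.restrict W ∈ E} := by ext ω; simp
  have hmono : Monotone fun W : Finset (V × ℕ) => X t ⁻¹' {x | x.restrict W ∈ E} := by
    intro W W' hWW' ω hω
    refine hE _ _ ?_ (fun u v huv => ?_) hω
    swap
    · rw [restrict_adj] at *
      exact ⟨hWW' huv.1, hWW' huv.2.1, huv.2.2⟩
    rw [verts_restrict, verts_restrict]
    exact Set.inter_subset_inter_right _ (by exact_mod_cast hWW')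
  -- Continuity from below along the countably many finite sets of labels.
  rw [h1, hmono.directed_le.measure_iUnion]
  refine iSup_le fun W => hX.measure_le h hα ho t W (fun x y hxy hx => ?_)
    (hε.mono fun N hN => le_trans ?_ hN)
  · change y.restrict W ∈ E
    rw [← agreeOn_iff_restrict_eq.1 hxy]
    exact hx
  · refine RandomGrammar.semigroup_mono (Set.indicator_le_indicator_of_subset (fun x hx =>
      hE _ _ ?_ (restrict_graph_le x _) hx) fun _ => zero_le) _ _
    rw [verts_restrict]
    exact Set.inter_subset_left

end IsDynamics

end GraphGrammar

/-! ### Estimates for the infinite-volume dynamics at a fixed time. -/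

namespace GraphGrammar

open SpinGraph

namespace SpinGraph

variable {L S : Type*}

theorem exists_finset_mem_ball_restrict {x : SpinGraph L S} {p q : L} {R : ℕ}
    (h : q ∈ x.ball p R) : ∃ W : Finset L, p ∈ W ∧ q ∈ (x.restrict W).ball p R := by
  classical
  induction R generalizing q with
  | zero => exact ⟨{p}, Finset.mem_singleton_self p, by rw [mem_ball_zero] at *; exact h⟩
  | succ R ih =>
    rcases mem_ball_succ.1 h with rfl | ⟨w, hw, hwq⟩
    · exact ⟨{q}, Finset.mem_singleton_self q, mem_ball_self _ _ _⟩
    · obtain ⟨W, hpW, hwW⟩ := ih hw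
      refine ⟨insert q (insert w W), by simp [hpW], mem_ball_succ.2 (Or.inr ⟨w, ?_, ?_⟩)⟩
      · refine ball_mono_graph (fun a b hab => ?_) p R hwW
        rw [restrict_adj] at *
        exact ⟨by simp [Finset.mem_coe.1 hab.1], by simp [Finset.mem_coe.1 hab.2.1], hab.2.2⟩
      · exact restrict_adj.2 ⟨by simp, by simp, hwq⟩

theorem InGC.mono {x : SpinGraph L S} {n m : ℕ} (hx : x.InGC n) (h : n ≤ m) : x.InGC m :=
  ⟨hx.1, hx.2.1, hx.2.2.1, hx.2.2.2.mono h⟩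

theorem eventually_ball_subset {x : SpinGraph L S} (hx : x.IsConnected) {o v : L}
    (ho : o ∈ x.verts) (hv : v ∈ x.verts) (r : ℕ) :
    ∀ᶠ N in atTop, x.ball v r ⊆ x.ball o N := by
  obtain ⟨N₀, hN₀⟩ := exists_mem_ball hx ho hv
  filter_upwards [eventually_ge_atTop (N₀ + r)] with N hN u hu
  exact ball_mono x o hN (mem_ball_trans hN₀ hu)

end SpinGraph

namespace IsDynamics

variable {S V Ω : Type*} [MeasurableSpace Ω] {𝓖 : RandomGrammar S} {n C : ℕ} {c : ℝ}
  {U U' : ∀ x : SpinGraph (V × ℕ) S, 𝓖.Occurrence x → Finset (V × ℕ)}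
  {α : SpinGraph V S} {o : V} {P : Measure Ω} {X : ℝ≥0 → Ω → SpinGraph (V × ℕ) S}
  [IsProbabilityMeasure P]

section Increasing

variable [Countable V] (hX : IsDynamics 𝓖 α o P X) (h : 𝓖.Controlled V n C c U U')
  (hα : α.InGC n) (ho : o ∈ α.verts) (t : ℝ≥0)
include hX h hα ho

theorem ae_fst_mem : ∀ᵐ ω ∂P, ∀ p ∈ (X t ω).verts, p.1 ∈ α.verts := by
  have key := hX.measure_le_of_monotone h hα ho t (E := {x | ∃ p ∈ x.verts, p.1 ∉ α.verts})
    (fun x y h1 _ ⟨p, hp, hp'⟩ => ⟨p, h1 hp, hp'⟩) (ε := 0) (Eventually.of_forall fun N => ?_)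
  · rw [ae_iff]
    refine le_antisymm ((measure_mono fun ω hω => ?_).trans key) zero_le
    simp only [Set.mem_ofPred_eq, not_forall] at hω
    obtain ⟨p, hp, hp'⟩ := hω
    refine ⟨{p}, p, ?_, hp'⟩
    rw [verts_restrict]
    exact ⟨hp, by simp⟩
  · rw [← h.semigroup_impossible hα ho t.2 N]
    refine RandomGrammar.semigroup_mono (Set.indicator_le_indicator_of_subset ?_
      fun _ => zero_le) _ _
    rintro x ⟨p, hp, hp'⟩ hx
    exact hp' (hx.2 p hp)

theorem measure_dist_le (hc : 0 ≤ c) : ∃ K ρ : ℝ, 0 ≤ K ∧ 0 < ρ ∧ ρ < 1 ∧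
    ∀ v ∈ α.verts, ∀ R M : ℕ,
      P {ω | ∃ p ∈ (X t ω).verts, p.1 = v ∧ ∃ q ∈ (X t ω).ball p R, M ≤ α.graph.dist v q.1} ≤
        ENNReal.ofReal (K * (4 * (n + 1)) ^ R * ρ ^ M) := by
  obtain ⟨K, ρ, hK, hρ, hρ1, hle⟩ := h.exists_semigroup_dist_le hc hα ho t.2
  refine ⟨K, ρ, hK, hρ, hρ1, fun v hv R M => ?_⟩
  have key := hX.measure_le_of_monotone h hα ho t (E := {x | ∃ p ∈ x.verts, p.1 = v ∧
    ∃ q ∈ x.ball p R, M ≤ α.graph.dist v q.1})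
    (fun x y h1 h2 ⟨p, hp, hpv, q, hq, hqM⟩ => ⟨p, h1 hp, hpv, q, ball_mono_graph h2 p R hq, hqM⟩)
    (ε := ENNReal.ofReal (K * (4 * (n + 1)) ^ R * ρ ^ M)) ?_
  · refine (measure_mono fun ω hω => ?_).trans key
    obtain ⟨p, hp, hpv, q, hq, hqM⟩ := hω
    obtain ⟨W, hpW, hqW⟩ := exists_finset_mem_ball_restrict hq
    refine ⟨W, p, ?_, hpv, q, hqW, hqM⟩
    rw [verts_restrict]
    exact ⟨hp, hpW⟩
  · filter_upwards [eventually_ball_subset hα.2.2.1 ho hv 0] with N hN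
    exact le_trans (RandomGrammar.semigroup_mono (Set.indicator_le_indicator_of_subset
      (fun x hx => Or.inl hx) fun _ => zero_le) _ _) (hle v R M N (hN (mem_ball_self _ _ _)))

theorem measure_card_le {v : V} (hv : v ∈ α.verts) (M : ℕ) {m : ℕ} (hm : 0 < m) :
    P {ω | ∃ s : Finset (V × ℕ), (∀ p ∈ s, p ∈ (X t ω).verts ∧ p.1 ∈ α.ball v M) ∧ m ≤ s.card} ≤
      ENNReal.ofReal (Real.exp (c * C * t) * ((α.ball v M).ncard / m)) := by
  have hfin := ball_finite hα.2.2.2 v M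
  have hB : ∀ u, u ∈ hfin.toFinset ↔ u ∈ α.ball v M := fun u => by simp
  have key := hX.measure_le_of_monotone h hα ho t (E := {x | ∃ s : Finset (V × ℕ),
    (∀ p ∈ s, p ∈ x.verts ∧ p.1 ∈ hfin.toFinset) ∧ m ≤ s.card})
    (fun x y h1 h2 ⟨s, hs, hsm⟩ => ⟨s, fun p hp => ⟨h1 (hs p hp).1, (hs p hp).2⟩, hsm⟩)
    (ε := ENNReal.ofReal (Real.exp (c * C * t) * ((α.ball v M).ncard / m))) ?_
  · refine (measure_mono fun ω hω => ?_).trans key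
    obtain ⟨s, hs, hsm⟩ := hω
    refine ⟨s, s, fun p hp => ⟨?_, (hB _).2 (hs p hp).2⟩, hsm⟩
    rw [verts_restrict]
    exact ⟨(hs p hp).1, hp⟩
  · filter_upwards [eventually_ball_subset hα.2.2.1 ho hv M] with N hN
    rw [Set.ncard_eq_toFinset_card _ hfin]
    exact h.semigroup_card_le hα ho ⟨v, (hB v).2 (mem_ball_self _ _ _)⟩
      (fun u hu => hN ((hB u).1 hu)) t.2 hm

end Increasing

section Tight

variable (h : 𝓖.Controlled V n C c U U') (hc : 0 ≤ c) (hα : α.InGC n) (ho : o ∈ α.verts) (t : ℝ≥0)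
include h hc hα ho

/-- The neighbourhoods of the vertices over `v` are contained, uniformly in the volume and with
a large probability, in a finite set of labels. -/
theorem exists_finset_semigroup_le {v : V} (hv : v ∈ α.verts) (R : ℕ) {ε : ℝ≥0∞} (hε : 0 < ε) :
    ∃ W : Finset (V × ℕ), ∀ᶠ N in atTop,
      𝓖.semigroup t (Set.indicator {x | (∃ p ∈ x.verts, p.1 = v ∧ ∃ q ∈ x.ball p R, q ∉ W) ∨
        ∀ p ∈ x.verts, p ∉ W} 1) (α.initial o N) ≤ ε := by
  classical
  obtain ⟨K, ρ, hK, hρ, hρ1, hle⟩ := h.exists_semigroup_dist_le hc hα ho t.2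
  have hε2 : 0 < ε / 2 := ENNReal.half_pos hε.ne'
  obtain ⟨M, hM⟩ : ∃ M : ℕ, ENNReal.ofReal (K * (4 * (n + 1)) ^ R * ρ ^ M) ≤ ε / 2 := by
    have h1 : Tendsto (fun M : ℕ => ENNReal.ofReal (K * (4 * (n + 1)) ^ R * ρ ^ M)) atTop (𝓝 0) := by
      have := ENNReal.tendsto_ofReal ((tendsto_pow_atTop_nhds_zero_of_lt_one hρ.le hρ1).const_mul
        (K * (4 * (n + 1)) ^ R))
      simpa using this
    exact (((tendsto_order.1 h1).2 _ hε2).exists).imp fun _ h => h.le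
  have hfin := ball_finite hα.2.2.2 v M
  have hB : ∀ u, u ∈ hfin.toFinset ↔ u ∈ α.ball v M := fun u => by simp
  obtain ⟨J, hJ0, hJ⟩ : ∃ J : ℕ, 0 < J ∧
      ENNReal.ofReal (Real.exp (2 * c * C * t) * hfin.toFinset.card / J) ≤ ε / 2 := by
    have h1 : Tendsto (fun J : ℕ => ENNReal.ofReal
        (Real.exp (2 * c * C * t) * hfin.toFinset.card / J)) atTop (𝓝 0) := by
      have := ENNReal.tendsto_ofReal (tendsto_const_div_atTop_nhds_zero_nat
        (Real.exp (2 * c * C * t) * hfin.toFinset.card))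
      simpa using this
    obtain ⟨J, h2, h3⟩ := (((tendsto_order.1 h1).2 _ hε2).and (eventually_gt_atTop 0)).exists
    exact ⟨J, h3, h2.le⟩
  -- Ancestors are confined to the ball of radius `M` by the distance estimate, and second
  -- components over it are below `J`, each up to probability `ε / 2`.
  refine ⟨hfin.toFinset ×ˢ Finset.range J, ?_⟩
  filter_upwards [eventually_ball_subset hα.2.2.1 ho hv M] with N hN
  set E₁ : Set (SpinGraph (V × ℕ) S) := {x | (∃ p ∈ x.verts, p.1 = v ∧
    ∃ q ∈ x.ball p R, M ≤ α.graph.dist v q.1) ∨ ∀ p ∈ x.verts, M ≤ α.graph.dist v p.1} with hE₁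
  set E₂ : Set (SpinGraph (V × ℕ) S) :=
    {x | ∃ p ∈ x.verts, p.1 ∈ hfin.toFinset ∧ J ≤ p.2} with hE₂
  set E₃ : Set (SpinGraph (V × ℕ) S) := {x | ¬ ((∀ p, x.spin p ∈
    RandomGrammar.possibleSpins 𝓖 α p) ∧ ∀ p ∈ x.verts, p.1 ∈ α.verts)} with hE₃
  have hmem : ∀ x, x ∉ E₂ → x ∉ E₃ → ∀ q ∈ x.verts, α.graph.dist v q.1 < M →
      q ∈ hfin.toFinset ×ˢ Finset.range J := by
    intro x h2 h3 q hq hqM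
    have h4 : q.1 ∈ α.verts := (not_not.1 h3).2 q hq
    have h5 : q.1 ∈ hfin.toFinset := (hB _).2 ((hα.2.2.1.mem_ball_iff hv h4).2 hqM.le)
    refine Finset.mem_product.2 ⟨h5, Finset.mem_range.2 (lt_of_not_ge fun h6 => h2 ⟨q, hq, h5, h6⟩)⟩
  have hsub : ∀ x, ((∃ p ∈ x.verts, p.1 = v ∧ ∃ q ∈ x.ball p R,
      q ∉ hfin.toFinset ×ˢ Finset.range J) ∨
      ∀ p ∈ x.verts, p ∉ hfin.toFinset ×ˢ Finset.range J) → x ∈ E₁ ∨ x ∈ E₂ ∨ x ∈ E₃ := by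
    intro x hx
    by_contra hcon
    push Not at hcon
    obtain ⟨h1, h2, h3⟩ := hcon
    refine h1 (hx.imp ?_ ?_)
    · rintro ⟨p, hp, hpv, q, hq, hqW⟩
      exact ⟨p, hp, hpv, q, hq, le_of_not_gt fun h4 =>
        hqW (hmem x h2 h3 q (ball_subset_verts hp R hq) h4)⟩
    · exact fun h4 p hp => le_of_not_gt fun h5 => h4 p hp (hmem x h2 h3 p hp h5)
  calc _ ≤ 𝓖.semigroup t (E₁.indicator 1 + (E₂.indicator 1 + E₃.indicator 1)) (α.initial o N) := by
        refine RandomGrammar.semigroup_mono (fun x => ?_) _ _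
        refine Set.indicator_le' (f := 1) (fun x hx => ?_) (fun _ _ => zero_le) x
        rcases hsub x hx with h1 | h1 | h1 <;>
          simp only [Pi.add_apply, Set.indicator_of_mem h1, Pi.one_apply]
        · exact le_self_add
        · exact le_self_add.trans le_add_self
        · exact le_add_self.trans le_add_self
    _ ≤ ε / 2 + (ε / 2 + 0) := by
        rw [h.semigroup_add _ _ _ (inGF_initial hα ho N),
          h.semigroup_add _ _ _ (inGF_initial hα ho N)]
        exact add_le_add ((hle v R M N (hN (mem_ball_self _ _ _))).trans hM) (add_le_add
          ((h.semigroup_snd_le hc hα ho ⟨v, (hB v).2 (mem_ball_self _ _ _)⟩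
            (fun u hu => hN ((hB u).1 hu)) t.2 hJ0).trans hJ)
          (h.semigroup_impossible hα ho t.2 N).le)
    _ = ε := by rw [add_zero, ENNReal.add_halves]

/-- Emptiness implies that no vertex lies in `W`, a local event whose finite-volume probabilities
are small, uniformly for large volumes, by tightness. -/
theorem ae_nonempty (hX : IsDynamics 𝓖 α o P X) : ∀ᵐ ω ∂P, (X t ω).verts.Nonempty := by
  have hset : {ω | ¬ (X t ω).verts.Nonempty} = {ω | (X t ω).verts = ∅} := by
    ext ω; simp [Set.not_nonempty_iff_eq_empty]
  rw [ae_iff, hset]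
  refine le_antisymm (le_of_forall_gt_imp_ge_of_dense fun ε hε => ?_) zero_le
  obtain ⟨W, hW⟩ := exists_finset_semigroup_le h hc hα ho t ho 0 hε
  refine (measure_mono ?_).trans (hX.measure_le h hα ho t W (E := {x | ∀ p ∈ W, p ∉ x.verts})
    (fun x y hxy hx p hp => ?_) (hW.mono fun N hN => le_trans
      (RandomGrammar.semigroup_mono (Set.indicator_le_indicator_of_subset
        (fun x (hx : ∀ p ∈ W, p ∉ x.verts) => Or.inr fun p hp hpW => hx p hpW hp)
        fun _ => zero_le) _ _) hN))
  · intro ω hω p _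
    rw [Set.mem_ofPred_eq] at hω
    rw [hω]
    exact Set.notMem_empty p
  · change ¬ (y.spin p).isSome
    rw [← hxy.1 p hp]
    exact hx p hp

/-- A ball with few vertices is neither a local nor an increasing event. With probability up to `ε /
2` lost, the ball is contained in a finite set `W` of labels, where the event becomes local; the
failure of containment is itself an increasing event. The loss occurs once in the limit and once in
finite volume. -/
theorem measure_ball_le [Countable V] (hX : IsDynamics 𝓖 α o P X) : ∃ K θ₀ θ₁ : ℝ, 0 ≤ K ∧ 1 < θ₀ ∧
    1 ≤ θ₁ ∧ ∀ v ∈ α.verts, ∀ r R m : ℕ,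
      P {ω | ∃ p ∈ (X t ω).verts, p.1 = v ∧ ((X t ω).ball p R).ncard < m} ≤
        ENNReal.ofReal (K * ((α.ball v r).ncard * θ₁ ^ r / θ₀ ^ R + m / (α.ball v r).ncard)) := by
  obtain ⟨K, θ₀, θ₁, hK, hθ₀, hθ₁, hle⟩ := h.exists_semigroup_ball_le hc hα ho t.2
  refine ⟨K, θ₀, θ₁, hK, hθ₀, hθ₁, fun v hv r R m => ?_⟩
  have hfin := ball_finite hα.2.2.2 v r
  have hB : ∀ u, u ∈ hfin.toFinset ↔ u ∈ α.ball v r := fun u => by simp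
  rw [Set.ncard_eq_toFinset_card _ hfin]
  refine ENNReal.le_of_forall_pos_le_add fun ε hε _ => ?_
  have hε2 : (0 : ℝ≥0∞) < ε / 2 := ENNReal.half_pos (by exact_mod_cast hε.ne')
  obtain ⟨W, hW⟩ := exists_finset_semigroup_le h hc hα ho t hv R hε2
  set E₀ : Set (SpinGraph (V × ℕ) S) :=
    {x | ∃ p ∈ x.verts, p.1 = v ∧ (x.ball p R).ncard < m} with hE₀
  set E₁ : Set (SpinGraph (V × ℕ) S) :=
    {x | ∃ p ∈ x.verts, p.1 = v ∧ ∃ q ∈ x.ball p R, q ∉ W} with hE₁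
  set E₂ : Set (SpinGraph (V × ℕ) S) :=
    {x | ∃ p ∈ x.verts, p ∈ W ∧ p.1 = v ∧ ((x.restrict W).ball p R).ncard < m} with hE₂
  have hW₁ : ∀ᶠ N in atTop, 𝓖.semigroup t (E₁.indicator 1) (α.initial o N) ≤ ε / 2 :=
    hW.mono fun N hN => le_trans (RandomGrammar.semigroup_mono
      (Set.indicator_le_indicator_of_subset (fun x hx => Or.inl hx) fun _ => zero_le) _ _) hN
  have h1 : P {ω | X t ω ∈ E₁} ≤ ε / 2 := by
    refine (measure_mono fun ω hω => ?_).trans (hX.measure_le_of_monotone h hα ho t (E := E₁)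
      (fun x y h1 h2 ⟨p, hp, hpv, q, hq, hqW⟩ =>
        ⟨p, h1 hp, hpv, q, ball_mono_graph h2 p R hq, hqW⟩) hW₁)
    obtain ⟨p, hp, hpv, q, hq, hqW⟩ := hω
    obtain ⟨W', hpW', hqW'⟩ := exists_finset_mem_ball_restrict hq
    refine ⟨W', p, ?_, hpv, q, hqW', hqW⟩
    rw [verts_restrict]
    exact ⟨hp, hpW'⟩
  have hball : ∀ x ∉ E₁, ∀ p ∈ x.verts, p.1 = v → (x.restrict W).ball p R = x.ball p R := by
    intro x hx p hp hpv
    refine ball_restrict (fun q hq => ?_) le_rfl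
    by_contra hqW
    exact hx ⟨p, hp, hpv, q, hq, hqW⟩
  have h2 : P {ω | X t ω ∈ E₂} ≤ ENNReal.ofReal
      (K * (hfin.toFinset.card * θ₁ ^ r / θ₀ ^ R + m / hfin.toFinset.card)) + ε / 2 := by
    refine hX.measure_le h hα ho t W (E := E₂) ?_ ?_
    · rintro x y hxy ⟨p, hp, hpW, hpv, hpm⟩
      refine ⟨p, ?_, hpW, hpv, ?_⟩
      · change (y.spin p).isSome
        rw [← hxy.1 p hpW]
        exact hp
      · rwa [← agreeOn_iff_restrict_eq.1 hxy]
    · filter_upwards [hW₁, eventually_ball_subset hα.2.2.1 ho hv r] with N hN hNr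
      calc 𝓖.semigroup t (E₂.indicator 1) (α.initial o N)
          ≤ 𝓖.semigroup t (E₀.indicator 1 + E₁.indicator 1) (α.initial o N) := by
            refine RandomGrammar.semigroup_mono (fun x => ?_) _ _
            refine Set.indicator_le' (f := 1) (fun x hx => ?_) (fun _ _ => zero_le) x
            by_cases hx1 : x ∈ E₁
            · simp only [Pi.add_apply, Set.indicator_of_mem hx1, Pi.one_apply]
              exact le_add_self
            · have hx0 : x ∈ E₀ := by
                obtain ⟨p, hp, -, hpv, hpm⟩ := hx
                exact ⟨p, hp, hpv, by rwa [← hball x hx1 p hp hpv]⟩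
              simp only [Pi.add_apply, Set.indicator_of_mem hx0, Pi.one_apply]
              exact le_self_add
        _ ≤ _ := by
            rw [h.semigroup_add _ _ _ (inGF_initial hα ho N)]
            exact add_le_add (hle v _ r R m N ⟨v, (hB v).2 (mem_ball_self _ _ _)⟩
              (fun u hu => (hB u).1 hu) hNr) hN
  calc P {ω | X t ω ∈ E₀} ≤ P ({ω | X t ω ∈ E₂} ∪ {ω | X t ω ∈ E₁}) := by
        refine measure_mono fun ω hω => ?_
        by_cases hx1 : X t ω ∈ E₁
        · exact Or.inr hx1
        · obtain ⟨p, hp, hpv, hpm⟩ := hω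
          have hpW : p ∈ W := by
            by_contra hpW
            exact hx1 ⟨p, hp, hpv, p, mem_ball_self _ _ _, hpW⟩
          exact Or.inl ⟨p, hp, hpW, hpv, by rwa [hball _ hx1 p hp hpv]⟩
    _ ≤ P {ω | X t ω ∈ E₂} + P {ω | X t ω ∈ E₁} := measure_union_le _ _
    _ ≤ _ := add_le_add h2 h1
    _ = _ := by rw [add_assoc, ENNReal.add_halves]

end Tight

end IsDynamics

end GraphGrammar

/-! ### Growth exponents along dyadic radii and Borel–Cantelli. -/

namespace GraphGrammar

open SpinGraph

theorem tendsto_log_mul_div_log {C : ℕ} (hC : 0 < C) :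
    Tendsto (fun N : ℕ => Real.log ((C * N : ℕ) : ℝ) / Real.log N) atTop (𝓝 1) := by
  have hlog : Tendsto (fun N : ℕ => Real.log (N : ℝ)) atTop atTop :=
    Real.tendsto_log_atTop.comp tendsto_natCast_atTop_atTop
  have h1 : Tendsto (fun N : ℕ => Real.log (C : ℝ) / Real.log N + 1) atTop (𝓝 1) := by
    simpa using (hlog.const_div_atTop (Real.log (C : ℝ))).add_const 1
  refine h1.congr' ?_
  filter_upwards [eventually_ge_atTop 2] with N hN
  have h2 : 0 < Real.log (N : ℝ) := Real.log_pos (by exact_mod_cast hN)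
  have h3 : (N : ℝ) ≠ 0 := by positivity
  rw [Nat.cast_mul, Real.log_mul (by positivity) h3]
  field_simp

theorem tendsto_log_natDiv_div_log {C : ℕ} (hC : 0 < C) :
    Tendsto (fun N : ℕ => Real.log ((N / C : ℕ) : ℝ) / Real.log N) atTop (𝓝 1) := by
  have hlog : Tendsto (fun N : ℕ => Real.log (N : ℝ)) atTop atTop :=
    Real.tendsto_log_atTop.comp tendsto_natCast_atTop_atTop
  have h1 : Tendsto (fun N : ℕ => 1 - Real.log (2 * C : ℝ) / Real.log N) atTop (𝓝 1) := by
    simpa using (hlog.const_div_atTop (Real.log (2 * C : ℝ))).const_sub 1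
  refine tendsto_of_tendsto_of_tendsto_of_le_of_le' h1 tendsto_const_nhds ?_ ?_
  · filter_upwards [eventually_ge_atTop (max 2 C)] with N hN
    have hN2 : 2 ≤ N := (le_max_left _ _).trans hN
    have hM : 1 ≤ N / C := (Nat.one_le_div_iff hC).2 ((le_max_right _ _).trans hN)
    have h2 : 0 < Real.log (N : ℝ) := Real.log_pos (by exact_mod_cast hN2)
    have h3 : N ≤ 2 * C * (N / C) := by
      have h4 := Nat.div_add_mod N C
      have h5 := Nat.mod_lt N hC
      nlinarith
    have h6 : Real.log (N : ℝ) ≤ Real.log (2 * C : ℝ) + Real.log ((N / C : ℕ) : ℝ) := by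
      rw [← Real.log_mul (by positivity) (by positivity)]
      exact Real.log_le_log (by positivity) (by exact_mod_cast h3)
    rw [sub_le_iff_le_add, ← add_div, le_div_iff₀ h2, one_mul]
    linarith
  · filter_upwards [eventually_ge_atTop (max 2 C)] with N hN
    have hN2 : 2 ≤ N := (le_max_left _ _).trans hN
    have hM : 1 ≤ N / C := (Nat.one_le_div_iff hC).2 ((le_max_right _ _).trans hN)
    have h2 : 0 < Real.log (N : ℝ) := Real.log_pos (by exact_mod_cast hN2)
    rw [div_le_one h2]
    exact Real.log_le_log (by positivity) (by exact_mod_cast Nat.div_le_self N C)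

/-- Growth exponents do not change under rescaling and subpolynomial factors. -/
theorem tendsto_log_div_log_of_comparable {a b : ℕ → ℕ} (ha : ∀ N, 1 ≤ a N) (hb : ∀ N, 1 ≤ b N)
    (hbm : Monotone b) {C : ℕ} (hC : 0 < C) {g : ℕ → ℝ} (hg : ∀ᶠ N in atTop, 0 < g N)
    (hg0 : Tendsto (fun N : ℕ => Real.log (g N) / Real.log N) atTop (𝓝 0))
    (hba : ∀ᶠ N in atTop, (b N : ℝ) ≤ g N * a (C * N))
    (hab : ∀ᶠ N in atTop, (a N : ℝ) ≤ g N * b (C * N)) {d : EReal}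
    (hd : Tendsto (fun N : ℕ => ((Real.log (a N) / Real.log N : ℝ) : EReal)) atTop (𝓝 d)) :
    Tendsto (fun N : ℕ => ((Real.log (b N) / Real.log N : ℝ) : EReal)) atTop (𝓝 d) := by
  set u : ℕ → ℝ := fun N => Real.log (a N) / Real.log N with hu
  set v : ℕ → ℝ := fun N => Real.log (b N) / Real.log N with hv
  set e : ℕ → ℝ := fun N => Real.log (g N) / Real.log N with he
  set r : ℕ → ℝ := fun N => Real.log ((C * N : ℕ) : ℝ) / Real.log N with hr
  set s : ℕ → ℝ := fun N => Real.log ((N / C : ℕ) : ℝ) / Real.log N with hs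
  have hmul : Tendsto (fun N : ℕ => C * N) atTop atTop :=
    tendsto_atTop_mono (fun N => Nat.le_mul_of_pos_left N hC) tendsto_id
  have hdiv : Tendsto (fun N : ℕ => N / C) atTop atTop := Nat.tendsto_div_const_atTop hC.ne'
  have hr1 : Tendsto r atTop (𝓝 1) := tendsto_log_mul_div_log hC
  have hs1 : Tendsto s atTop (𝓝 1) := tendsto_log_natDiv_div_log hC
  have hup : ∀ᶠ N in atTop, v N ≤ e N + u (C * N) * r N := by
    filter_upwards [eventually_ge_atTop 2, hg, hba] with N hN hgN hN'
    have h1 : 0 < Real.log (N : ℝ) := Real.log_pos (by exact_mod_cast hN)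
    have h2 : 0 < Real.log ((C * N : ℕ) : ℝ) :=
      Real.log_pos (by exact_mod_cast hN.trans (Nat.le_mul_of_pos_left N hC))
    have h3 : (0 : ℝ) < b N := by exact_mod_cast hb N
    have h4 : (a (C * N) : ℝ) ≠ 0 := by exact_mod_cast (Nat.lt_of_succ_le (ha (C * N))).ne'
    have h5 := Real.log_le_log h3 hN'
    rw [Real.log_mul hgN.ne' h4] at h5
    have h6 : u (C * N) * r N = Real.log (a (C * N)) / Real.log N := by
      simp only [hu, hr]
      field_simp
    rw [h6]
    simp only [hv, he]
    rw [← add_div]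
    exact div_le_div_of_nonneg_right h5 h1.le
  -- The comparison is used at radius `N / C`; since `C * (N / C) ≤ N`, monotonicity of `b`
  -- suffices.
  have hlow : ∀ᶠ N in atTop, u (N / C) * s N - e (N / C) * s N ≤ v N := by
    filter_upwards [hdiv.eventually (eventually_ge_atTop 2), hdiv.eventually hg,
      hdiv.eventually hab] with N hN hgN hN'
    have h1 : 0 < Real.log ((N / C : ℕ) : ℝ) := Real.log_pos (by exact_mod_cast hN)
    have h2 : 0 < Real.log (N : ℝ) :=
      Real.log_pos (by exact_mod_cast hN.trans (Nat.div_le_self N C))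
    have h3 : (0 : ℝ) < a (N / C) := by exact_mod_cast ha _
    have h4 : (0 : ℝ) < b N := by exact_mod_cast hb N
    have h5 : (b (C * (N / C)) : ℝ) ≤ b N := by exact_mod_cast hbm (Nat.mul_div_le N C)
    have h6 := Real.log_le_log h3 (hN'.trans (mul_le_mul_of_nonneg_left h5 hgN.le))
    rw [Real.log_mul hgN.ne' h4.ne'] at h6
    have h7 : u (N / C) * s N - e (N / C) * s N =
        (Real.log (a (N / C)) - Real.log (g (N / C))) / Real.log N := by
      simp only [hu, he, hs]
      field_simp
    rw [h7]
    exact div_le_div_of_nonneg_right (by linarith) h2.le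
  have he0 : Tendsto (fun N => e (N / C) * s N) atTop (𝓝 0) := by
    simpa using (hg0.comp hdiv).mul hs1
  have hu0 : ∀ᶠ N in atTop, 0 ≤ u N := Eventually.of_forall fun N =>
    div_nonneg (Real.log_natCast_nonneg _) (Real.log_natCast_nonneg _)
  induction d with
  | bot =>
    -- The quotients are nonnegative, which rules out the limit `-∞`.
    have h1 : (0 : EReal) ≤ ⊥ := ge_of_tendsto hd (hu0.mono fun N hN => by exact_mod_cast hN)
    exact absurd h1 (by simp)
  | coe d =>
    have hd' : Tendsto u atTop (𝓝 d) := EReal.tendsto_coe.1 hd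
    refine EReal.tendsto_coe.2 (tendsto_of_tendsto_of_tendsto_of_le_of_le' ?_ ?_ hlow hup)
    · simpa using ((hd'.comp hdiv).mul hs1).sub he0
    · simpa using hg0.add ((hd'.comp hmul).mul hr1)
  | top =>
    have hd' : Tendsto u atTop atTop := EReal.tendsto_coe_nhds_top_iff.1 hd
    refine EReal.tendsto_coe_nhds_top_iff.2 (tendsto_atTop_mono' _ hlow ?_)
    have h1 := (hd'.comp hdiv).atTop_mul_pos one_pos hs1
    simpa [sub_eq_add_neg] using h1.atTop_add he0.neg

/-- Growth exponents can be compared along powers of two. -/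
theorem tendsto_log_div_log_of_dyadic {a b : ℕ → ℕ} (ha : ∀ N, 1 ≤ a N) (hb : ∀ N, 1 ≤ b N)
    (ham : Monotone a) (hbm : Monotone b) {k : ℕ}
    (hba : ∀ᶠ j in atTop, b (2 ^ j) ≤ 2 * (j + 1) ^ 2 * a (2 ^ (j + k)))
    (hab : ∀ᶠ j in atTop, a (2 ^ j) ≤ 2 * (j + 1) ^ 2 * b (2 ^ (j + k))) {d : EReal}
    (hd : Tendsto (fun N : ℕ => ((Real.log (a N) / Real.log N : ℝ) : EReal)) atTop (𝓝 d)) :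
    Tendsto (fun N : ℕ => ((Real.log (b N) / Real.log N : ℝ) : EReal)) atTop (𝓝 d) := by
  have hlog : Tendsto (fun N : ℕ => Real.log (N : ℝ)) atTop atTop :=
    Real.tendsto_log_atTop.comp tendsto_natCast_atTop_atTop
  have key : ∀ {a b : ℕ → ℕ}, Monotone a → Monotone b →
      (∀ᶠ j in atTop, b (2 ^ j) ≤ 2 * (j + 1) ^ 2 * a (2 ^ (j + k))) →
      ∀ᶠ N : ℕ in atTop, (b N : ℝ) ≤ 32 * Real.log N ^ 2 * a (2 ^ (k + 1) * N) := by
    intro a b ham hbm h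
    have hlog2 : Tendsto (fun N : ℕ => Nat.log 2 N + 1) atTop atTop := by
      refine tendsto_atTop_mono (fun N => Nat.le_succ _) (tendsto_atTop.2 fun j => ?_)
      filter_upwards [eventually_ge_atTop (2 ^ j)] with N hN
      exact Nat.le_log_of_pow_le (by norm_num) hN
    -- For `N` between `2 ^ j` and `2 ^ (j + 1)` the hypothesis is used at `j + 1`. Its factor is `2
    -- * (j + 2) ^ 2`, and `j + 2 ≤ 4 * log N` yields 32.
    filter_upwards [hlog2.eventually h, eventually_ge_atTop 3] with N h1 hN
    set j := Nat.log 2 N with hj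
    have h2 : 2 ^ j ≤ N := Nat.pow_log_le_self 2 (by omega)
    have h3 : N ≤ 2 ^ (j + 1) := (Nat.lt_pow_succ_log_self (by norm_num) N).le
    have h4 : b N ≤ 2 * (j + 1 + 1) ^ 2 * a (2 ^ (k + 1) * N) := by
      refine (hbm h3).trans (h1.trans (Nat.mul_le_mul_left _ (ham ?_)))
      calc 2 ^ (j + 1 + k) = 2 ^ (k + 1) * 2 ^ j := by ring
        _ ≤ _ := Nat.mul_le_mul_left _ h2
    have h5 : (1 : ℝ) ≤ Real.log N := by
      rw [Real.le_log_iff_exp_le (by positivity)]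
      have h6 : (3 : ℝ) ≤ N := by exact_mod_cast hN
      linarith [Real.exp_one_lt_d9]
    have h7 : (j : ℝ) * Real.log 2 ≤ Real.log N := by
      rw [← Real.log_pow]
      exact Real.log_le_log (by positivity) (by exact_mod_cast h2)
    have h8 : (j : ℝ) + 2 ≤ 4 * Real.log N := by
      have h9 := Real.log_two_gt_d9
      have h10 : (j : ℝ) * 0.6 ≤ (j : ℝ) * Real.log 2 :=
        mul_le_mul_of_nonneg_left (by linarith) (Nat.cast_nonneg _)
      linarith
    have h11 : (b N : ℝ) ≤ 2 * ((j : ℝ) + 1 + 1) ^ 2 * a (2 ^ (k + 1) * N) := by exact_mod_cast h4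
    refine h11.trans (mul_le_mul_of_nonneg_right ?_ (Nat.cast_nonneg _))
    have h12 : ((j : ℝ) + 2) ^ 2 ≤ (4 * Real.log N) ^ 2 := pow_le_pow_left₀ (by positivity) h8 2
    linarith
  refine tendsto_log_div_log_of_comparable (g := fun N => 32 * Real.log N ^ 2) ha hb hbm
    (C := 2 ^ (k + 1)) (by positivity) ?_ ?_ (key ham hbm hba) (key hbm ham hab) hd
  · filter_upwards [hlog.eventually_gt_atTop 0] with N hN
    positivity
  · have h1 : Tendsto (fun N : ℕ => Real.log 32 / Real.log N +
        2 * (Real.log (Real.log N) / Real.log N)) atTop (𝓝 0) := by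
      simpa using (hlog.const_div_atTop (Real.log 32)).add
        ((Real.isLittleO_log_id_atTop.tendsto_div_nhds_zero.comp hlog).const_mul 2)
    refine h1.congr' ?_
    filter_upwards [hlog.eventually_gt_atTop 0] with N hN
    rw [Real.log_mul (by norm_num) (by positivity), Real.log_pow]
    push_cast
    ring

/-- A fixed number `k` of additional doublings of the radius beats any exponential growth `w`: it is
enough that `w * ρ ^ 2 ^ k ≤ 1 / 2`. -/
theorem eventually_pow_mul_pow_le {w ρ : ℝ} (hw : 0 ≤ w) (hρ : 0 ≤ ρ) (hρ1 : ρ < 1) :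
    ∀ᶠ k : ℕ in atTop, ∀ j : ℕ, w ^ 2 ^ j * ρ ^ 2 ^ (j + k) ≤ (1 / 2) ^ j := by
  have h1 : Tendsto (fun k : ℕ => w * ρ ^ 2 ^ k) atTop (𝓝 0) := by
    simpa using ((tendsto_pow_atTop_nhds_zero_of_lt_one hρ hρ1).comp
      (tendsto_pow_atTop_atTop_of_one_lt (one_lt_two : 1 < 2))).const_mul w
  filter_upwards [(tendsto_order.1 h1).2 (1 / 2) (by norm_num)] with k hk j
  calc w ^ 2 ^ j * ρ ^ 2 ^ (j + k) = (w * ρ ^ 2 ^ k) ^ 2 ^ j := by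
        rw [mul_pow, ← pow_mul, ← pow_add, add_comm k]
    _ ≤ (1 / 2) ^ 2 ^ j := pow_le_pow_left₀ (by positivity) hk.le _
    _ ≤ (1 / 2) ^ j := pow_le_pow_of_le_one (by norm_num) (by norm_num) Nat.lt_two_pow_self.le

/-- The first Borel–Cantelli lemma, with a summable bound. -/
theorem ae_eventually_notMem_of_summable {Ω : Type*} [MeasurableSpace Ω] {P : Measure Ω}
    {E : ℕ → Set Ω} {f : ℕ → ℝ} (hf : Summable f) (hE : ∀ j, P (E j) ≤ ENNReal.ofReal (f j)) :
    ∀ᵐ ω ∂P, ∀ᶠ j in atTop, ω ∉ E j :=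
  ae_eventually_notMem (ne_top_of_le_ne_top hf.tsum_ofReal_ne_top (ENNReal.tsum_le_tsum hE))

theorem summable_one_div_succ_sq : Summable fun j : ℕ => 1 / ((j : ℝ) + 1) ^ 2 := by
  have h := (summable_nat_add_iff 1).2 (Real.summable_one_div_nat_pow.2 one_lt_two)
  exact_mod_cast h

namespace IsDynamics

variable {S V Ω : Type*} [MeasurableSpace Ω] {𝓖 : RandomGrammar S} {n C : ℕ} {c : ℝ}
  {U U' : ∀ x : SpinGraph (V × ℕ) S, 𝓖.Occurrence x → Finset (V × ℕ)}
  {α : SpinGraph V S} {o : V} {P : Measure Ω} {X : ℝ≥0 → Ω → SpinGraph (V × ℕ) S}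
  [IsProbabilityMeasure P] [Countable V]

/-- Comparison of the growth of the neighbourhoods of a vertex at time `t` and of its ancestor. -/
theorem exists_ae_eventually (hX : IsDynamics 𝓖 α o P X) (h : 𝓖.Controlled V n C c U U')
    (hc : 0 ≤ c) (hα : α.InGC n) (ho : o ∈ α.verts) (t : ℝ≥0) :
    ∃ k : ℕ, ∀ v ∈ α.verts, ∀ᵐ ω ∂P, ∀ᶠ j : ℕ in atTop, ∀ p ∈ (X t ω).verts, p.1 = v →
      ((X t ω).ball p (2 ^ j)).Finite ∧
      ((X t ω).ball p (2 ^ j)).ncard ≤ (j + 1) ^ 2 * (α.ball v (2 ^ (j + k))).ncard ∧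
      (α.ball v (2 ^ j)).ncard / (j + 1) ^ 2 ≤ ((X t ω).ball p (2 ^ (j + k))).ncard := by
  obtain ⟨K, ρ, hK, hρ, hρ1, hdist⟩ := hX.measure_dist_le h hα ho t hc
  obtain ⟨K', θ₀, θ₁, hK', hθ₀, hθ₁, hball⟩ := measure_ball_le h hc hα ho t hX
  have hn : (0 : ℝ) ≤ n := Nat.cast_nonneg n
  have hθ : 0 < θ₀ := one_pos.trans hθ₀
  -- One `k` serves both directions. The second base combines the crude bound `(n + 1) ^ r` for the
  -- volume of a ball with the factor `θ₁ ^ r` of the distance moment.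
  obtain ⟨k, hk, hk'⟩ := ((eventually_pow_mul_pow_le (w := 4 * (n + 1)) (by positivity) hρ.le
    hρ1).and (eventually_pow_mul_pow_le (w := (n + 1) * θ₁) (by positivity)
    (inv_nonneg.2 hθ.le) (inv_lt_one_of_one_lt₀ hθ₀))).exists
  have hgeo : Summable fun j : ℕ => (1 / 2 : ℝ) ^ j :=
    summable_geometric_of_lt_one (by norm_num) (by norm_num)
  have hpos : ∀ v R, 0 < (α.ball v R).ncard := fun v R =>
    (Set.ncard_pos (ball_finite hα.2.2.2 v R)).2 ⟨v, mem_ball_self _ _ _⟩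
  refine ⟨k, fun v hv => ?_⟩
  have h1 := ae_eventually_notMem_of_summable (P := P) (hgeo.mul_left K)
    (E := fun j => {ω | ∃ p ∈ (X t ω).verts, p.1 = v ∧ ∃ q ∈ (X t ω).ball p (2 ^ j),
      2 ^ (j + k) ≤ α.graph.dist v q.1}) fun j => (hdist v hv (2 ^ j) (2 ^ (j + k))).trans
      (ENNReal.ofReal_le_ofReal (by
        rw [mul_assoc]
        exact mul_le_mul_of_nonneg_left (hk j) hK))
  have h2 := ae_eventually_notMem_of_summable (P := P)
    (summable_one_div_succ_sq.mul_left (Real.exp (c * C * t)))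
    (E := fun j => {ω | ∃ s : Finset (V × ℕ), (∀ p ∈ s, p ∈ (X t ω).verts ∧
      p.1 ∈ α.ball v (2 ^ (j + k))) ∧ (j + 1) ^ 2 * (α.ball v (2 ^ (j + k))).ncard ≤ s.card})
    fun j => (hX.measure_card_le h hα ho t hv (2 ^ (j + k))
      (Nat.mul_pos (by positivity) (hpos v _))).trans (ENNReal.ofReal_le_ofReal (by
        refine mul_le_mul_of_nonneg_left (le_of_eq ?_) (Real.exp_pos _).le
        have : ((α.ball v (2 ^ (j + k))).ncard : ℝ) ≠ 0 := by exact_mod_cast (hpos v _).ne'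
        push_cast
        field_simp))
  -- Asking for only a fraction `1 / (j + 1) ^ 2` of the initial volume makes the second error term
  -- summable.
  have h3 := ae_eventually_notMem_of_summable (P := P)
    ((hgeo.add summable_one_div_succ_sq).mul_left K')
    (E := fun j => {ω | ∃ p ∈ (X t ω).verts, p.1 = v ∧ ((X t ω).ball p (2 ^ (j + k))).ncard <
      (α.ball v (2 ^ j)).ncard / (j + 1) ^ 2})
    fun j => (hball v hv (2 ^ j) (2 ^ (j + k)) _).trans (ENNReal.ofReal_le_ofReal (by
        refine mul_le_mul_of_nonneg_left (add_le_add ?_ ?_) hK'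
        · refine le_trans ?_ (hk' j)
          have h4 : ((α.ball v (2 ^ j)).ncard : ℝ) ≤ (n + 1) ^ 2 ^ j := by
            exact_mod_cast ball_ncard_le hα.2.2.2 v (2 ^ j)
          rw [mul_pow, inv_pow, ← div_eq_mul_inv]
          gcongr
        · have h4 : (0 : ℝ) < (α.ball v (2 ^ j)).ncard := by exact_mod_cast hpos v _
          rw [div_le_iff₀ h4, one_div, inv_mul_eq_div]
          refine Nat.cast_div_le.trans (le_of_eq ?_)
          push_cast
          rfl))
  filter_upwards [h1, h2, h3, hX.ae_fst_mem h hα ho t] with ω h1 h2 h3 h0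
  filter_upwards [h1, h2, h3] with j h1 h2 h3 p hp hpv
  have hsub : ∀ q ∈ (X t ω).ball p (2 ^ j), q ∈ (X t ω).verts ∧ q.1 ∈ α.ball v (2 ^ (j + k)) := by
    intro q hq
    have hqx := ball_subset_verts hp _ hq
    refine ⟨hqx, (hα.2.2.1.mem_ball_iff hv (h0 q hqx)).2 (le_of_not_ge fun hle => ?_)⟩
    exact h1 ⟨p, hp, hpv, q, hq, hle⟩
  have hfin : ((X t ω).ball p (2 ^ j)).Finite := by
    by_contra hinf
    -- Finiteness is proved separately since `ncard` is 0 for infinite sets: an infinite ball would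
    -- contain a finite set of the excluded size.
    obtain ⟨s, hs, hcard⟩ := Set.Infinite.exists_subset_card_eq hinf
      ((j + 1) ^ 2 * (α.ball v (2 ^ (j + k))).ncard)
    exact h2 ⟨s, fun q hq => hsub q (hs hq), hcard.ge⟩
  refine ⟨hfin, le_of_not_ge fun hle => ?_, le_of_not_gt fun hlt => h3 ⟨p, hp, hpv, hlt⟩⟩
  refine h2 ⟨hfin.toFinset, fun q hq => hsub q (hfin.mem_toFinset.1 hq), ?_⟩
  rwa [← Set.ncard_eq_toFinset_card _ hfin]

theorem ae_hasScalingMacrodim (hX : IsDynamics 𝓖 α o P X) (h : 𝓖.Controlled V n C c U U')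
    (hc : 0 ≤ c) (hα : α.InGC n) (ho : o ∈ α.verts) {d : EReal} (hd : α.HasScalingMacrodim d)
    (t : ℝ≥0) : ∀ᵐ ω ∂P, (X t ω).HasScalingMacrodim d := by
  obtain ⟨k, hk⟩ := hX.exists_ae_eventually h hc hα ho t
  filter_upwards [ae_nonempty h hc hα ho t hX, hX.ae_fst_mem h hα ho t,
    (ae_ball_iff α.verts.to_countable).2 hk] with ω h1 h2 h3
  refine ⟨h1, fun p hp => ?_⟩
  have h4 := (h3 p.1 (h2 p hp)).mono fun j hj => hj p hp rfl
  have hfin : ∀ N, ((X t ω).ball p N).Finite := by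
    intro N
    obtain ⟨j, hj, hjN⟩ := (h4.and (eventually_ge_atTop N)).exists
    exact hj.1.subset (ball_mono _ _ (hjN.trans Nat.lt_two_pow_self.le))
  have hα' := hd.2 p.1 (h2 p hp)
  refine ⟨hfin, tendsto_log_div_log_of_dyadic (k := k)
    (fun N => (Set.ncard_pos (hα'.1 N)).2 ⟨p.1, mem_ball_self _ _ _⟩)
    (fun N => (Set.ncard_pos (hfin N)).2 ⟨p, mem_ball_self _ _ _⟩)
    (fun N M hNM => Set.ncard_le_ncard (ball_mono _ _ hNM) (hα'.1 M))
    (fun N M hNM => Set.ncard_le_ncard (ball_mono _ _ hNM) (hfin M))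
    (h4.mono fun j hj => hj.2.1.trans ?_) (h4.mono fun j hj => ?_) hα'.2⟩
  · exact Nat.mul_le_mul_right _ (Nat.le_mul_of_pos_left _ two_pos)
  · have h5 : 0 < (j + 1) ^ 2 := by positivity
    have h6 : 1 ≤ ((X t ω).ball p (2 ^ (j + k))).ncard :=
      (Set.ncard_pos (hfin _)).2 ⟨p, mem_ball_self _ _ _⟩
    -- The quotient in `exists_ae_eventually` is rounded down. Undoing this costs `b + 1 ≤ 2 * b`,
    -- the source of the factor 2 in `tendsto_log_div_log_of_dyadic`.
    have h7 := (Nat.div_lt_iff_lt_mul h5).1 (Nat.lt_succ_of_le hj.2.2)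
    nlinarith

end IsDynamics

end GraphGrammar

end

theorem mainTheorem1 {S : Type*} (𝓖 : GraphGrammar.RandomGrammar S)
    (hlocal : 𝓖.IsLocal) (hbounded : 𝓖.IsLocallyBounded) (hreversible : 𝓖.IsLocallyReversible)
    {V : Type} [Countable V] (n : ℕ) (α : GraphGrammar.SpinGraph V S) (hα : α.InGC n)
    (o : V) (ho : o ∈ α.verts) (d : EReal) (hd : α.HasScalingMacrodim d)
    {Ω : Type*} [MeasurableSpace Ω] (P : MeasureTheory.Measure Ω)
    [MeasureTheory.IsProbabilityMeasure P] (X : ℝ≥0 → Ω → GraphGrammar.SpinGraph (V × ℕ) S)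
    (hX : GraphGrammar.IsDynamics 𝓖 α o P X) :
    ∀ t : ℝ≥0, ∀ᵐ ω ∂P, (X t ω).HasScalingMacrodim d := by
  intro t
  obtain ⟨n₀, hn₀⟩ := 𝓖.exists_controlled hlocal hbounded V
  -- The degree bound is raised to a value for which the classes are invariant.
  obtain ⟨C, c, U, U', hc, h⟩ := hn₀ (max n n₀) (le_max_right _ _)
  exact hX.ae_hasScalingMacrodim h hc.le (hα.mono (le_max_left _ _)) ho hd t
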